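/- Let $\gamma\in(0,1]$, $N:=\lfloor 1/\gamma\rfloor$, $T>0$. Words are finite words in the alphabet $\{1,\dots,d\}$, $|w|$ is the length of $w$, $\varepsilon$ the empty word. **Driver.** Let $\mathbf W$ be a weakly geometric $\gamma$-Hölder rough path on $[0,T]$: a path in the group $G^{(N)}$ of step-$N$ truncated characters of the shuffle algebra over $\mathbb R^d$ (so $\langle \mathbf W_t,e_\varepsilon\rangle=1$ and $\langle\mathbf W_t,e_u \mathbin{\sqcup\!\sqcup} e_v\rangle=\langle\mathbf W_t,e_u\rangle\langle\mathbf W_t,e_v\rangle$ for $|u|+|v|\le N$) whose increments $\mathbf W_{st}=\mathbf W_s^{-1}\star\mathbf W_t$, with $\langle g\star h,e_w\rangle=\sum_{uv=w}\langle g,e_u\rangle\langle h,e_v\rangle$, satisfy $|\langle\mathbf W_{st},e_w\rangle|\le C|t-s|^{|w|\gamma}$ for all $|w|\le N$. **Vector fields.** Let $f_1,\dots,f_d\in C_b^{2N+1}(\mathbb R^n;\mathbb R^n)$ (bounded together with all derivatives up to order $2N+1$). Put $\Gamma_i\phi=f_i\cdot D\phi$, $\Gamma_{i_1\cdots i_m}=\Gamma_{i_1}\circ\cdots\circ\Gamma_{i_m}$,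 $\Gamma_\varepsilon=\mathrm{id}$, and $F_w=\Gamma_w\mathrm{id}$ (so $F_\varepsilon=\mathrm{id}$ and $F_{iw}=DF_w\,f_i$). **Controlled paths.** $\mathbf X=(\langle e_w^*,\mathbf X_t\rangle)_{|w|<N}$ is controlled by $\mathbf W$ if every coefficient is $\gamma$-Hölder on $[0,T]$ and $$\Bigl|\langle e_w^*,\mathbf X_t\rangle-\sum_{|v|<N-|w|}\langle e_{vw}^*,\mathbf X_s\rangle\langle\mathbf W_{st},e_v\rangle\Bigr|\le C|t-s|^{(N-|w|)\gamma},\qquad s<t .$$ The rough integral $\int_0^t\mathbf X_u\,d\mathbf W^i_u$ has $\varepsilon$-coefficient $\lim_{|\pi|\to0}\sum_{[a,b]\in\pi}\sum_{|w|<N}\langle e_w^*,\mathbf X_a\rangle\langle\mathbf W_{ab},e_{wi}\rangle$ over partitions $\pi$ of $[0,t]$, $e_{wi}$-coefficient $\langle e_w^*,\mathbf X_t\rangle$, and all other coefficients $0$; $\int_s^t:=\int_0^t-\int_0^s$. The lift $f_i(\mathbf X)$ has coefficients $$\langle e_w^*,f_i(\mathbf X)_t\rangle=\sum_{k}\frac1{k!}\sum_{u_1,\dots,u_k\ne\varepsilon}\langle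 e_w^*,e_{u_1}\mathbin{\sqcup\!\sqcup}\cdots\mathbin{\sqcup\!\sqcup} e_{u_k}\rangle\,D^kf_i(X_t)\bigl(\langle e_{u_1}^*,\mathbf X_t\rangle,\dots,\langle e_{u_k}^*,\mathbf X_t\rangle\bigr),\qquad X_t=\langle e_\varepsilon^*,\mathbf X_t\rangle .$$ **RDE.** $X:[0,T]\to\mathbb R^n$ solves $dX_t=\sum_if_i(X_t)\,d\mathbf W^i_t$, $X_0=x$, if there is a controlled path $\mathbf X$ above $X$ with $\langle e_w^*,\mathbf X_0\rangle=F_w(x)$ for $|w|<N$ and $\mathbf X_t-\mathbf X_s=\sum_i\int_s^tf_i(\mathbf X)_u\,d\mathbf W^i_u$ (in all coefficients of order $<N$) for all $s,t\in[0,T]$. **Weak solutions.** Write $\nu(\phi)=\int\phi\,d\nu$. For a finite (nonnegative Borel) measure $\mu$ on $\mathbb R^n$, a family $(\rho_t)_{t\in[0,T]}$ of finite measures with $\rho_0=\mu$ is a measure-valued weak solution of the rough continuity equation $$d\rho_t=-\sum_{i=1}^d\operatorname{div}(f_i\rho_t)\,d\mathbf W^i_t$$ if for every $M$ there is a constant $C$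 such that for all $\phi\in C_b^{N+1}(\mathbb R^n)$ whose derivatives of orders $0,\dots,N+1$ are bounded by $M$, all words $w$ with $|w|\le N$ and all $0\le s<t\le T$, $$\Bigl|\rho_t(\Gamma_w\phi)-\sum_{|v|\le N-|w|}\rho_s(\Gamma_{vw}\phi)\,\langle\mathbf W_{st},e_v\rangle\Bigr|\le C\,|t-s|^{(N+1-|w|)\gamma}.$$ **Theorem.** For every $x\in\mathbb R^n$ the RDE has a unique solution $X^{0,x}$ on $[0,T]$, and $x\mapsto X^{0,x}_t$ is Borel measurable for each $t\in[0,T]$. For every finite measure $\mu$ there is a unique measure-valued weak solution $\rho$ with $\rho_0=\mu$. It is the pushforward of $\mu$ under the flow: for every $t\in[0,T]$, $\rho_t=(X^{0,\cdot}_t)_*\mu$, that is, $$\rho_t(\phi)=\int\phi(X^{0,x}_t)\,\mu(dx)\qquad\text{for all }\phi\in C_b^{N+1}(\mathbb R^n).$$ -/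

import Mathlib

open Set MeasureTheory

namespace RoughContinuity

/-! Words over the alphabet `{1, …, d}` are lists `List (Fin d)`; concatenation is `++`. An element of
the truncated tensor algebra or of its dual is recorded by its coefficients on words; coefficients on
words longer than the truncation level are never used. -/

/-- The sum of `g w` over all words `w` of length `< m`. -/
def sumWords {A : Type*} [AddCommMonoid A] {d : ℕ} (m : ℕ) (g : List (Fin d) → A) : A :=
  ∑ k ∈ Finset.range m, ∑ v : Fin k → Fin d, g (List.ofFn v)

/-- All shuffles of two words, listed with multiplicity: `e_u ⧢ e_v` is the sum of the `e_w` over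
this list. -/
def shuffles {α : Type*} : List α → List α → List (List α)
  | [], v => [v]
  | a :: u, [] => [a :: u]
  | a :: u, b :: v =>
      (shuffles u (b :: v)).map (fun w => a :: w) ++ (shuffles (a :: u) v).map (fun w => b :: w)
termination_by u v => u.length + v.length

/-- Step-`N` truncated characters of the shuffle algebra, i.e. elements of the group `G^{(N)}`. -/
def IsTruncatedCharacter {d : ℕ} (N : ℕ) (g : List (Fin d) → ℝ) : Prop :=
  g [] = 1 ∧ ∀ u v : List (Fin d), u.length + v.length ≤ N →
    ((shuffles u v).map g).sum = g u * g v

/-- Convolution product `⟨g ⋆ h, e_w⟩ = ∑_{uv = w} ⟨g, e_u⟩ ⟨h, e_v⟩`. -/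
def conv {d : ℕ} (g h : List (Fin d) → ℝ) (w : List (Fin d)) : ℝ :=
  ∑ k ∈ Finset.range (w.length + 1), g (w.take k) * h (w.drop k)

/-- The inverse `g ∘ S` of a character, `S` being the antipode. -/
def charInv {d : ℕ} (g : List (Fin d) → ℝ) (w : List (Fin d)) : ℝ :=
  (-1) ^ w.length * g w.reverse

/-- The increment `W_{st} = W_s⁻¹ ⋆ W_t`. -/
def incr {d : ℕ} (W : ℝ → List (Fin d) → ℝ) (s t : ℝ) : List (Fin d) → ℝ :=
  conv (charInv (W s)) (W t)

/-- The truncation level `N_γ = ⌊1/γ⌋`. -/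
noncomputable def level (γ : ℝ) : ℕ := ⌊γ⁻¹⌋₊

/-- `W` is a weakly geometric `γ`-Hölder rough path on `[0, T]`: a path in `G^{(N_γ)}` which is
`γ`-Hölder for a homogeneous norm, that is, coordinatewise,
`|⟨W_{st}, e_w⟩| ≲ |t - s|^{|w|γ}` for all words `w` with `|w| ≤ N_γ`. -/
def IsWeaklyGeometricRoughPath {d : ℕ} (γ T : ℝ) (W : ℝ → List (Fin d) → ℝ) : Prop :=
  (∀ t ∈ Icc 0 T, IsTruncatedCharacter (level γ) (W t)) ∧
  ∀ w : List (Fin d), w.length ≤ level γ →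
    ∃ C : ℝ, ∀ s ∈ Icc 0 T, ∀ t ∈ Icc 0 T, |incr W s t w| ≤ C * |t - s| ^ ((w.length : ℝ) * γ)

/-- The class `C^k_b`: `k` times continuously differentiable, the function and its derivatives up to
order `k` being bounded. -/
def IsCb {E F : Type*} [NormedAddCommGroup E] [NormedSpace ℝ E] [NormedAddCommGroup F]
    [NormedSpace ℝ F] (k : ℕ) (φ : E → F) : Prop :=
  ContDiff ℝ k φ ∧ ∀ j ≤ k, ∃ C : ℝ, ∀ x, ‖iteratedFDeriv ℝ j φ x‖ ≤ C

/-- `Γ_w φ = Γ_{i₁} (Γ_{i₂} (⋯ Γ_{iₘ} φ))` for `w = i₁ ⋯ iₘ`, where `Γ_i φ (x) = Dφ(x) f_i(x)`.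
For `φ = id` these are the functions `F_w`, with `F_ε = id` and `F_{iw} = DF_w f_i`. -/
noncomputable def Gam {E F : Type*} [NormedAddCommGroup E] [NormedSpace ℝ E] [NormedAddCommGroup F]
    [NormedSpace ℝ F] {d : ℕ} (f : Fin d → E → E) : List (Fin d) → (E → F) → E → F
  | [], φ => φ
  | i :: w, φ => fun x => fderiv ℝ (Gam f w φ) x (f i x)

/-- The `E`-valued path `X`, with coefficients `X t w = ⟨e_w^*, X_t⟩` for `|w| < N`, is controlled by
`W`: every coefficient is `γ`-Hölder and
`|⟨e_w^*, X_t⟩ - ⟨W_{st} ⋆ e_w^*, X_s⟩| ≲ |t - s|^{(N - |w|)γ}`. Here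
`⟨W_{st} ⋆ e_w^*, X_s⟩` is the sum of `⟨W_{st}, e_v⟩ ⟨e_{vw}^*, X_s⟩` over `|v| < N - |w|`. -/
def IsControlled {E : Type*} [NormedAddCommGroup E] [NormedSpace ℝ E] {d : ℕ} (N : ℕ) (γ T : ℝ)
    (W : ℝ → List (Fin d) → ℝ) (X : ℝ → List (Fin d) → E) : Prop :=
  ∀ w : List (Fin d), w.length < N →
    (∃ C : ℝ, ∀ s ∈ Icc 0 T, ∀ t ∈ Icc 0 T, ‖X t w - X s w‖ ≤ C * |t - s| ^ γ) ∧
    ∃ C : ℝ, ∀ s ∈ Icc 0 T, ∀ t ∈ Icc 0 T, s < t →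
      ‖X t w - sumWords (N - w.length) (fun v => incr W s t v • X s (v ++ w))‖
        ≤ C * (t - s) ^ (((N - w.length : ℕ) : ℝ) * γ)

/-- The lift of the composition `φ (X)` of a function with a controlled path. Its coefficient on a
word `w` is the sum, over the set partitions `{B₁, …, B_k}` of the positions of `w`, of
`D^k φ(X_t) (⟨e_{u₁}^*, X_t⟩, …, ⟨e_{u_k}^*, X_t⟩)` with `u_j` the subword of `w` at the positions
in `B_j`. Every set partition with `k` blocks arises from `k!` orderings of its blocks, hence this is
`∑_k 1/k! ∑_{u₁, …, u_k} ⟨e_w^*, e_{u₁} ⧢ ⋯ ⧢ e_{u_k}⟩ D^k φ(X_t) (⟨e_{u₁}^*, X_t⟩, …)` over nonempty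
words `u_j`. For `w = ε` it is `φ (X_t)`. -/
noncomputable def composeLift {E F : Type*} [NormedAddCommGroup E] [NormedSpace ℝ E]
    [NormedAddCommGroup F] [NormedSpace ℝ F] {d : ℕ} (φ : E → F) (X : ℝ → List (Fin d) → E)
    (t : ℝ) (w : List (Fin d)) : F :=
  ∑ c : OrderedFinpartition w.length,
    iteratedFDeriv ℝ c.length φ (X t [])
      (fun m => X t (List.ofFn fun j => w.get (c.emb m j)))

/-- The rough integral `∫_0^t Y_u dW^i_u` exists and equals `I`: the compensated Riemann sums
`∑_{[a,b]} ∑_{|w| < N} ⟨e_w^*, Y_a⟩ ⟨W_{ab}, e_{wi}⟩` over partitions of `[0, t]` converge to `I`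
as the mesh tends to `0`. -/
def HasRoughIntegral {E : Type*} [NormedAddCommGroup E] [NormedSpace ℝ E] {d : ℕ} (N : ℕ)
    (W : ℝ → List (Fin d) → ℝ) (i : Fin d) (Y : ℝ → List (Fin d) → E) (t : ℝ) (I : E) : Prop :=
  ∀ ε > 0, ∃ δ > 0, ∀ (k : ℕ) (p : ℕ → ℝ), Monotone p → p 0 = 0 → p k = t →
    (∀ j < k, p (j + 1) - p j < δ) →
    ‖(∑ j ∈ Finset.range k,
        sumWords N (fun w => incr W (p j) (p (j + 1)) (w ++ [i]) • Y (p j) w)) - I‖ < ε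

/-- `Z` is the path `t ↦ ∫_0^t Y_u dW^i_u` with its higher coefficients
`⟨e_{wi}^*, Z_t⟩ = ⟨e_w^*, Y_t⟩`, all others being zero. -/
def IsRoughIntegralLift {E : Type*} [NormedAddCommGroup E] [NormedSpace ℝ E] {d : ℕ} (N : ℕ) (T : ℝ)
    (W : ℝ → List (Fin d) → ℝ) (i : Fin d) (Y Z : ℝ → List (Fin d) → E) : Prop :=
  ∀ t ∈ Icc 0 T, HasRoughIntegral N W i Y t (Z t []) ∧
    ∀ (w : List (Fin d)) (j : Fin d), w.length < N → Z t (w ++ [j]) = if j = i then Y t w else 0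

/-- `X` solves `dX_t = ∑_i f_i(X_t) dW^i_t` on `[0, T]`, `X_0 = x`: there is a controlled path `XX`
above `X`, started from `∑_{|w| < N_γ} F_w(x) e_w`, with
`XX_t - XX_s = ∑_i ∫_s^t f_i(XX)_u dW^i_u` in all coefficients of order `< N_γ`. -/
def IsRDESolution {E : Type*} [NormedAddCommGroup E] [NormedSpace ℝ E] {d : ℕ} (γ T : ℝ)
    (f : Fin d → E → E) (W : ℝ → List (Fin d) → ℝ) (x : E) (X : ℝ → E) : Prop :=
  ∃ (XX : ℝ → List (Fin d) → E) (Z : Fin d → ℝ → List (Fin d) → E),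
    IsControlled (level γ) γ T W XX ∧
    (∀ t ∈ Icc 0 T, XX t [] = X t) ∧
    (∀ w : List (Fin d), w.length < level γ → XX 0 w = Gam f w id x) ∧
    (∀ i, IsRoughIntegralLift (level γ) T W i (composeLift (f i) XX) (Z i)) ∧
    ∀ s ∈ Icc 0 T, ∀ t ∈ Icc 0 T, ∀ w : List (Fin d), w.length < level γ →
      XX t w - XX s w = ∑ i, (Z i t w - Z i s w)

/-- `ρ` is a measure-valued weak solution on `[0, T]` of the rough continuity equation with initial
value `μ`: for all words `w` with `|w| ≤ N_γ`,
`|ρ_t(Γ_w φ) - ∑_{|v| ≤ N_γ - |w|} ρ_s(Γ_{vw} φ) ⟨W_{st}, e_v⟩| ≲ |t - s|^{(N_γ + 1 - |w|)γ}`,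
uniformly over bounded sets of test functions `φ` in `C^{N_γ+1}_b`. -/
def IsWeakSolution {E : Type*} [NormedAddCommGroup E] [NormedSpace ℝ E] [MeasurableSpace E] {d : ℕ}
    (γ T : ℝ) (f : Fin d → E → E) (W : ℝ → List (Fin d) → ℝ) (μ : FiniteMeasure E)
    (ρ : ℝ → FiniteMeasure E) : Prop :=
  ρ 0 = μ ∧
  ∀ M : ℝ, ∃ C : ℝ, ∀ φ : E → ℝ, ContDiff ℝ (level γ + 1 : ℕ) φ →
    (∀ j ≤ level γ + 1, ∀ x, ‖iteratedFDeriv ℝ j φ x‖ ≤ M) →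
    ∀ w : List (Fin d), w.length ≤ level γ → ∀ s ∈ Icc 0 T, ∀ t ∈ Icc 0 T, s < t →
      |(∫ x, Gam f w φ x ∂(ρ t : Measure E)) -
          sumWords (level γ + 1 - w.length)
            (fun v => (∫ x, Gam f (v ++ w) φ x ∂(ρ s : Measure E)) * incr W s t v)|
        ≤ C * (t - s) ^ (((level γ + 1 - w.length : ℕ) : ℝ) * γ)

end RoughContinuity

/-! Everything rests on the one-step map `roughStep`, x ↦ ∑_{|v| ≤ N} ⟨W_{st}, e_v⟩ F_v(x). Since
W_{st} is a character, this map behaves like the time-one flow of a Lie series: φ composed with it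
equals ∑_{|w|<m} ⟨W_{st}, e_w⟩ Γ_w φ up to |t-s|^{mγ}, for m ≤ N+1, even in C^k norms (`taylor_sup`,
`taylor`). The algebra behind this is that Γ_w acts on products by deshuffling w, that deshuffling
is dual to the shuffle product (`sumWords_smul_cosum`), and that characters turn shuffles into
products.

Applied to the F_v and combined with Chen's relation, the expansion shows that the one-step maps
form an almost flow: Ψ_{ut} ∘ Ψ_{su} differs from Ψ_{st} by O(|t-s|^a) in C^{N+1}, where a = (N+1)γ
> 1 (`RoughData.exists_isAlmostFlow`). A nonlinear sewing argument by bisection then bounds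
compositions along all fine partitions, uniformly in C^{N+1} (`IsAlmostFlow.exists_global`). Dyadic
compositions converge to a map X, Lipschitz in the starting point. Its paths are integral curves,
meaning |Y_t - Ψ_{st}(Y_s)| ≤ C|t-s|^a, and such curves are determined by their initial value
(`IsAlmostFlow.exists_flow`, `DiscreteBounds.curve_unique`).

Being an integral curve is equivalent to solving the RDE. The coefficients of a solution are forced
to be F_w(Y), the lift f_i(F(Y)) has coefficients F_{wi}(Y) by Faà di Bruno (`composeLift_Gam`), and
the rough integrals are sewn from the terms of Ψ_{st}(Y_s) - Y_s grouped by last letter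
(`RoughData.isRDESolution`, `RoughData.isIntegralCurve_of_isRDESolution`).

For the continuity equation, integrating the expansion of φ along the curves shows that the
pushforward is a weak solution. Conversely, for any weak solution the quantity ρ_{p_j}(φ ∘ flow from
p_j to t) changes by only O(|p_{j+1}-p_j|^a) at each partition step, because φ composed with the
discrete flow stays bounded in C^{N+1}. As a > 1 these errors sum to zero in the limit, so ρ_t(φ) =
∫ φ(X_t^x) μ(dx) (`IsWeakSolution.integral_eq`). Functions of class C_b^{N+1} separate finite
measures, which gives uniqueness. -/

namespace RoughContinuity

/-! ### Sums over words and deshuffling -/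

section Words

variable {d : ℕ} {A : Type*} [AddCommMonoid A]

/-- The words of length `< m`. -/
def words (d m : ℕ) : Finset (List (Fin d)) :=
  (Finset.range m).biUnion fun k => Finset.univ.image fun v : Fin k → Fin d => List.ofFn v

lemma mem_words {m : ℕ} {w : List (Fin d)} : w ∈ words d m ↔ w.length < m := by
  simp only [words, Finset.mem_biUnion, Finset.mem_range, Finset.mem_image, Finset.mem_univ,
    true_and]
  constructor
  · rintro ⟨k, hk, v, rfl⟩
    simpa using hk
  · intro h
    exact ⟨w.length, h, w.get, List.ofFn_get w⟩

lemma sumWords_eq_sum (m : ℕ) (g : List (Fin d) → A) : sumWords m g = ∑ w ∈ words d m, g w := by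
  rw [sumWords, words, Finset.sum_biUnion]
  · refine Finset.sum_congr rfl fun k _ => ?_
    rw [Finset.sum_image]
    intro v _ v' _ h
    exact List.ofFn_injective h
  · intro k _ l _ hkl
    rw [Function.onFun, Finset.disjoint_left]
    intro w hw hw'
    simp only [Finset.mem_image, Finset.mem_univ, true_and] at hw hw'
    obtain ⟨v, rfl⟩ := hw
    obtain ⟨v', h⟩ := hw'
    have := congrArg List.length h
    simp at this
    exact hkl this.symm

lemma sumWords_congr {m : ℕ} {g h : List (Fin d) → A}
    (H : ∀ w : List (Fin d), w.length < m → g w = h w) : sumWords m g = sumWords m h := by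
  rw [sumWords_eq_sum, sumWords_eq_sum]
  exact Finset.sum_congr rfl fun w hw => H w (mem_words.1 hw)

lemma sumWords_add (m : ℕ) (g h : List (Fin d) → A) :
    sumWords m (fun w => g w + h w) = sumWords m g + sumWords m h := by
  simp only [sumWords_eq_sum, Finset.sum_add_distrib]

lemma sumWords_sum {ι : Type*} (s : Finset ι) (m : ℕ) (g : ι → List (Fin d) → A) :
    sumWords m (fun w => ∑ i ∈ s, g i w) = ∑ i ∈ s, sumWords m (g i) := by
  simp only [sumWords_eq_sum]
  exact Finset.sum_comm

@[simp] lemma sumWords_zero (g : List (Fin d) → A) : sumWords 0 g = 0 := by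
  simp [sumWords]

lemma sumWords_succ (m : ℕ) (g : List (Fin d) → A) :
    sumWords (m + 1) g = g [] + ∑ a, sumWords m (fun w => g (a :: w)) := by
  rw [sumWords, Finset.sum_range_succ', add_comm]
  congr 1
  · simp
  · rw [← sumWords_sum Finset.univ m fun a w => g (a :: w), sumWords]
    refine Finset.sum_congr rfl fun k _ => ?_
    rw [← (Fin.consEquiv (fun _ : Fin (k + 1) => Fin d)).sum_comp, Fintype.sum_prod_type,
      Finset.sum_comm]
    refine Finset.sum_congr rfl fun v _ => Finset.sum_congr rfl fun a _ => ?_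
    simp [Fin.consEquiv, List.ofFn_succ]

lemma sumWords_eq_zero {m : ℕ} {g : List (Fin d) → A}
    (H : ∀ w : List (Fin d), w.length < m → g w = 0) : sumWords m g = 0 := by
  rw [sumWords_eq_sum]
  exact Finset.sum_eq_zero fun w hw => H w (mem_words.1 hw)

/-- The sum of `K u v` over all pairs of words with `|u| + |v| < m`. -/
def sumPairs (m : ℕ) (K : List (Fin d) → List (Fin d) → A) : A :=
  sumWords m fun u => sumWords (m - u.length) (K u)

lemma sumPairs_congr {m : ℕ} {K L : List (Fin d) → List (Fin d) → A}
    (H : ∀ u v : List (Fin d), u.length + v.length < m → K u v = L u v) :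
    sumPairs m K = sumPairs m L :=
  sumWords_congr fun u _ => sumWords_congr fun v hv => H u v (by omega)

lemma sumPairs_add (m : ℕ) (K L : List (Fin d) → List (Fin d) → A) :
    sumPairs m (fun u v => K u v + L u v) = sumPairs m K + sumPairs m L := by
  simp only [sumPairs, sumWords_add]

lemma sumPairs_succ (m : ℕ) (K : List (Fin d) → List (Fin d) → A) :
    sumPairs (m + 1) K = sumWords (m + 1) (K []) + ∑ a, sumPairs m (fun u => K (a :: u)) := by
  rw [sumPairs, sumWords_succ]
  simp [sumPairs]

lemma sumPairs_comm (m : ℕ) (K : List (Fin d) → List (Fin d) → A) :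
    sumPairs m K = sumPairs m (fun u v => K v u) := by
  simp only [sumPairs, sumWords_eq_sum]
  refine Finset.sum_comm' ?_
  intro u v
  simp only [mem_words]
  omega

lemma sumPairs_succ_right (m : ℕ) (K : List (Fin d) → List (Fin d) → A) :
    sumPairs (m + 1) K =
      sumWords (m + 1) (fun u => K u []) + ∑ a, sumPairs m (fun u v => K u (a :: v)) := by
  rw [sumPairs_comm, sumPairs_succ]
  congr 1
  exact Finset.sum_congr rfl fun a _ => sumPairs_comm _ _

/-- The sum of `G u v` over the splittings of `w` into a subword `u` and its complement `v`. -/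
def cosum : List (Fin d) → (List (Fin d) → List (Fin d) → A) → A
  | [], G => G [] []
  | a :: w, G => cosum w (fun u v => G (a :: u) v) + cosum w (fun u v => G u (a :: v))

lemma cosum_add (w : List (Fin d)) (G H : List (Fin d) → List (Fin d) → A) :
    cosum w (fun u v => G u v + H u v) = cosum w G + cosum w H := by
  induction w generalizing G H with
  | nil => rfl
  | cons a w ih => simp only [cosum, ih]; abel

lemma cosum_congr {w : List (Fin d)} {G H : List (Fin d) → List (Fin d) → A}
    (h : ∀ u v : List (Fin d), u.length + v.length = w.length → G u v = H u v) :
    cosum w G = cosum w H := by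
  induction w generalizing G H with
  | nil => exact h _ _ rfl
  | cons a w ih =>
    exact congrArg₂ (· + ·) (ih fun u v huv => h _ _ (by simp; omega))
      (ih fun u v huv => h _ _ (by simp; omega))

lemma map_cosum {B : Type*} [AddCommMonoid B] {𝓕 : Type*} [FunLike 𝓕 A B] [AddMonoidHomClass 𝓕 A B]
    (L : 𝓕) (w : List (Fin d)) (G : List (Fin d) → List (Fin d) → A) :
    L (cosum w G) = cosum w fun u v => L (G u v) := by
  induction w generalizing G with
  | nil => rfl
  | cons a w ih => simp only [cosum, map_add, ih]

end Words

/-! ### Duality between deshuffling and the shuffle product -/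

section Shuffle

variable {d : ℕ}

/-- The value of `g` on the shuffle `e_u ⧢ e_v`. -/
def sh {α : Type*} (g : List α → ℝ) (u v : List α) : ℝ := ((shuffles u v).map g).sum

variable {α : Type*}

@[simp] lemma sh_nil_left (g : List α → ℝ) (v : List α) : sh g [] v = g v := by
  simp [sh, shuffles]

@[simp] lemma sh_nil_right (g : List α → ℝ) (u : List α) : sh g u [] = g u := by
  cases u <;> simp [sh, shuffles]

lemma sh_cons_cons (g : List α → ℝ) (a b : α) (u v : List α) :
    sh g (a :: u) (b :: v) =
      sh (fun w => g (a :: w)) u (b :: v) + sh (fun w => g (b :: w)) (a :: u) v := by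
  simp [sh, shuffles, Function.comp_def]

lemma sh_add (g h : List α → ℝ) (u v : List α) :
    sh (fun w => g w + h w) u v = sh g u v + sh h u v := by
  simp [sh]

lemma sh_const_mul (c : ℝ) (g : List α → ℝ) (u v : List α) :
    sh (fun w => c * g w) u v = c * sh g u v := by
  simp [sh, List.sum_map_mul_left]

/-- Coproduct and shuffle product are dual to each other. -/
lemma sumWords_smul_cosum {V : Type*} [AddCommGroup V] [Module ℝ V] (m : ℕ)
    (g : List (Fin d) → ℝ) (G : List (Fin d) → List (Fin d) → V) :
    sumWords m (fun w => g w • cosum w G) = sumPairs m fun u v => sh g u v • G u v := by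
  induction m generalizing g G with
  | zero => simp [sumPairs]
  | succ m ih =>
    -- Pairs are sorted by the origin of the first letter of the shuffle: from `u` (`L`), from `v`
    -- (`R`), or both words empty (`Z`).
    let L : List (Fin d) → List (Fin d) → V := fun u v =>
      match u with
      | [] => 0
      | a :: u' => sh (fun w => g (a :: w)) u' v • G (a :: u') v
    let R : List (Fin d) → List (Fin d) → V := fun u v =>
      match v with
      | [] => 0
      | b :: v' => sh (fun w => g (b :: w)) u v' • G u (b :: v')
    let Z : List (Fin d) → List (Fin d) → V := fun u v =>
      match u, v with
      | [], [] => g [] • G [] []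
      | _, _ => 0
    have key : ∀ u v, sh g u v • G u v = Z u v + (L u v + R u v) := by
      intro u v
      cases u <;> cases v <;> simp [L, R, Z, sh_cons_cons, add_smul]
    have hZ : sumPairs (m + 1) Z = g [] • G [] [] := by
      rw [sumPairs_succ, sumWords_succ]
      simp [Z, sumPairs, sumWords_eq_zero]
    have hL : sumPairs (m + 1) L =
        ∑ a, sumPairs m fun u v => sh (fun w => g (a :: w)) u v • G (a :: u) v := by
      rw [sumPairs_succ, sumWords_eq_zero, zero_add]
      intro w _; rfl
    have hR : sumPairs (m + 1) R =
        ∑ a, sumPairs m fun u v => sh (fun w => g (a :: w)) u v • G u (a :: v) := by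
      rw [sumPairs_succ_right, sumWords_eq_zero, zero_add]
      intro w _; rfl
    simp only [key, sumPairs_add, hZ, hL, hR]
    rw [sumWords_succ, ← Finset.sum_add_distrib]
    simp only [cosum, smul_add, sumWords_add, ih]

end Shuffle

/-! ### Convolution, antipode and the group of truncated characters -/

section Convolution

variable {d : ℕ}

lemma conv_nil (g h : List (Fin d) → ℝ) : conv g h [] = g [] * h [] := by simp [conv]

lemma conv_cons (g h : List (Fin d) → ℝ) (a : Fin d) (w : List (Fin d)) :
    conv g h (a :: w) = g [] * h (a :: w) + conv (fun z => g (a :: z)) h w := by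
  rw [conv, List.length_cons, Finset.sum_range_succ', add_comm]
  simp [conv]

lemma conv_congr {g g' h h' : List (Fin d) → ℝ} {w : List (Fin d)}
    (hg : ∀ u : List (Fin d), u.length ≤ w.length → g u = g' u)
    (hh : ∀ u : List (Fin d), u.length ≤ w.length → h u = h' u) : conv g h w = conv g' h' w := by
  refine Finset.sum_congr rfl fun k _ => ?_
  rw [hg _ (by simp), hh _ (by simp)]

lemma conv_add_left (g g' h : List (Fin d) → ℝ) (w : List (Fin d)) :
    conv (fun z => g z + g' z) h w = conv g h w + conv g' h w := by
  simp [conv, add_mul, Finset.sum_add_distrib]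

lemma conv_mul_left (c : ℝ) (g h : List (Fin d) → ℝ) (w : List (Fin d)) :
    conv (fun z => c * g z) h w = c * conv g h w := by
  simp [conv, Finset.mul_sum, mul_assoc]

lemma conv_assoc (g h k : List (Fin d) → ℝ) (w : List (Fin d)) :
    conv (conv g h) k w = conv g (conv h k) w := by
  induction w generalizing g with
  | nil => simp [conv_nil, mul_assoc]
  | cons a w ih =>
    rw [conv_cons, conv_cons]
    simp only [conv_cons, conv_nil, conv_add_left, conv_mul_left, ih]
    ring

lemma sumWords_conv {V : Type*} [AddCommGroup V] [Module ℝ V] (m : ℕ) (g h : List (Fin d) → ℝ)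
    (G : List (Fin d) → V) :
    sumWords m (fun z => conv g h z • G z) = sumPairs m fun u v => (g u * h v) • G (u ++ v) := by
  induction m generalizing g G with
  | zero => simp [sumPairs]
  | succ m ih =>
    rw [sumPairs_succ, sumWords_succ]
    simp only [conv_cons, conv_nil, add_smul, sumWords_add, ih, Finset.sum_add_distrib]
    rw [sumWords_succ (g := fun v => (g [] * h v) • G ([] ++ v))]
    simp [add_assoc]

/-- The neutral element of the convolution product. -/
def convUnit (w : List (Fin d)) : ℝ := if w = [] then 1 else 0

lemma unit_conv (g : List (Fin d) → ℝ) (w : List (Fin d)) : conv convUnit g w = g w := by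
  rw [conv, Finset.sum_range_succ', Finset.sum_eq_zero]
  · simp [convUnit]
  · intro k hk
    have : w.take (k + 1) ≠ [] := by
      simp at hk ⊢; rintro rfl; simp at hk
    simp [convUnit, this]

/-- The alternating sum `∑ (-1)^{n-k} w_{≤k} ⧢ rev(w_{>k})`, evaluated at `g`. -/
def antipodeSum (g : List (Fin d) → ℝ) (w : List (Fin d)) : ℝ :=
  ∑ k ∈ Finset.range (w.length + 1),
    (-1) ^ (w.length - k) * sh g (w.take k) (w.drop k).reverse

/-- The shuffles of `u` and `v` starting with the first letter of `u`. -/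
def shLeft {α : Type*} (g : List α → ℝ) : List α → List α → ℝ
  | [], _ => 0
  | a :: u, v => sh (fun w => g (a :: w)) u v

/-- The shuffles of `u` and `v` starting with the first letter of `v`. -/
def shRight {α : Type*} (g : List α → ℝ) : List α → List α → ℝ
  | _, [] => 0
  | u, b :: v => sh (fun w => g (b :: w)) u v

lemma sh_eq_shLeft_add_shRight {α : Type*} (g : List α → ℝ) (u v : List α)
    (h : u ≠ [] ∨ v ≠ []) : sh g u v = shLeft g u v + shRight g u v := by
  cases u <;> cases v <;> simp_all [shLeft, shRight, sh_cons_cons]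

/-- A shuffle of a prefix of the word with the reversed remaining suffix starts either with the
first letter `a` of the whole word or with its last letter `b`. Removing that letter leaves the same
alternating sum for `x`, respectively `y`; in the second case the suffix is one letter shorter,
which flips the sign. -/
lemma antipodeSum_rec (g : List (Fin d) → ℝ) (a b : Fin d) (x y : List (Fin d))
    (h : a :: x = y ++ [b]) :
    antipodeSum g (a :: x) =
      antipodeSum (fun w => g (a :: w)) x - antipodeSum (fun w => g (b :: w)) y := by
  have hl : x.length = y.length := by simpa using congrArg List.length h
  have hsplit : antipodeSum g (a :: x) =
      (∑ k ∈ Finset.range (x.length + 2), (-1) ^ (x.length + 1 - k) *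
        shLeft g ((a :: x).take k) ((a :: x).drop k).reverse) +
      ∑ k ∈ Finset.range (y.length + 2), (-1) ^ (y.length + 1 - k) *
        shRight g ((y ++ [b]).take k) ((y ++ [b]).drop k).reverse := by
    rw [antipodeSum, ← hl, ← h, ← Finset.sum_add_distrib]
    refine Finset.sum_congr rfl fun k hk => ?_
    rw [sh_eq_shLeft_add_shRight, mul_add]
    · simp
    · rcases k with - | k
      · right; simp
      · left; simp
  rw [hsplit, Finset.sum_range_succ', Finset.sum_range_succ _ (y.length + 1), sub_eq_add_neg]
  congr 1
  · simp [shLeft, antipodeSum]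
  · have : (y ++ [b]).drop (y.length + 1) = [] := by simp
    rw [this, antipodeSum, ← Finset.sum_neg_distrib]
    simp only [List.reverse_nil, shRight, mul_zero, add_zero]
    refine Finset.sum_congr rfl fun k hk => ?_
    have hk : k ≤ y.length := by simpa [Nat.lt_succ_iff] using hk
    rw [List.drop_append_of_le_length hk, List.take_append_of_le_length hk, List.reverse_append,
      Nat.succ_sub hk, pow_succ]
    simp

/-- Induction on the length by `antipodeSum_rec`. For words of length one the two terms do not
vanish but cancel, since first and last letter coincide. -/
lemma antipodeSum_eq_zero (w : List (Fin d)) (hw : w ≠ []) (g : List (Fin d) → ℝ) :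
    antipodeSum g w = 0 := by
  induction hn : w.length generalizing w g with
  | zero => simp_all
  | succ n ih =>
    obtain ⟨a, x, rfl⟩ := List.exists_cons_of_ne_nil hw
    have hy := List.dropLast_append_getLast hw
    rw [antipodeSum_rec g a _ x _ hy.symm]
    have hx : x.length = n := by simpa using hn
    rcases eq_or_ne x [] with rfl | hx0
    · simp [antipodeSum]
    · rw [ih x hx0 _ hx, ih _ _ _ _, sub_zero]
      · intro h0
        have := congrArg List.length h0
        simp at this
        exact hx0 this
      · simp [hx]

/-- The antipode inverts truncated characters. -/
lemma conv_charInv {N : ℕ} {g : List (Fin d) → ℝ} (hg : IsTruncatedCharacter N g)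
    {w : List (Fin d)} (hw : w.length ≤ N) : conv g (charInv g) w = convUnit w := by
  rcases eq_or_ne w [] with rfl | hw0
  · simp [conv_nil, charInv, convUnit, hg.1]
  · rw [convUnit, if_neg hw0, ← antipodeSum_eq_zero w hw0 g]
    -- A character turns each shuffle in the alternating sum into a product, which makes the sum the
    -- convolution with the antipode.
    refine Finset.sum_congr rfl fun k hk => ?_
    have hk : k ≤ w.length := by simpa [Nat.lt_succ_iff] using hk
    have : sh g (w.take k) (w.drop k).reverse = _ := hg.2 _ _ (by simp; omega)
    rw [this, charInv, List.length_drop]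
    ring

/-- The defining recursion of shuffles reads first letters. Its mirror image for last letters is
what reversal of words requires. -/
lemma sh_append_singleton {α : Type*} (g : List α → ℝ) (u v : List α) (a b : α) :
    sh g (u ++ [a]) (v ++ [b]) =
      sh (fun w => g (w ++ [a])) u (v ++ [b]) + sh (fun w => g (w ++ [b])) (u ++ [a]) v := by
  induction u generalizing g v with
  | nil =>
    induction v generalizing g with
    | nil => simp [sh_cons_cons, add_comm]
    | cons e v ih =>
      have := ih (fun w => g (e :: w))
      simp only [List.nil_append, List.cons_append, sh_cons_cons, sh_nil_left] at this ⊢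
      rw [this]; ring
  | cons c u ihu =>
    induction v generalizing g with
    | nil =>
      have := ihu (fun w => g (c :: w)) []
      simp only [List.nil_append, List.cons_append, sh_cons_cons, sh_nil_right] at this ⊢
      rw [this]; ring
    | cons e v ihv =>
      have h1 := ihu (fun w => g (c :: w)) (e :: v)
      have h2 := ihv (fun w => g (e :: w))
      simp only [List.cons_append, sh_cons_cons] at h1 h2 ⊢
      rw [h1, h2]; ring

lemma sh_reverse {α : Type*} (g : List α → ℝ) (u v : List α) :
    sh g u.reverse v.reverse = sh (fun w => g w.reverse) u v := by
  induction u generalizing g v with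
  | nil => simp
  | cons a u ihu =>
    induction v generalizing g with
    | nil => simp
    | cons b v ihv =>
      have h1 := ihu (fun w => g (w ++ [a])) (b :: v)
      have h2 := ihv (fun w => g (w ++ [b]))
      simp only [List.reverse_cons] at h1 h2 ⊢
      rw [sh_append_singleton, sh_cons_cons, h1, h2]
      simp

lemma length_of_mem_shuffles {α : Type*} {u v w : List α} (h : w ∈ shuffles u v) :
    w.length = u.length + v.length := by
  induction u generalizing v w with
  | nil => simp_all [shuffles]
  | cons a u ihu =>
    induction v generalizing w with
    | nil => simp_all [shuffles]
    | cons b v ihv =>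
      simp only [shuffles, List.mem_append, List.mem_map] at h
      rcases h with ⟨z, hz, rfl⟩ | ⟨z, hz, rfl⟩
      · simp [ihu hz]; omega
      · simp [ihv hz]; omega

/-- Reversal is compatible with shuffles (`sh_reverse`), and the sign is multiplicative because all
shuffles of two words have the same length. -/
lemma IsTruncatedCharacter.charInv {N : ℕ} {g : List (Fin d) → ℝ}
    (hg : IsTruncatedCharacter N g) : IsTruncatedCharacter N (charInv g) := by
  refine ⟨by simp [RoughContinuity.charInv, hg.1], fun u v huv => ?_⟩
  have h1 : (shuffles u v).map (RoughContinuity.charInv g) =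
      (shuffles u v).map fun w => (-1) ^ (u.length + v.length) * g w.reverse := by
    refine List.map_congr_left fun w hw => ?_
    rw [RoughContinuity.charInv, length_of_mem_shuffles hw]
  have h2 := sh_reverse g u v
  have h3 : sh g u.reverse v.reverse = _ := hg.2 _ _ (by simpa using huv)
  rw [h1, List.sum_map_mul_left]
  change _ * sh (fun w => g w.reverse) u v = _
  rw [← h2, h3]
  simp only [RoughContinuity.charInv]
  ring

/-- Deconcatenation is compatible with the shuffle product. -/
lemma sh_conv (g h : List (Fin d) → ℝ) (u v : List (Fin d)) :
    sh (conv g h) u v =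
      ∑ k ∈ Finset.range (u.length + 1), ∑ l ∈ Finset.range (v.length + 1),
        sh g (u.take k) (v.take l) * sh h (u.drop k) (v.drop l) := by
  induction u generalizing g v with
  | nil => simp [conv]
  | cons a u ihu =>
    induction v generalizing g with
    | nil => simp [conv]
    | cons b v ihv =>
      have h1 := ihu (fun w => g (a :: w)) (b :: v)
      have h2 := ihv (fun w => g (b :: w))
      rw [sh_cons_cons]
      simp only [conv_cons, sh_add, sh_const_mul, h1, h2, List.length_cons]
      simp only [Finset.sum_range_succ' _ (u.length + 1), Finset.sum_range_succ' _ (v.length + 1),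
        List.take_succ_cons, List.drop_succ_cons, List.take_zero, List.drop_zero, sh_nil_left,
        sh_nil_right, sh_cons_cons, add_mul, Finset.sum_add_distrib]
      ring

lemma IsTruncatedCharacter.conv {N : ℕ} {g h : List (Fin d) → ℝ}
    (hg : IsTruncatedCharacter N g) (hh : IsTruncatedCharacter N h) :
    IsTruncatedCharacter N (conv g h) := by
  refine ⟨by simp [conv_nil, hg.1, hh.1], fun u v huv => ?_⟩
  change sh (RoughContinuity.conv g h) u v = _
  rw [sh_conv, RoughContinuity.conv, RoughContinuity.conv, Finset.sum_mul_sum]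
  refine Finset.sum_congr rfl fun k _ => Finset.sum_congr rfl fun l _ => ?_
  have h1 : sh g (u.take k) (v.take l) = _ := hg.2 _ _ (by simp; omega)
  have h2 : sh h (u.drop k) (v.drop l) = _ := hh.2 _ _ (by simp; omega)
  rw [h1, h2]
  ring

end Convolution

/-! ### Chen's relation for increments -/

section RoughPath

variable {d : ℕ} {γ T : ℝ} {W : ℝ → List (Fin d) → ℝ}

lemma IsWeaklyGeometricRoughPath.incr_character (hW : IsWeaklyGeometricRoughPath γ T W) {s t : ℝ}
    (hs : s ∈ Icc 0 T) (ht : t ∈ Icc 0 T) : IsTruncatedCharacter (level γ) (incr W s t) :=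
  (hW.1 s hs).charInv.conv (hW.1 t ht)

lemma IsWeaklyGeometricRoughPath.chen (hW : IsWeaklyGeometricRoughPath γ T W) {s u t : ℝ}
    (hu : u ∈ Icc 0 T) {w : List (Fin d)} (hw : w.length ≤ level γ) :
    conv (incr W s u) (incr W u t) w = incr W s t w := by
  simp only [incr]
  rw [conv_assoc]
  refine conv_congr (fun _ _ => rfl) fun z hz => ?_
  rw [← conv_assoc, conv_congr (g' := convUnit) (h' := W t) _ fun _ _ => rfl, unit_conv]
  exact fun y hy => conv_charInv (hW.1 u hu) (by omega)

/-- The Hölder bound at distance zero kills all nonempty words, so no left inverse property of the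
antipode is needed. -/
lemma IsWeaklyGeometricRoughPath.incr_self (hW : IsWeaklyGeometricRoughPath γ T W) (hγ : 0 < γ)
    {s : ℝ} (hs : s ∈ Icc 0 T) {w : List (Fin d)} (hw : w.length ≤ level γ) :
    incr W s s w = convUnit w := by
  rcases eq_or_ne w [] with rfl | hw0
  · simpa [convUnit] using (hW.incr_character hs hs).1
  · obtain ⟨C, hC⟩ := hW.2 w hw
    have h := hC s hs s hs
    have hpos : 0 < (w.length : ℝ) * γ :=
      mul_pos (by exact_mod_cast List.length_pos_iff.2 hw0) hγ
    rw [sub_self, abs_zero, Real.zero_rpow hpos.ne', mul_zero] at h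
    simp [convUnit, hw0, abs_nonpos_iff.1 h]

end RoughPath
end RoughContinuity

namespace RoughContinuity

/-! ### Quantitative `C^k_b` calculus for perturbations of the identity -/

section BddC

variable {E F G H : Type} [NormedAddCommGroup E] [NormedSpace ℝ E] [NormedAddCommGroup F]
  [NormedSpace ℝ F] [NormedAddCommGroup G] [NormedSpace ℝ G] [NormedAddCommGroup H]
  [NormedSpace ℝ H]

/-- `g` is of class `C^k` and its derivatives of orders `0, …, k` are bounded by `M`. -/
def BddC (k : ℕ) (g : E → F) (M : ℝ) : Prop :=
  ContDiff ℝ k g ∧ ∀ j ≤ k, ∀ x, ‖iteratedFDeriv ℝ j g x‖ ≤ M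

namespace BddC

variable {k : ℕ} {g h : E → F} {M M' : ℝ}

lemma norm_le (hg : BddC k g M) (x : E) : ‖g x‖ ≤ M := by
  simpa using hg.2 0 (Nat.zero_le _) x

lemma nonneg (hg : BddC k g M) : 0 ≤ M := (norm_nonneg _).trans (hg.norm_le 0)

lemma contDiff (hg : BddC k g M) : ContDiff ℝ k g := hg.1

lemma continuous (hg : BddC k g M) : Continuous g := hg.1.continuous

lemma mono (hg : BddC k g M) (h : M ≤ M') : BddC k g M' :=
  ⟨hg.1, fun j hj x => (hg.2 j hj x).trans h⟩

lemma of_le {l : ℕ} (hg : BddC k g M) (h : l ≤ k) : BddC l g M :=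
  ⟨hg.1.of_le (by exact_mod_cast h), fun j hj x => hg.2 j (hj.trans h) x⟩

lemma zero_iff : BddC 0 g M ↔ Continuous g ∧ ∀ x, ‖g x‖ ≤ M := by
  simp [BddC]

lemma succ_iff : BddC (k + 1) g M ↔
    Differentiable ℝ g ∧ (∀ x, ‖g x‖ ≤ M) ∧ BddC k (fderiv ℝ g) M := by
  constructor
  · intro hg
    refine ⟨hg.1.differentiable (by simp), hg.norm_le, ?_, fun j hj x => ?_⟩
    · exact (contDiff_succ_iff_fderiv.1 (by exact_mod_cast hg.1)).2.2
    · rw [norm_iteratedFDeriv_fderiv]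
      exact hg.2 _ (by omega) x
  · rintro ⟨h1, h2, h3⟩
    refine ⟨?_, fun j hj x => ?_⟩
    · have := (contDiff_succ_iff_fderiv (n := (k : WithTop ℕ∞)) (f := g) (𝕜 := ℝ)).2
        ⟨h1, by simp, h3.1⟩
      exact_mod_cast this
    · rcases j with - | j
      · simpa using h2 x
      · rw [← norm_iteratedFDeriv_fderiv]
        exact h3.2 j (by omega) x

lemma differentiable (hg : BddC (k + 1) g M) : Differentiable ℝ g := (succ_iff.1 hg).1

lemma fderiv (hg : BddC (k + 1) g M) : BddC k (fderiv ℝ g) M := (succ_iff.1 hg).2.2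

lemma add (hg : BddC k g M) (hh : BddC k h M') : BddC k (fun x => g x + h x) (M + M') := by
  refine ⟨hg.1.add hh.1, fun j hj x => ?_⟩
  have hj' : (j : WithTop ℕ∞) ≤ k := by exact_mod_cast hj
  rw [show (fun x => g x + h x) = g + h from rfl, iteratedFDeriv_add
    (hg.1.of_le hj') (hh.1.of_le hj')]
  exact (norm_add_le _ _).trans (add_le_add (hg.2 j hj x) (hh.2 j hj x))

lemma neg (hg : BddC k g M) : BddC k (fun x => -g x) M := by
  refine ⟨hg.1.neg, fun j hj x => ?_⟩
  rw [show (fun x => -g x) = -g from rfl, iteratedFDeriv_neg_apply, norm_neg]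
  exact hg.2 j hj x

lemma const (c : F) : BddC k (fun _ : E => c) ‖c‖ := by
  induction k generalizing F with
  | zero => exact zero_iff.2 ⟨continuous_const, fun _ => le_rfl⟩
  | succ k ih =>
    refine succ_iff.2 ⟨differentiable_const c, fun _ => le_rfl, ?_⟩
    have : _root_.fderiv ℝ (fun _ : E => c) = fun _ => 0 := by
      ext x; simp
    rw [this]
    exact (ih (0 : E →L[ℝ] F)).mono (by rw [norm_zero]; exact norm_nonneg c)

lemma sum {ι : Type*} {s : Finset ι} {u : ι → E → F} {m : ι → ℝ}
    (hu : ∀ i ∈ s, BddC k (u i) (m i)) : BddC k (fun x => ∑ i ∈ s, u i x) (∑ i ∈ s, m i) := by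
  classical
  induction s using Finset.induction_on with
  | empty => simpa using const (k := k) (E := E) (0 : F)
  | insert a s ha ih =>
    simp only [Finset.sum_insert ha]
    exact (hu a (Finset.mem_insert_self a s)).add
      (ih fun i hi => hu i (Finset.mem_insert_of_mem hi))

lemma bilin (B : F →L[ℝ] G →L[ℝ] H) (hB : ‖B‖ ≤ 1) {u : E → G} (hg : BddC k g M)
    (hu : BddC k u M') : BddC k (fun x => B (g x) (u x)) (2 ^ k * (M * M')) := by
  have hM := hg.nonneg
  have hM' := hu.nonneg
  refine ⟨(B.contDiff.comp hg.1).clm_apply hu.1, fun j hj x => ?_⟩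
  have hj' : (j : WithTop ℕ∞) ≤ k := by exact_mod_cast hj
  refine (B.norm_iteratedFDeriv_le_of_bilinear_of_le_one hg.1 hu.1 x hj' hB).trans ?_
  calc ∑ i ∈ Finset.range (j + 1), (j.choose i : ℝ) * ‖iteratedFDeriv ℝ i g x‖ *
        ‖iteratedFDeriv ℝ (j - i) u x‖
      ≤ ∑ i ∈ Finset.range (j + 1), (j.choose i : ℝ) * (M * M') := by
        refine Finset.sum_le_sum fun i hi => ?_
        have hi : i ≤ j := by simpa [Nat.lt_succ_iff] using hi
        rw [mul_assoc]
        gcongr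
        · exact hg.2 i (hi.trans hj) x
        · exact hu.2 (j - i) (by omega) x
    _ = 2 ^ j * (M * M') := by
        rw [← Finset.sum_mul]
        congr 1
        exact_mod_cast Nat.sum_range_choose j
    _ ≤ 2 ^ k * (M * M') := by
        gcongr
        norm_num

lemma clm_apply {A : E → F →L[ℝ] G} (hA : BddC k A M) (hg : BddC k g M') :
    BddC k (fun x => A x (g x)) (2 ^ k * (M * M')) :=
  bilin (ContinuousLinearMap.id ℝ (F →L[ℝ] G)) ContinuousLinearMap.norm_id_le hA hg

lemma clm_comp {A : E → G →L[ℝ] H} {B : E → F →L[ℝ] G} (hA : BddC k A M) (hB : BddC k B M') :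
    BddC k (fun x => (A x).comp (B x)) (2 ^ k * (M * M')) :=
  bilin (ContinuousLinearMap.compL ℝ F G H) (ContinuousLinearMap.norm_compL_le ℝ F G H) hA hB

lemma clm_left (L : F →L[ℝ] G) (hg : BddC k g M) : BddC k (fun x => L (g x)) (‖L‖ * M) := by
  refine ⟨L.contDiff.comp hg.1, fun j hj x => ?_⟩
  have hj' : (j : WithTop ℕ∞) ≤ k := by exact_mod_cast hj
  refine (L.norm_iteratedFDeriv_comp_left hg.1.contDiffAt hj').trans ?_
  gcongr
  exact hg.2 j hj x

lemma const_smul (c : ℝ) (hg : BddC k g M) : BddC k (fun x => c • g x) (|c| * M) := by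
  refine ⟨hg.1.const_smul c, fun j hj x => ?_⟩
  have hj' : (j : WithTop ℕ∞) ≤ k := by exact_mod_cast hj
  rw [show (fun x => c • g x) = c • g from rfl,
    iteratedFDeriv_const_smul_apply (hg.1.contDiffAt.of_le hj'), norm_smul, Real.norm_eq_abs]
  gcongr
  exact hg.2 j hj x

lemma norm_sub_le (hg : BddC (k + 1) g M) (x y : E) : ‖g x - g y‖ ≤ M * ‖x - y‖ :=
  Convex.norm_image_sub_le_of_norm_fderiv_le (fun z _ => hg.differentiable z)
    (fun z _ => hg.fderiv.norm_le z) convex_univ (mem_univ y) (mem_univ x)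

/-- The constant in the bound on the composition with a perturbation of the identity. -/
noncomputable def compConst (k : ℕ) (ε : ℝ) : ℝ := ∏ i ∈ Finset.range k, (1 + 2 ^ i * ε)

lemma one_le_compConst {ε : ℝ} (hε : 0 ≤ ε) : 1 ≤ compConst k ε := by
  unfold compConst
  induction k with
  | zero => simp
  | succ k ih =>
    rw [Finset.prod_range_succ]
    exact one_le_mul_of_one_le_of_one_le ih (by simpa using by positivity)

lemma continuous_compConst : Continuous (compConst k) := by
  unfold compConst
  fun_prop

-- Together with continuity, this says that composing with a map close to the identity multiplies
-- `C^k` bounds by a factor close to 1. The bisection argument depends on it, since a fixed larger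
-- factor could exceed the gain from halving.
@[simp] lemma compConst_zero : compConst k 0 = 1 := by simp [compConst]

lemma differentiable_of_sub_id {φ : E → E} {ε : ℝ} (hφ : BddC (k + 1) (fun x => φ x - x) ε) :
    Differentiable ℝ φ := by
  have h := hφ.differentiable.add differentiable_id
  rwa [show (fun x => φ x - x) + id = φ by ext x; simp] at h

lemma continuous_of_sub_id {φ : E → E} {ε : ℝ} (hφ : BddC k (fun x => φ x - x) ε) :
    Continuous φ := by
  have h := hφ.continuous.add continuous_id
  rwa [show (fun x => φ x - x) + id = φ by ext x; simp] at h

lemma fderiv_eq_of_sub_id {φ : E → E} {ε : ℝ} (hφ : BddC (k + 1) (fun x => φ x - x) ε) (x : E) :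
    _root_.fderiv ℝ φ x =
      ContinuousLinearMap.id ℝ E + _root_.fderiv ℝ (fun x => φ x - x) x := by
  rw [fderiv_fun_sub (hφ.differentiable_of_sub_id x) differentiableAt_fun_id]
  simp

/-- Composition with a perturbation of the identity. -/
lemma comp {φ : E → E} {ε : ℝ} (hg : BddC k g M) (hφ : BddC k (fun x => φ x - x) ε) :
    BddC k (fun x => g (φ x)) (compConst k ε * M) := by
  induction k generalizing F with
  | zero =>
    refine zero_iff.2 ⟨hg.continuous.comp hφ.continuous_of_sub_id, fun x => ?_⟩
    simpa [compConst] using hg.norm_le (φ x)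
  | succ k ih =>
    have hε := hφ.nonneg
    have hM := hg.nonneg
    have hd := hφ.differentiable_of_sub_id
    refine succ_iff.2 ⟨hg.differentiable.comp hd, fun x => ?_, ?_⟩
    · exact (hg.norm_le _).trans (le_mul_of_one_le_left hM (one_le_compConst hε))
    -- As Dφ = 1 + D(φ - id), the derivative of g ∘ φ is Dg ∘ φ plus its composite with D(φ - id).
    -- The second term costs 2^k ε, which yields the new factor 1 + 2^k ε.
    · have h1 := ih hg.fderiv (hφ.of_le (Nat.le_succ k))
      have h2 := h1.add (h1.clm_comp hφ.fderiv)
      have : _root_.fderiv ℝ (fun x => g (φ x)) = fun x => _root_.fderiv ℝ g (φ x) +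
          (_root_.fderiv ℝ g (φ x)).comp (_root_.fderiv ℝ (fun x => φ x - x) x) := by
        funext x
        rw [show (fun x => g (φ x)) = g ∘ φ from rfl,
          fderiv_comp x (hg.differentiable _) (hd x), hφ.fderiv_eq_of_sub_id]
        simp
      rw [this]
      refine h2.mono (le_of_eq ?_)
      rw [compConst, compConst, Finset.prod_range_succ]
      ring

/-- The constant in the bound on the difference of two compositions. -/
noncomputable def diffConst : ℕ → ℝ
  | 0 => 1
  | k + 1 => diffConst k * (1 + 2 ^ k) + 2 ^ k * compConst k 1

lemma one_le_diffConst (k : ℕ) : 1 ≤ diffConst k := by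
  induction k with
  | zero => exact le_rfl
  | succ k ih =>
    have h1 : (0 : ℝ) ≤ 2 ^ k * compConst k 1 :=
      mul_nonneg (by positivity) (zero_le_one.trans (one_le_compConst zero_le_one))
    have h2 : (1 : ℝ) ≤ 1 + 2 ^ k := by simp
    have := one_le_mul_of_one_le_of_one_le ih h2
    rw [diffConst]
    linarith

/-- The difference of the compositions of a function with two perturbations of the identity. -/
lemma comp_sub_comp {φ ψ : E → E} {η : ℝ} (hg : BddC (k + 1) g M)
    (hφ : BddC k (fun x => φ x - x) 1) (hψ : BddC k (fun x => ψ x - x) 1)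
    (hd : BddC k (fun x => φ x - ψ x) η) :
    BddC k (fun x => g (φ x) - g (ψ x)) (diffConst k * (M * η)) := by
  induction k generalizing F with
  | zero =>
    refine zero_iff.2 ⟨(hg.continuous.comp hφ.continuous_of_sub_id).sub
      (hg.continuous.comp hψ.continuous_of_sub_id), fun x => ?_⟩
    rw [diffConst, one_mul]
    exact (hg.norm_sub_le _ _).trans (mul_le_mul_of_nonneg_left (hd.norm_le x) hg.nonneg)
  | succ k ih =>
    have hη := hd.nonneg
    have hM := hg.nonneg
    have hφd := hφ.differentiable_of_sub_id
    have hψd := hψ.differentiable_of_sub_id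
    refine succ_iff.2 ⟨(hg.differentiable.comp hφd).sub (hg.differentiable.comp hψd),
      fun x => ?_, ?_⟩
    · refine (hg.norm_sub_le _ _).trans ?_
      refine (mul_le_mul_of_nonneg_left (hd.norm_le x) hM).trans ?_
      exact le_mul_of_one_le_left (by positivity) (one_le_diffConst _)
    -- Uses Dg(φ)Dφ - Dg(ψ)Dψ = (Dg(φ) - Dg(ψ))Dφ + Dg(ψ)(Dφ - Dψ), with Dφ written as a
    -- perturbation of 1. The extra derivative of g pays for the difference Dg(φ) - Dg(ψ).
    · have h1 := ih hg.fderiv (hφ.of_le (Nat.le_succ k)) (hψ.of_le (Nat.le_succ k))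
        (hd.of_le (Nat.le_succ k))
      have h2 := (hg.fderiv.of_le (Nat.le_succ k)).comp (hψ.of_le (Nat.le_succ k))
      have h3 := (h1.add (h1.clm_comp hφ.fderiv)).add (h2.clm_comp hd.fderiv)
      have : _root_.fderiv ℝ (fun x => g (φ x) - g (ψ x)) = fun x =>
          ((_root_.fderiv ℝ g (φ x) - _root_.fderiv ℝ g (ψ x)) +
          (_root_.fderiv ℝ g (φ x) - _root_.fderiv ℝ g (ψ x)).comp
            (_root_.fderiv ℝ (fun x => φ x - x) x)) +
          (_root_.fderiv ℝ g (ψ x)).comp (_root_.fderiv ℝ (fun x => φ x - ψ x) x) := by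
        funext x
        have e1 : _root_.fderiv ℝ (fun x => g (φ x)) x =
            (_root_.fderiv ℝ g (φ x)).comp (_root_.fderiv ℝ φ x) :=
          fderiv_comp x (hg.differentiable _) (hφd x)
        have e2 : _root_.fderiv ℝ (fun x => g (ψ x)) x =
            (_root_.fderiv ℝ g (ψ x)).comp (_root_.fderiv ℝ ψ x) :=
          fderiv_comp x (hg.differentiable _) (hψd x)
        have d1 : DifferentiableAt ℝ (fun x => g (φ x)) x := (hg.differentiable _).comp x (hφd x)
        have d2 : DifferentiableAt ℝ (fun x => g (ψ x)) x := (hg.differentiable _).comp x (hψd x)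
        rw [fderiv_fun_sub d1 d2, e1, e2, fderiv_fun_sub (hφd x) (hψd x),
          fderiv_fun_sub (hφd x) differentiableAt_fun_id]
        ext v
        simp
      rw [this]
      refine h3.mono (le_of_eq ?_)
      rw [diffConst]
      ring

end BddC

lemma IsCb.exists_bddC {k : ℕ} {g : E → F} (hg : IsCb k g) : ∃ M, BddC k g M := by
  choose! C hC using hg.2
  refine ⟨∑ j ∈ Finset.range (k + 1), |C j|, hg.1, fun j hj x => ?_⟩
  refine (hC j hj x).trans ((le_abs_self _).trans ?_)
  exact Finset.single_le_sum (f := fun j => |C j|) (fun i _ => abs_nonneg _)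
    (Finset.mem_range.2 (Nat.lt_succ_of_le hj))

end BddC
end RoughContinuity

namespace RoughContinuity

/-! ### Iterated Lie derivatives: chain rule, Euler identity, Faà di Bruno -/

section Gam

variable {E F : Type} [NormedAddCommGroup E] [NormedSpace ℝ E] [NormedAddCommGroup F]
  [NormedSpace ℝ F] {d : ℕ} {f : Fin d → E → E}

lemma Gam_append (u v : List (Fin d)) (φ : E → F) :
    Gam f (u ++ v) φ = Gam f u (Gam f v φ) := by
  induction u with
  | nil => rfl
  | cons a u ih => simp only [List.cons_append, Gam, ih]

lemma Gam_concat_id (w : List (Fin d)) (i : Fin d) : Gam f (w ++ [i]) id = Gam f w (f i) := by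
  rw [Gam_append]
  simp [Gam]

lemma contDiff_Gam {j : ℕ} {w : List (Fin d)} {φ : E → F} (hφ : ContDiff ℝ (j + w.length : ℕ) φ)
    (hf : ∀ i, ContDiff ℝ (j + w.length : ℕ) (f i)) : ContDiff ℝ j (Gam f w φ) := by
  induction w generalizing j with
  | nil => simpa [Gam] using hφ
  | cons i w ih =>
    have e : j + (i :: w).length = (j + 1) + w.length := by simp; omega
    rw [e] at hφ hf
    have h1 := ih hφ hf
    have h2 : ContDiff ℝ j (fderiv ℝ (Gam f w φ)) := h1.fderiv_right (by exact_mod_cast le_rfl)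
    exact h2.clm_apply ((hf i).of_le (by exact_mod_cast (by omega)))

lemma BddC.Gam {K j : ℕ} {A M : ℝ} {w : List (Fin d)} {φ : E → F} (hf : ∀ i, BddC K (f i) A)
    (hj : j + w.length ≤ K + 1) (hφ : BddC (j + w.length) φ M) :
    BddC j (Gam f w φ) ((2 ^ (K + 1) * A) ^ w.length * M) := by
  induction w generalizing j with
  | nil => simpa [RoughContinuity.Gam] using hφ
  | cons i w ih =>
    have e : j + (i :: w).length = (j + 1) + w.length := by simp; omega
    rw [e] at hφ hj
    have h1 := (ih hj hφ).fderiv.clm_apply ((hf i).of_le (by omega : j ≤ K))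
    refine h1.mono ?_
    have hA := (hf i).nonneg
    have hM := hφ.nonneg
    have : (2 : ℝ) ^ j ≤ 2 ^ (K + 1) := pow_le_pow_right₀ one_le_two (by omega)
    calc (2 : ℝ) ^ j * ((2 ^ (K + 1) * A) ^ w.length * M * A)
        ≤ 2 ^ (K + 1) * ((2 ^ (K + 1) * A) ^ w.length * M * A) := by gcongr
      _ = _ := by rw [List.length_cons, pow_succ]; ring

lemma differentiable_Gam {w : List (Fin d)} {φ : E → F} (hφ : ContDiff ℝ (w.length + 1 : ℕ) φ)
    (hf : ∀ i, ContDiff ℝ (w.length + 1 : ℕ) (f i)) : Differentiable ℝ (Gam f w φ) :=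
  (contDiff_Gam (j := 1) (by rwa [add_comm]) (by rwa [add_comm])).differentiable (by simp)

lemma hasFDerivAt_cosum {w : List (Fin d)} {G : List (Fin d) → List (Fin d) → E → F}
    {G' : List (Fin d) → List (Fin d) → E →L[ℝ] F} {x : E}
    (h : ∀ u v : List (Fin d), u.length + v.length = w.length → HasFDerivAt (G u v) (G' u v) x) :
    HasFDerivAt (fun y => cosum w fun u v => G u v y) (cosum w G') x := by
  induction w generalizing G G' with
  | nil => exact h _ _ rfl
  | cons a w ih =>
    exact (ih fun u v huv => h _ _ (by simp; omega)).add
      (ih fun u v huv => h _ _ (by simp; omega))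

/-- The chain rule for `Γ_w φ`. -/
lemma fderiv_Gam_apply {w : List (Fin d)} {φ : E → F} (hφ : ContDiff ℝ (w.length + 1 : ℕ) φ)
    (hf : ∀ i, ContDiff ℝ (w.length + 1 : ℕ) (f i)) (x ξ : E) :
    fderiv ℝ (Gam f w φ) x ξ =
      cosum w fun u v => Gam f u (fderiv ℝ φ) x (fderiv ℝ (Gam f v id) x ξ) := by
  induction w generalizing x ξ with
  | nil => simp [Gam, cosum]
  | cons i w ih =>
    have hφ' : ContDiff ℝ (w.length + 1 : ℕ) φ := hφ.of_le (by exact_mod_cast (by simp))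
    have hf' : ∀ i, ContDiff ℝ (w.length + 1 : ℕ) (f i) :=
      fun i => (hf i).of_le (by exact_mod_cast (by simp))
    have hDφ : ContDiff ℝ (w.length + 1 : ℕ) (fderiv ℝ φ) :=
      hφ.fderiv_right (by exact_mod_cast (by simp))
    have hG : ContDiff ℝ (2 : ℕ) (Gam f w φ) :=
      contDiff_Gam (hφ.of_le (by exact_mod_cast (by simp; omega)))
        fun i => (hf i).of_le (by exact_mod_cast (by simp; omega))
    have hF : ∀ v : List (Fin d), v.length ≤ w.length → ContDiff ℝ (2 : ℕ) (Gam f v id) := by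
      intro v hv
      exact contDiff_Gam contDiff_id
        fun i => (hf i).of_le (by exact_mod_cast (by simp; omega))
    have hfd : DifferentiableAt ℝ (f i) x := (hf i).differentiable (by simp) x
    have dG : ∀ {F' : Type} [NormedAddCommGroup F'] [NormedSpace ℝ F'] {g : E → F'},
        ContDiff ℝ (2 : ℕ) g → DifferentiableAt ℝ (fderiv ℝ g) x := by
      intro F' _ _ g hg
      exact (hg.fderiv_right (m := 1) (by norm_num)).differentiable (by simp) x
    -- Symmetry of the second derivative allows `ξ` and `f i x` to be exchanged, so Γ_i g can be
    -- differentiated in direction ξ by differentiating Dg · ξ along f_i.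
    have hstep : ∀ {F' : Type} [NormedAddCommGroup F'] [NormedSpace ℝ F'] {g : E → F'},
        ContDiff ℝ (2 : ℕ) g → fderiv ℝ (fun y => fderiv ℝ g y (f i y)) x ξ =
          fderiv ℝ (fderiv ℝ g) x (f i x) ξ + fderiv ℝ g x (fderiv ℝ (f i) x ξ) := by
      intro F' _ _ g hg
      rw [fderiv_clm_apply (dG hg) hfd]
      have hs := (hg.contDiffAt (x := x)).isSymmSndFDerivAt (by simp)
      simp [hs (f i x) ξ, add_comm]
    have hdu : ∀ u : List (Fin d), u.length ≤ w.length →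
        DifferentiableAt ℝ (Gam f u (fderiv ℝ φ)) x := by
      intro u hu
      exact differentiable_Gam (hDφ.of_le (by exact_mod_cast (by omega)))
        (fun i => (hf' i).of_le (by exact_mod_cast (by omega))) x
    -- The induction hypothesis is differentiated along f_i with ξ frozen. By the product rule the
    -- letter i joins either u or v, which is the recursion of `cosum`; the missing term with Df_i
    -- comes from the induction hypothesis in direction Df_i ξ.
    have key : fderiv ℝ (fderiv ℝ (Gam f w φ)) x (f i x) ξ = cosum w fun u v =>
        Gam f (i :: u) (fderiv ℝ φ) x (fderiv ℝ (Gam f v id) x ξ) +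
          Gam f u (fderiv ℝ φ) x (fderiv ℝ (fderiv ℝ (Gam f v id)) x (f i x) ξ) := by
      have h1 : HasFDerivAt (fun y => fderiv ℝ (Gam f w φ) y ξ)
          ((fderiv ℝ (fderiv ℝ (Gam f w φ)) x).flip ξ) x := by
        have := (dG hG).hasFDerivAt.clm_apply (hasFDerivAt_const ξ x)
        simpa using this
      have h2 := hasFDerivAt_cosum (w := w) (x := x)
        (G := fun u v y => Gam f u (fderiv ℝ φ) y (fderiv ℝ (Gam f v id) y ξ))
        (G' := fun u v => (Gam f u (fderiv ℝ φ) x).comp ((fderiv ℝ (fderiv ℝ (Gam f v id)) x).flip ξ)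
          + (fderiv ℝ (Gam f u (fderiv ℝ φ)) x).flip (fderiv ℝ (Gam f v id) x ξ)) (by
        intro u v huv
        have h3 : HasFDerivAt (fun y => fderiv ℝ (Gam f v id) y ξ)
            ((fderiv ℝ (fderiv ℝ (Gam f v id)) x).flip ξ) x := by
          have := (dG (hF v (by omega))).hasFDerivAt.clm_apply (hasFDerivAt_const ξ x)
          simpa using this
        exact (hdu u (by omega)).hasFDerivAt.clm_apply h3)
      have h4 : (fun y => fderiv ℝ (Gam f w φ) y ξ) =
          fun y => cosum w fun u v => Gam f u (fderiv ℝ φ) y (fderiv ℝ (Gam f v id) y ξ) := by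
        funext y
        exact ih hφ' hf' y ξ
      rw [h4] at h1
      have h5 := congrArg (fun L : E →L[ℝ] F => L (f i x)) (h1.unique h2)
      simp only [ContinuousLinearMap.flip_apply] at h5
      rw [h5]
      have := map_cosum (ContinuousLinearMap.apply ℝ F (f i x)) w
        (fun u v => (Gam f u (fderiv ℝ φ) x).comp ((fderiv ℝ (fderiv ℝ (Gam f v id)) x).flip ξ)
          + (fderiv ℝ (Gam f u (fderiv ℝ φ)) x).flip (fderiv ℝ (Gam f v id) x ξ))
      simp only [ContinuousLinearMap.apply_apply] at this
      rw [this]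
      refine cosum_congr fun u v _ => ?_
      simp [Gam, add_comm]
    simp only [Gam, cosum]
    rw [hstep hG, key, ih hφ' hf', cosum_add, add_assoc, ← cosum_add]
    congr 1
    refine cosum_congr fun u v huv => ?_
    rw [hstep (hF v (by omega)), map_add]

/-- Euler's identity for the grading by word length. -/
lemma length_smul_Gam {w : List (Fin d)} {φ : E → F} (hφ : ContDiff ℝ (w.length + 1 : ℕ) φ)
    (hf : ∀ i, ContDiff ℝ (w.length + 1 : ℕ) (f i)) (x : E) :
    (w.length : ℝ) • Gam f w φ x =
      cosum w fun u v => (v.length : ℝ) • Gam f u (fderiv ℝ φ) x (Gam f v id x) := by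
  induction w generalizing x with
  | nil => simp [cosum]
  | cons i w ih =>
    have hφ' : ContDiff ℝ (w.length + 1 : ℕ) φ := hφ.of_le (by exact_mod_cast (by simp))
    have hf' : ∀ i, ContDiff ℝ (w.length + 1 : ℕ) (f i) :=
      fun i => (hf i).of_le (by exact_mod_cast (by simp))
    have hDφ : ContDiff ℝ (w.length + 1 : ℕ) (fderiv ℝ φ) :=
      hφ.fderiv_right (by exact_mod_cast (by simp))
    have h1 : HasFDerivAt (fun y => (w.length : ℝ) • Gam f w φ y)
        ((w.length : ℝ) • fderiv ℝ (Gam f w φ) x) x :=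
      (differentiable_Gam hφ' hf' x).hasFDerivAt.const_smul _
    have h2 := hasFDerivAt_cosum (w := w) (x := x)
      (G := fun u v y => (v.length : ℝ) • Gam f u (fderiv ℝ φ) y (Gam f v id y))
      (G' := fun u v => (v.length : ℝ) • ((Gam f u (fderiv ℝ φ) x).comp (fderiv ℝ (Gam f v id) x)
        + (fderiv ℝ (Gam f u (fderiv ℝ φ)) x).flip (Gam f v id x))) (by
      intro u v huv
      have hu := differentiable_Gam (f := f) (w := u) (φ := fderiv ℝ φ)
        (hDφ.of_le (by exact_mod_cast (by omega)))
        (fun i => (hf' i).of_le (by exact_mod_cast (by omega))) x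
      have hv := differentiable_Gam (f := f) (w := v) (φ := (id : E → E)) contDiff_id
        (fun i => (hf' i).of_le (by exact_mod_cast (by omega))) x
      exact (hu.hasFDerivAt.clm_apply hv.hasFDerivAt).const_smul _)
    have h4 : (fun y => (w.length : ℝ) • Gam f w φ y) = fun y =>
        cosum w fun u v => (v.length : ℝ) • Gam f u (fderiv ℝ φ) y (Gam f v id y) := by
      funext y
      exact ih hφ' hf' y
    rw [h4] at h1
    have h5 := congrArg (fun L : E →L[ℝ] F => L (f i x)) (h1.unique h2)
    have h6 := map_cosum (ContinuousLinearMap.apply ℝ F (f i x)) w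
      (fun u v => (v.length : ℝ) • ((Gam f u (fderiv ℝ φ) x).comp (fderiv ℝ (Gam f v id) x)
        + (fderiv ℝ (Gam f u (fderiv ℝ φ)) x).flip (Gam f v id x)))
    simp only [ContinuousLinearMap.apply_apply] at h6
    rw [h6] at h5
    simp only [smul_apply] at h5
    -- (|w|+1) Γ_{iw}φ is the derivative of |w| Γ_w φ along f_i plus one further copy of Γ_{iw}φ.
    -- The chain rule with ξ = f_i expands that copy and raises the weight |v| to |v|+1 when i joins
    -- v.
    have h7 := fderiv_Gam_apply hφ' hf' x (f i x)
    simp only [Gam, cosum, List.length_cons, Nat.cast_add, Nat.cast_one, add_smul, one_smul]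
    rw [h5, h7, ← cosum_add, ← cosum_add]
    refine cosum_congr fun u v _ => ?_
    simp only [add_apply, ContinuousLinearMap.comp_apply,
      ContinuousLinearMap.flip_apply, smul_add]
    abel

lemma ofFn_comp_cast {α : Type*} {m n : ℕ} (h : m = n) (g : Fin n → α) :
    List.ofFn (g ∘ Fin.cast h) = List.ofFn g := by
  subst h; rfl

lemma ofFn_extendMiddle_self {n : ℕ} (c : OrderedFinpartition n) (k : Fin c.length) {α : Type*}
    (a : α) (w : Fin n → α) :
    List.ofFn ((Fin.cons a w : Fin (n + 1) → α) ∘ (c.extendMiddle k).emb k) =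
      a :: List.ofFn (w ∘ c.emb k) := by
  have hs : Function.update c.partSize k (c.partSize k + 1) k = c.partSize k + 1 := by simp
  have he : (c.extendMiddle k).emb k =
      (fun j => Fin.cases 0 (Fin.succ ∘ c.emb k) j) ∘ Fin.cast hs := dif_pos rfl
  rw [he]
  refine (ofFn_comp_cast hs ((Fin.cons a w : Fin (n + 1) → α) ∘
    fun j : Fin (c.partSize k + 1) => Fin.cases 0 (Fin.succ ∘ c.emb k) j)).trans ?_
  rw [List.ofFn_succ]
  rfl

lemma ofFn_extendMiddle_of_ne {n : ℕ} (c : OrderedFinpartition n) {k m : Fin c.length}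
    (hm : m ≠ k) {α : Type*} (a : α) (w : Fin n → α) :
    List.ofFn ((Fin.cons a w : Fin (n + 1) → α) ∘ (c.extendMiddle k).emb m) =
      List.ofFn (w ∘ c.emb m) := by
  have hs : Function.update c.partSize k (c.partSize k + 1) m = c.partSize m := by simp [hm]
  have he : (c.extendMiddle k).emb m = Fin.succ ∘ c.emb m ∘ Fin.cast hs := dif_neg hm
  rw [he]
  exact ofFn_comp_cast hs (w ∘ c.emb m)

/-- The Faà di Bruno formula for iterated Lie derivatives. -/
lemma Gam_eq_sum_partitions {n : ℕ} (w : Fin n → Fin d) {φ : E → F} (hφ : ContDiff ℝ n φ)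
    (hf : ∀ i, ContDiff ℝ n (f i)) (x : E) :
    Gam f (List.ofFn w) φ x = ∑ c : OrderedFinpartition n, iteratedFDeriv ℝ c.length φ x
      fun m => Gam f (List.ofFn (w ∘ c.emb m)) id x := by
  induction n generalizing x with
  | zero =>
    rw [Fintype.sum_unique]
    exact (iteratedFDeriv_zero_apply _).symm
  | succ n ih =>
    obtain ⟨i, w', rfl⟩ : ∃ i w', w = Fin.cons i w' := ⟨_, _, (Fin.cons_self_tail w).symm⟩
    have hφ' : ContDiff ℝ n φ := hφ.of_le (by exact_mod_cast (by simp))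
    have hf' : ∀ i, ContDiff ℝ n (f i) := fun i => (hf i).of_le (by exact_mod_cast (by simp))
    have e : Gam f (List.ofFn w') φ = fun y => ∑ c : OrderedFinpartition n,
        iteratedFDeriv ℝ c.length φ y fun m => Gam f (List.ofFn (w' ∘ c.emb m)) id y := by
      funext y
      exact ih w' hφ' hf' y
    have hterm : ∀ c : OrderedFinpartition n, HasFDerivAt (fun y =>
        iteratedFDeriv ℝ c.length φ y fun m => Gam f (List.ofFn (w' ∘ c.emb m)) id y)
        ((ContinuousMultilinearMap.apply ℝ (fun _ : Fin c.length => E) F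
            fun m => Gam f (List.ofFn (w' ∘ c.emb m)) id x).comp
              (fderiv ℝ (iteratedFDeriv ℝ c.length φ) x) +
          ∑ k, ((iteratedFDeriv ℝ c.length φ x).toContinuousLinearMap
            (fun m => Gam f (List.ofFn (w' ∘ c.emb m)) id x) k).comp
              (fderiv ℝ (Gam f (List.ofFn (w' ∘ c.emb k)) id) x)) x := by
      intro c
      refine HasFDerivAt.continuousMultilinearMap_apply
        (f := iteratedFDeriv ℝ c.length φ)
        (g := fun m y => Gam f (List.ofFn (w' ∘ c.emb m)) id y)
        (f' := fderiv ℝ (iteratedFDeriv ℝ c.length φ) x)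
        (g' := fun m => fderiv ℝ (Gam f (List.ofFn (w' ∘ c.emb m)) id) x) ?_ ?_
      · refine (hφ.differentiable_iteratedFDeriv ?_ x).hasFDerivAt
        exact_mod_cast Nat.lt_succ_of_le c.length_le
      · intro m
        refine (differentiable_Gam contDiff_id (fun i => (hf i).of_le ?_) x).hasFDerivAt
        have := c.partSize_le m
        exact_mod_cast (by simpa using this)
    have hsum := HasFDerivAt.fun_sum (u := Finset.univ) fun c _ => hterm c
    rw [List.ofFn_cons, Gam]
    simp only
    -- A partition of n+1 positions arises from one of n positions by making the new position a
    -- block of its own, when the derivative falls on D^kφ, or by adding it to an existing block,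
    -- when the derivative falls on that argument.
    rw [e, hsum.fderiv, ← (OrderedFinpartition.extendEquiv n).sum_comp, Fintype.sum_sigma]
    simp only [sum_apply]
    refine Finset.sum_congr rfl fun c _ => ?_
    rw [Fintype.sum_option]
    simp only [add_apply, sum_apply, ContinuousLinearMap.comp_apply]
    congr 1
    · refine Eq.trans ?_ (iteratedFDeriv_succ_apply_left (𝕜 := ℝ) (f := φ) (x := x)
        (n := c.length) (fun m : Fin (c.length + 1) => Gam f
          (List.ofFn ((Fin.cons i w' : Fin (n + 1) → Fin d) ∘ c.extendLeft.emb m)) id x)).symm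
      have h0 : Gam f (List.ofFn ((Fin.cons i w' : Fin (n + 1) → Fin d) ∘ c.extendLeft.emb
          (0 : Fin (c.length + 1)))) id x = f i x := by
        have : List.ofFn ((Fin.cons i w' : Fin (n + 1) → Fin d) ∘ c.extendLeft.emb
          (0 : Fin (c.length + 1))) = [i] := rfl
        rw [this]
        simp [Gam]
      exact congrArg (fun ξ => fderiv ℝ (iteratedFDeriv ℝ c.length φ) x ξ
        fun m => Gam f (List.ofFn (w' ∘ c.emb m)) id x) h0.symm
    · refine Finset.sum_congr rfl fun k _ => ?_
      refine congrArg (iteratedFDeriv ℝ c.length φ x) (funext fun m => ?_)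
      rcases eq_or_ne m k with rfl | hm
      · rw [Function.update_self]
        exact congrArg (fun l => Gam f l id x) (ofFn_extendMiddle_self c m i w').symm
      · rw [Function.update_of_ne hm]
        exact congrArg (fun l => Gam f l id x) (ofFn_extendMiddle_of_ne c hm i w').symm

/-- The lift of `φ (X)` along `F_w(X)` has the coefficients `Γ_w φ (X)`. -/
lemma composeLift_Gam {φ : E → F} {w : List (Fin d)} (hφ : ContDiff ℝ w.length φ)
    (hf : ∀ i, ContDiff ℝ w.length (f i)) {X : ℝ → List (Fin d) → E} {t : ℝ} {x : E}
    (hX : ∀ v : List (Fin d), v.length ≤ w.length → X t v = Gam f v id x) :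
    composeLift φ X t w = Gam f w φ x := by
  have h := Gam_eq_sum_partitions (f := f) w.get hφ hf x
  rw [List.ofFn_get] at h
  rw [h, composeLift, hX [] (Nat.zero_le _)]
  refine Finset.sum_congr rfl fun c _ => ?_
  congr 1
  funext m
  exact hX _ (by simpa using c.partSize_le m)

end Gam
end RoughContinuity

/-! ### Taylor expansion along the one-step map -/

namespace RoughContinuity

/-- Multiplying two truncated expansions produces a rectangle of pairs of words, while the truncated
product keeps a triangle. The difference contains only pairs of total length at least `p`, hence
terms of order τ^p. -/
lemma rect_sub_pairs {d : ℕ} {V : Type*} [AddCommGroup V] (m n p : ℕ) (hp : p ≤ n)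
    (K : List (Fin d) → List (Fin d) → V) :
    (sumWords m fun u => sumWords n (K u)) - (sumWords m fun u => sumWords (p - u.length) (K u)) =
      ∑ u ∈ words d m, ∑ v ∈ words d n \ words d (p - u.length), K u v := by
  simp only [sumWords_eq_sum]
  rw [← Finset.sum_sub_distrib]
  refine Finset.sum_congr rfl fun u _ => ?_
  rw [Finset.sum_sdiff_eq_sub]
  intro v hv
  rw [mem_words] at hv ⊢
  omega

/-- The size τ = |t-s|^γ may exceed 1, so surplus powers of τ are absorbed by a constant instead of
being dropped. -/
lemma pow_le_mul_pow {τ B : ℝ} (h0 : 0 ≤ τ) (hB : τ ≤ B) (h1 : 1 ≤ B) {a b L : ℕ} (hab : a ≤ b)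
    (hbL : b ≤ L) : τ ^ b ≤ B ^ L * τ ^ a := by
  obtain ⟨c, rfl⟩ := Nat.exists_eq_add_of_le hab
  rw [pow_add, mul_comm]
  gcongr
  exact (pow_le_pow_left₀ h0 hB c).trans (pow_le_pow_right₀ h1 (by omega))

section Taylor

variable {E : Type} [NormedAddCommGroup E] [NormedSpace ℝ E] {d : ℕ} {f : Fin d → E → E}

/-- The one-step map `x ↦ ∑_{|v| ≤ N} ⟨g, e_v⟩ F_v(x)`. -/
noncomputable def stepMap (f : Fin d → E → E) (N : ℕ) (g : List (Fin d) → ℝ) (x : E) : E :=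
  sumWords (N + 1) fun v => g v • Gam f v id x

/-- A truncated character of size `τ` in the homogeneous sense. -/
structure IsCharacterOfSize (N : ℕ) (K τ : ℝ) (g : List (Fin d) → ℝ) : Prop where
  character : IsTruncatedCharacter N g
  bound : ∀ w : List (Fin d), w.length ≤ N → |g w| ≤ K * τ ^ w.length

lemma sh_scale {α : Type*} (h : ℝ) (g : List α → ℝ) (u v : List α) :
    sh (fun w => h ^ w.length * g w) u v = h ^ (u.length + v.length) * sh g u v := by
  have : (shuffles u v).map (fun w => h ^ w.length * g w) =
      (shuffles u v).map fun w => h ^ (u.length + v.length) * g w :=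
    List.map_congr_left fun w hw => by rw [length_of_mem_shuffles hw]
  rw [sh, this, List.sum_map_mul_left, sh]

/-- Shuffling is graded by length, so dilations preserve characters. Letting h run from 0 to 1 joins
the unit to `g` without increasing the size. -/
lemma IsCharacterOfSize.scale {N : ℕ} {K τ h : ℝ} {g : List (Fin d) → ℝ}
    (hg : IsCharacterOfSize N K τ g) (h0 : 0 ≤ h) (h1 : h ≤ 1) :
    IsCharacterOfSize N K τ (fun w => h ^ w.length * g w) := by
  refine ⟨⟨by simp [hg.character.1], fun u v huv => ?_⟩, fun w hw => ?_⟩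
  · change sh _ u v = _
    have : sh g u v = _ := hg.character.2 u v huv
    rw [sh_scale, this, pow_add]
    ring
  · rw [abs_mul, abs_of_nonneg (pow_nonneg h0 _)]
    exact (mul_le_of_le_one_left (abs_nonneg _) (pow_le_one₀ h0 h1)).trans (hg.bound w hw)

/-- A common bound for the vector fields `Γ_w φ` and `F_w`. -/
noncomputable def gamConst (N : ℕ) (A : ℝ) : ℝ := (1 + 2 ^ (2 * N + 2) * A) ^ (2 * N + 2)

variable {N : ℕ} {A : ℝ}

lemma one_le_gamConst (hA : 0 ≤ A) : 1 ≤ gamConst N A :=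
  one_le_pow₀ (by simpa using by positivity)

lemma bddC_Gam {F : Type} [NormedAddCommGroup F] [NormedSpace ℝ F]
    (hA : 0 ≤ A) (hf : ∀ i, BddC (2 * N + 1) (f i) A) {j : ℕ} {w : List (Fin d)} {φ : E → F} {M : ℝ}
    (hj : j + w.length ≤ 2 * N + 2) (hφ : BddC (j + w.length) φ M) :
    BddC j (Gam f w φ) (gamConst N A * M) := by
  refine (BddC.Gam hf hj hφ).mono ?_
  have := hφ.nonneg
  gcongr
  calc (2 ^ (2 * N + 1 + 1) * A) ^ w.length ≤ (1 + 2 ^ (2 * N + 2) * A) ^ w.length := by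
        gcongr
        simp
    _ ≤ _ := pow_le_pow_right₀ (by simpa using by positivity) (by omega)

/-- The identity is unbounded, so the last letter is peeled off: F_{vi} = Γ_v f_i. Each further
letter costs one derivative, so F_w has 2N+2-|w| bounded derivatives. -/
lemma bddC_Gam_id (hA : 0 ≤ A) (hf : ∀ i, BddC (2 * N + 1) (f i) A) {j : ℕ} {w : List (Fin d)}
    (hw : w ≠ []) (hj : j + w.length ≤ 2 * N + 2) :
    BddC j (Gam f w id) (gamConst N A) := by
  have hw' := List.dropLast_append_getLast hw
  generalize w.dropLast = v at hw'
  generalize w.getLast hw = i at hw'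
  subst hw'
  rw [Gam_concat_id]
  have hj : j + v.length ≤ 2 * N + 1 := by simp at hj; omega
  refine (BddC.Gam hf (hj.trans (Nat.le_succ _)) ((hf i).of_le hj)).mono ?_
  have h1 : (1 : ℝ) ≤ 1 + 2 ^ (2 * N + 2) * A := by simpa using by positivity
  calc (2 ^ (2 * N + 1 + 1) * A) ^ v.length * A
      ≤ (1 + 2 ^ (2 * N + 2) * A) ^ v.length * (1 + 2 ^ (2 * N + 2) * A) := by
        gcongr
        · simp
        · have : (1 : ℝ) * A ≤ 2 ^ (2 * N + 2) * A := by
            gcongr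
            exact one_le_pow₀ one_le_two
          linarith
    _ = (1 + 2 ^ (2 * N + 2) * A) ^ (v.length + 1) := (pow_succ _ _).symm
    _ ≤ _ := pow_le_pow_right₀ h1 (by omega)

lemma bddC_fderiv_Gam_id (hA : 0 ≤ A) (hf : ∀ i, BddC (2 * N + 1) (f i) A) {j : ℕ}
    {w : List (Fin d)} (hj : j + 1 + w.length ≤ 2 * N + 2) :
    BddC j (fderiv ℝ (Gam f w id)) (gamConst N A) := by
  rcases eq_or_ne w [] with rfl | hw
  · have : fderiv ℝ (Gam f [] (id : E → E)) = fun _ => ContinuousLinearMap.id ℝ E := by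
      funext x; exact fderiv_id
    rw [this]
    exact (BddC.const _).mono (ContinuousLinearMap.norm_id_le.trans (one_le_gamConst hA))
  · exact (bddC_Gam_id hA hf hw hj).fderiv

lemma contDiff_of_bddC (hf : ∀ i, BddC (2 * N + 1) (f i) A) {j : ℕ} (hj : j ≤ 2 * N + 1) (i : Fin d) :
    ContDiff ℝ j (f i) := ((hf i).of_le hj).contDiff

lemma differentiable_Gam_id (hf : ∀ i, BddC (2 * N + 1) (f i) A) {w : List (Fin d)}
    (hw : w.length ≤ 2 * N) : Differentiable ℝ (Gam f w id) :=
  differentiable_Gam contDiff_id (contDiff_of_bddC hf (by omega))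

lemma hasFDerivAt_stepMap (hf : ∀ i, BddC (2 * N + 1) (f i) A) (g : List (Fin d) → ℝ) (x : E) :
    HasFDerivAt (stepMap f N g) (sumWords (N + 1) fun v => g v • fderiv ℝ (Gam f v id) x) x := by
  have : stepMap f N g = fun x => ∑ v ∈ words d (N + 1), g v • Gam f v id x := by
    funext x
    rw [stepMap, sumWords_eq_sum]
  rw [this, sumWords_eq_sum]
  refine HasFDerivAt.fun_sum fun v hv => ?_
  rw [mem_words] at hv
  exact ((differentiable_Gam_id hf (by omega)) x).hasFDerivAt.const_smul (g v)

lemma sumPairs_succ_of_right_nil {V : Type*} [AddCommMonoid V] (m : ℕ)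
    (K : List (Fin d) → List (Fin d) → V)
    (hK : ∀ u, K u [] = 0) :
    sumPairs (m + 1) K = sumWords m fun u => sumWords (m + 1 - u.length) (K u) := by
  rw [sumPairs, sumWords_eq_sum, sumWords_eq_sum]
  symm
  apply Finset.sum_subset
  · intro u hu
    rw [mem_words] at hu ⊢
    omega
  · intro u hu hu'
    rw [mem_words] at hu hu'
    have : m + 1 - u.length = 0 + 1 := by omega
    rw [this, sumWords_succ, hK]
    simp

/-- The Taylor expansion along the one-step map, uniformly in the base point. -/
lemma taylor_sup (hA : 0 ≤ A) (hf : ∀ i, BddC (2 * N + 1) (f i) A) {K B : ℝ} (hK : 0 ≤ K)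
    (hB : 1 ≤ B) (m : ℕ) (hm : m ≤ N + 1) :
    ∃ C, 0 ≤ C ∧ ∀ (F : Type) [NormedAddCommGroup F] [NormedSpace ℝ F] (φ : E → F) (M : ℝ),
      BddC m φ M → ∀ (g : List (Fin d) → ℝ) (τ : ℝ), 0 ≤ τ → τ ≤ B → IsCharacterOfSize N K τ g →
      ∀ x, ‖φ (stepMap f N g x) - sumWords m fun w => g w • Gam f w φ x‖ ≤ C * M * τ ^ m := by
  induction m with
  | zero =>
    refine ⟨1, zero_le_one, fun F _ _ φ M hφ g τ _ _ _ x => ?_⟩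
    simpa using hφ.norm_le _
  | succ m ih =>
    obtain ⟨C, hC0, hC⟩ := ih (by omega)
    have hc1 : 1 ≤ gamConst N A := one_le_gamConst hA
    set c := gamConst N A with hc
    refine ⟨C * ((words d (N + 1)).card * (N * K * (B ^ N * c))) +
      (words d m).card * ((words d (N + 1)).card * (K * (N * K) * (c * c) * B ^ (2 * N))),
      by positivity, fun F _ _ φ M hφ g τ hτ hτB hg x => ?_⟩
    have hM := hφ.nonneg
    have hDφ := hφ.fderiv
    -- The character is dilated by h. The remainder `e h` vanishes at h = 0, where the step map is
    -- the identity, and is the quantity sought at h = 1; it remains to bound its derivative in h.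
    let gs : ℝ → List (Fin d) → ℝ := fun h w => h ^ w.length * g w
    let gd : ℝ → List (Fin d) → ℝ := fun h w => (w.length * h ^ (w.length - 1)) * g w
    have hgd : ∀ h w, HasDerivAt (fun h => gs h w) (gd h w) h := fun h w =>
      (hasDerivAt_pow _ _).mul_const _
    have hgdb : ∀ h ∈ Ico (0 : ℝ) 1, ∀ w : List (Fin d), w.length ≤ N →
        |gd h w| ≤ N * K * τ ^ w.length := by
      intro h hh w hw
      rw [abs_mul, abs_mul, abs_of_nonneg (pow_nonneg hh.1 _), Nat.abs_cast]
      have h1 : (w.length : ℝ) * h ^ (w.length - 1) ≤ N * 1 :=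
        mul_le_mul (by exact_mod_cast hw) (pow_le_one₀ hh.1 hh.2.le) (pow_nonneg hh.1 _)
          (by positivity)
      calc _ ≤ N * 1 * (K * τ ^ w.length) :=
            mul_le_mul h1 (hg.bound w hw) (abs_nonneg _) (by positivity)
        _ = _ := by ring
    let Ψ' : ℝ → E := fun h => sumWords (N + 1) fun v => gd h v • Gam f v id x
    have hΨ : ∀ h, HasDerivAt (fun h => stepMap f N (gs h) x) (Ψ' h) h := by
      intro h
      simp only [stepMap, Ψ', sumWords_eq_sum]
      exact HasDerivAt.fun_sum fun v _ => (hgd h v).smul_const _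
    let e : ℝ → F := fun h => φ (stepMap f N (gs h) x) -
      sumWords (m + 1) fun w => gs h w • Gam f w φ x
    let e' : ℝ → F := fun h => fderiv ℝ φ (stepMap f N (gs h) x) (Ψ' h) -
      sumWords (m + 1) fun w => gd h w • Gam f w φ x
    have he : ∀ h, HasDerivAt e (e' h) h := by
      intro h
      refine HasDerivAt.sub ?_ ?_
      · exact (hφ.differentiable _).hasFDerivAt.comp_hasDerivAt h (hΨ h)
      · simp only [sumWords_eq_sum]
        exact HasDerivAt.fun_sum fun v _ => (hgd h v).smul_const _
    have he0 : e 0 = 0 := by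
      have h1 : ∀ (V : Type) [NormedAddCommGroup V] [NormedSpace ℝ V] (G : List (Fin d) → V) (n : ℕ),
          sumWords (n + 1) (fun w => gs 0 w • G w) = G [] := by
        intro V _ _ G n
        rw [sumWords_succ]
        simp [gs, sumWords_eq_zero, hg.character.1]
      simp only [e, stepMap]
      rw [h1, h1]
      simp [Gam]
    have he1 : e 1 = φ (stepMap f N g x) - sumWords (m + 1) fun w => g w • Gam f w φ x := by
      simp [e, gs]
    rw [← he1, ← sub_zero (e 1), ← he0]
    refine norm_image_sub_le_of_norm_deriv_le_segment_01' (f' := e')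
      (fun h _ => (he h).hasDerivWithinAt) fun h hh => ?_
    let G : List (Fin d) → List (Fin d) → F := fun u v =>
      (gs h u * gd h v) • Gam f u (fderiv ℝ φ) x (Gam f v id x)
    -- Differentiating h^{|w|} produces the weight |w|. Euler's identity `length_smul_Gam` moves it
    -- onto |v| in the deshuffled sum, and duality with the character property splits the
    -- coefficients into products. The weight |v| removes empty v, leaving |u| < m.
    have hpairs : (sumWords (m + 1) fun w => gd h w • Gam f w φ x) =
        sumWords m fun u => sumWords (m + 1 - u.length) (G u) := by
      rw [← sumPairs_succ_of_right_nil _ _ (fun u => by simp [G, gd])]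
      have h1 : (sumWords (m + 1) fun w => gd h w • Gam f w φ x) = sumWords (m + 1) fun w =>
          g w • cosum w fun u v => h ^ (u.length + v.length - 1) • ((v.length : ℝ) •
            Gam f u (fderiv ℝ φ) x (Gam f v id x)) := by
        refine sumWords_congr fun w hw => ?_
        have h2 := length_smul_Gam (f := f) (w := w) (φ := φ)
          ((hφ.of_le (by omega)).contDiff) (contDiff_of_bddC hf (by omega)) x
        have h3 : (cosum w fun u v => h ^ (u.length + v.length - 1) • ((v.length : ℝ) •
            Gam f u (fderiv ℝ φ) x (Gam f v id x))) = h ^ (w.length - 1) •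
            cosum w fun u v => (v.length : ℝ) • Gam f u (fderiv ℝ φ) x (Gam f v id x) := by
          have := map_cosum (DistribSMul.toAddMonoidHom F (h ^ (w.length - 1))) w
            fun u v => (v.length : ℝ) • Gam f u (fderiv ℝ φ) x (Gam f v id x)
          simp only [DistribSMul.toAddMonoidHom_apply] at this
          rw [this]
          exact cosum_congr fun u v huv => by rw [huv]
        rw [h3, ← h2, smul_smul, smul_smul]
        congr 1
        simp only [gd]
        ring
      rw [h1, sumWords_smul_cosum]
      refine sumPairs_congr fun u v huv => ?_
      have h4 : sh g u v = g u * g v := hg.character.2 u v (by omega)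
      rw [h4, smul_smul, smul_smul]
      congr 1
      simp only [gs, gd]
      rcases Nat.eq_zero_or_pos v.length with hv | hv
      · simp [hv]
      · rw [Nat.add_sub_assoc hv, pow_add]
        ring
    have hrect : (sumWords m fun u => gs h u • Gam f u (fderiv ℝ φ) x) (Ψ' h) =
        sumWords m fun u => sumWords (N + 1) (G u) := by
      simp only [Ψ', G, sumWords_eq_sum, sum_apply, smul_apply,
        map_sum, map_smul, Finset.smul_sum, smul_smul]
      rw [Finset.sum_comm]
      exact Finset.sum_congr rfl fun u _ => Finset.sum_congr rfl fun v _ => by rw [mul_comm]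
    -- The first term is the order-m remainder of Dφ, known by induction, times `Ψ' h`, which is of
    -- order τ since the empty word drops out. The second contains pairs with |u|+|v| ≥ m+1 only.
    have hsplit : e' h = (fderiv ℝ φ (stepMap f N (gs h) x) -
          sumWords m fun u => gs h u • Gam f u (fderiv ℝ φ) x) (Ψ' h) +
        ∑ u ∈ words d m, ∑ v ∈ words d (N + 1) \ words d (m + 1 - u.length), G u v := by
      rw [← rect_sub_pairs _ _ _ hm, ← hpairs, ← hrect]
      simp only [e', sub_apply]
      abel
    have hb1 := hC _ _ _ hDφ _ τ hτ hτB (hg.scale hh.1 hh.2.le) x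
    have hb2 : ‖Ψ' h‖ ≤ (words d (N + 1)).card * (N * K * (B ^ N * c)) * τ := by
      simp only [Ψ', sumWords_eq_sum]
      refine (norm_sum_le_of_le _ (n := fun _ => N * K * (B ^ N * c) * τ) fun v hv => ?_).trans
        (le_of_eq ?_)
      · rw [mem_words] at hv
        rcases eq_or_ne v [] with rfl | hv0
        · simp only [gd]
          simp
          positivity
        · rw [norm_smul, Real.norm_eq_abs]
          have h5 := (bddC_Gam_id (j := 0) hA hf hv0 (by omega)).norm_le x
          have h6 := hgdb h hh v (by omega)
          have h7 : τ ^ v.length ≤ B ^ N * τ ^ 1 :=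
            pow_le_mul_pow hτ hτB hB (List.length_pos_iff.2 hv0) (by omega)
          calc |gd h v| * ‖Gam f v id x‖ ≤ (N * K * (B ^ N * τ ^ 1)) * c := by
                refine mul_le_mul (h6.trans ?_) h5 (norm_nonneg _) (by positivity)
                gcongr
            _ = _ := by ring
      · simp
        ring
    have hb3 : ‖∑ u ∈ words d m, ∑ v ∈ words d (N + 1) \ words d (m + 1 - u.length), G u v‖ ≤
        (words d m).card * ((words d (N + 1)).card * (K * (N * K) * (c * c) * B ^ (2 * N) *
          (M * τ ^ (m + 1)))) := by
      refine (norm_sum_le_of_le _ fun u hu => ?_).trans_eq (Finset.sum_const _ |>.trans (nsmul_eq_mul _ _))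
      rw [mem_words] at hu
      refine (norm_sum_le_of_le _ (n := fun _ => K * (N * K) * (c * c) * B ^ (2 * N) *
          (M * τ ^ (m + 1))) fun v hv => ?_).trans ?_
      · simp only [Finset.mem_sdiff, mem_words, not_lt] at hv
        simp only [G]
        rcases eq_or_ne v [] with rfl | hv0
        · simp only [gd]
          simp
          positivity
        · rw [norm_smul, Real.norm_eq_abs, abs_mul]
          have h5 := (bddC_Gam_id (j := 0) hA hf hv0 (by omega)).norm_le x
          have h6 := hgdb h hh v (by omega)
          have h8 := (hg.scale hh.1 hh.2.le).bound u (by omega)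
          have h9 := (bddC_Gam (j := 0) hA hf (by omega)
            (hDφ.of_le (by omega : 0 + u.length ≤ m))).norm_le x
          have h7 : τ ^ (u.length + v.length) ≤ B ^ (2 * N) * τ ^ (m + 1) :=
            pow_le_mul_pow hτ hτB hB (by omega) (by omega)
          calc |gs h u| * |gd h v| * ‖Gam f u (fderiv ℝ φ) x (Gam f v id x)‖
              ≤ (K * τ ^ u.length) * (N * K * τ ^ v.length) * (c * M * c) := by
                refine mul_le_mul (mul_le_mul h8 h6 (abs_nonneg _) (by positivity))
                  ((ContinuousLinearMap.le_opNorm _ _).trans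
                    (mul_le_mul h9 h5 (norm_nonneg _) (by positivity))) (norm_nonneg _)
                  (by positivity)
            _ = K * (N * K) * (c * M * c) * τ ^ (u.length + v.length) := by
                rw [pow_add]; ring
            _ ≤ K * (N * K) * (c * M * c) * (B ^ (2 * N) * τ ^ (m + 1)) := by gcongr
            _ = _ := by ring
      · rw [Finset.sum_const, nsmul_eq_mul]
        gcongr
        exact Finset.sdiff_subset
    rw [hsplit]
    refine (norm_add_le _ _).trans ((add_le_add ((ContinuousLinearMap.le_opNorm _ _).trans
      (mul_le_mul hb1 hb2 (norm_nonneg _) (by positivity))) hb3).trans (le_of_eq ?_))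
    ring

lemma fderiv_Gam_eq_cosum {F : Type} [NormedAddCommGroup F] [NormedSpace ℝ F] {w : List (Fin d)}
    {φ : E → F} (hφ : ContDiff ℝ (w.length + 1 : ℕ) φ)
    (hf : ∀ i, ContDiff ℝ (w.length + 1 : ℕ) (f i)) (x : E) :
    fderiv ℝ (Gam f w φ) x =
      cosum w fun u v => (Gam f u (fderiv ℝ φ) x).comp (fderiv ℝ (Gam f v id) x) := by
  ext ξ
  rw [fderiv_Gam_apply hφ hf]
  have := map_cosum (ContinuousLinearMap.apply ℝ F ξ) w
    fun u v => (Gam f u (fderiv ℝ φ) x).comp (fderiv ℝ (Gam f v id) x)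
  simp only [ContinuousLinearMap.apply_apply] at this
  rw [this]
  rfl

/-- The Taylor expansion along the one-step map in `C^k`. -/
lemma taylor (hA : 0 ≤ A) (hf : ∀ i, BddC (2 * N + 1) (f i) A) {K B : ℝ} (hK : 0 ≤ K)
    (hB : 1 ≤ B) (k m : ℕ) (hk : k ≤ N + 1) (hm : m ≤ N + 1) :
    ∃ C, 0 ≤ C ∧ ∀ (F : Type) [NormedAddCommGroup F] [NormedSpace ℝ F] (φ : E → F) (M : ℝ),
      BddC (k + m) φ M → ∀ (g : List (Fin d) → ℝ) (τ : ℝ), 0 ≤ τ → τ ≤ B →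
      IsCharacterOfSize N K τ g →
      BddC k (fun x => φ (stepMap f N g x) - sumWords m fun w => g w • Gam f w φ x)
        (C * M * τ ^ m) := by
  obtain ⟨C₀, hC₀0, hC₀⟩ := taylor_sup hA hf hK hB m hm
  have hstep : ∀ g : List (Fin d) → ℝ, Differentiable ℝ (stepMap f N g) :=
    fun g x => (hasFDerivAt_stepMap hf g x).differentiableAt
  induction k with
  | zero =>
    refine ⟨C₀, hC₀0, fun F _ _ φ M hφ g τ hτ hτB hg => BddC.zero_iff.2 ⟨?_, ?_⟩⟩
    · refine (hφ.continuous.comp (hstep g).continuous).sub ?_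
      simp only [sumWords_eq_sum]
      refine continuous_finsetSum _ fun w hw => ?_
      rw [mem_words] at hw
      exact ((bddC_Gam (j := 0) hA hf (by omega) (hφ.of_le (by omega))).continuous).const_smul _
    · exact hC₀ F φ M (hφ.of_le (by omega)) g τ hτ hτB hg
  | succ k ih =>
    obtain ⟨C, hC0, hC⟩ := ih (by omega)
    have hc1 : 1 ≤ gamConst N A := one_le_gamConst hA
    set c := gamConst N A with hc
    refine ⟨C₀ + (2 ^ k * (C * ((words d (N + 1)).card * (K * B ^ N * c))) +
      (words d m).card * ((words d (N + 1)).card * (K * K * (2 ^ k * (c * c)) * B ^ (2 * N)))),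
      by positivity, fun F _ _ φ M hφ g τ hτ hτB hg => ?_⟩
    have hφ' : BddC (k + m + 1) φ M := by rwa [show k + m + 1 = k + 1 + m by omega]
    have hDφ := hφ'.fderiv
    have hM := hφ.nonneg
    have hdG : ∀ w : List (Fin d), w.length < m → Differentiable ℝ (Gam f w φ) := fun w hw =>
      differentiable_Gam ((hφ.of_le (by omega)).contDiff) (contDiff_of_bddC hf (by omega))
    have hd : ∀ x, HasFDerivAt (fun x => φ (stepMap f N g x) - sumWords m fun w =>
        g w • Gam f w φ x) ((fderiv ℝ φ (stepMap f N g x)).comp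
          (sumWords (N + 1) fun v => g v • fderiv ℝ (Gam f v id) x) -
          sumWords m fun w => g w • fderiv ℝ (Gam f w φ) x) x := by
      intro x
      refine HasFDerivAt.sub ?_ ?_
      · exact (hφ'.differentiable _).hasFDerivAt.comp x (hasFDerivAt_stepMap hf g x)
      · simp only [sumWords_eq_sum]
        exact HasFDerivAt.fun_sum fun w hw =>
          (hdG w (mem_words.1 hw) x).hasFDerivAt.const_smul (g w)
    refine BddC.succ_iff.2 ⟨fun x => (hd x).differentiableAt, fun x => ?_, ?_⟩
    · refine (hC₀ F φ M (hφ.of_le (by omega)) g τ hτ hτB hg x).trans ?_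
      gcongr
      exact le_add_of_nonneg_right (by positivity)
    · let G : List (Fin d) → List (Fin d) → E → E →L[ℝ] F := fun u v x =>
        (g u * g v) • (Gam f u (fderiv ℝ φ) x).comp (fderiv ℝ (Gam f v id) x)
      -- The same rectangle-minus-triangle splitting, now for the spatial derivative: the remainder
      -- of Dφ, controlled in `C^k` by induction, acts on the derivative of the step map, and the
      -- surplus pairs have |u|+|v| ≥ m.
      have hfd : fderiv ℝ (fun x => φ (stepMap f N g x) - sumWords m fun w => g w • Gam f w φ x) =
          fun x => (fderiv ℝ φ (stepMap f N g x) -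
              sumWords m fun u => g u • Gam f u (fderiv ℝ φ) x).comp
            (∑ v ∈ words d (N + 1), g v • fderiv ℝ (Gam f v id) x) +
          ∑ u ∈ words d m, ∑ v ∈ words d (N + 1) \ words d (m - u.length), G u v x := by
        funext x
        rw [(hd x).fderiv, ← rect_sub_pairs _ _ _ hm]
        have hpairs : (sumWords m fun w => g w • fderiv ℝ (Gam f w φ) x) =
            sumWords m fun u => sumWords (m - u.length) fun v => G u v x := by
          change _ = sumPairs m fun u v => G u v x
          have h1 : (sumWords m fun w => g w • fderiv ℝ (Gam f w φ) x) = sumWords m fun w =>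
              g w • cosum w fun u v =>
                (Gam f u (fderiv ℝ φ) x).comp (fderiv ℝ (Gam f v id) x) := by
            refine sumWords_congr fun w hw => ?_
            rw [fderiv_Gam_eq_cosum ((hφ.of_le (by omega)).contDiff)
              (contDiff_of_bddC hf (by omega))]
          rw [h1, sumWords_smul_cosum]
          refine sumPairs_congr fun u v huv => ?_
          have h4 : sh g u v = g u * g v := hg.character.2 u v (by omega)
          rw [h4]
        have hrect : (sumWords m fun u => g u • Gam f u (fderiv ℝ φ) x).comp
            (∑ v ∈ words d (N + 1), g v • fderiv ℝ (Gam f v id) x) =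
            sumWords m fun u => sumWords (N + 1) fun v => G u v x := by
          ext ξ
          simp only [G, sumWords_eq_sum, sum_apply, smul_apply, ContinuousLinearMap.comp_apply,
            map_sum, map_smul, Finset.smul_sum, smul_smul]
          rw [Finset.sum_comm]
          exact Finset.sum_congr rfl fun u _ => Finset.sum_congr rfl fun v _ => by rw [mul_comm]
        rw [hpairs, ← hrect, ContinuousLinearMap.sub_comp, sumWords_eq_sum (N + 1)]
        abel
      rw [hfd]
      have hb1 := hC _ _ _ hDφ g τ hτ hτB hg
      have hb2 : BddC k (fun x => ∑ v ∈ words d (N + 1), g v • fderiv ℝ (Gam f v id) x)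
          ((words d (N + 1)).card * (K * B ^ N * c)) := by
        refine (BddC.sum (m := fun _ => K * B ^ N * c) fun v hv => ?_).mono (by simp)
        rw [mem_words] at hv
        refine ((bddC_fderiv_Gam_id (j := k) hA hf (by omega)).const_smul (g v)).mono ?_
        have h1 := hg.bound v (by omega)
        have h2 : τ ^ v.length ≤ B ^ N * τ ^ 0 :=
          pow_le_mul_pow hτ hτB hB (Nat.zero_le _) (by omega)
        gcongr
        refine h1.trans ?_
        gcongr
        simpa using h2
      have hb3 : BddC k
          (fun x => ∑ u ∈ words d m, ∑ v ∈ words d (N + 1) \ words d (m - u.length), G u v x)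
          ((words d m).card * ((words d (N + 1)).card * (K * K * (2 ^ k * (c * c)) * B ^ (2 * N) *
          (M * τ ^ m)))) := by
        refine (BddC.sum (m := fun _ => (words d (N + 1)).card * (K * K * (2 ^ k * (c * c)) *
          B ^ (2 * N) * (M * τ ^ m))) fun u hu => ?_).mono (by simp)
        rw [mem_words] at hu
        refine (BddC.sum (m := fun _ => K * K * (2 ^ k * (c * c)) *
          B ^ (2 * N) * (M * τ ^ m)) fun v hv => ?_).mono ?_
        · simp only [Finset.mem_sdiff, mem_words, not_lt] at hv
          have h1 := bddC_Gam (j := k) (w := u) hA hf (by omega)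
            (hDφ.of_le (by omega))
          have h2 := bddC_fderiv_Gam_id (j := k) (w := v) hA hf (by omega)
          refine ((h1.clm_comp h2).const_smul (g u * g v)).mono ?_
          have h3 := hg.bound u (by omega)
          have h4 := hg.bound v (by omega)
          have h7 : τ ^ (u.length + v.length) ≤ B ^ (2 * N) * τ ^ m :=
            pow_le_mul_pow hτ hτB hB (by omega) (by omega)
          calc |g u * g v| * (2 ^ k * (gamConst N A * M * gamConst N A))
              ≤ ((K * τ ^ u.length) * (K * τ ^ v.length)) * (2 ^ k * (c * M * c)) := by
                rw [abs_mul]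
                gcongr
            _ = K * K * (2 ^ k * (c * M * c)) * τ ^ (u.length + v.length) := by
                rw [pow_add]; ring
            _ ≤ K * K * (2 ^ k * (c * M * c)) * (B ^ (2 * N) * τ ^ m) := by gcongr
            _ = _ := by ring
        · rw [Finset.sum_const, nsmul_eq_mul]
          gcongr
          exact Finset.sdiff_subset
      refine ((hb1.clm_comp hb2).add hb3).mono ?_
      have : 0 ≤ C₀ * M * τ ^ m := by positivity
      refine (le_add_of_nonneg_left this).trans (le_of_eq ?_)
      ring

end Taylor
end RoughContinuity

namespace RoughContinuity

/-! ### Bisection over partitions -/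

section Bisection

/-- An estimate on intervals which is stable under cutting an interval in three pieces, the outer
ones being of at most half the length. -/
lemma bisection {a L A η δ : ℝ} (ha : 0 < a) (hL : 0 ≤ L) (hLa : 2 * L * (1 / 2) ^ a < 1)
    (hA : 0 ≤ A) {p : ℕ → ℝ} (hp : Monotone p) {P : ℕ → ℕ → ℝ → Prop}
    (hmono : ∀ i j b b', P i j b → b ≤ b' → P i j b') (h0 : ∀ i, P i i 0)
    (hη : A / (1 - 2 * L * (1 / 2) ^ a) * δ ^ a ≤ η)
    (hrec : ∀ i m j b b', i ≤ m → m < j → p j - p i ≤ δ → 0 ≤ b → 0 ≤ b' → b ≤ η → b' ≤ η →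
      P i m b → P (m + 1) j b' → P i j (L * (b + b') + A * (p j - p i) ^ a))
    (i j : ℕ) (hij : i ≤ j) (hδ : p j - p i ≤ δ) :
    P i j (A / (1 - 2 * L * (1 / 2) ^ a) * (p j - p i) ^ a) := by
  -- K is the fixed point of the recursion: 2L · 2^{-a} K + A = K.
  set K := A / (1 - 2 * L * (1 / 2) ^ a) with hK
  have hpos : 0 < 1 - 2 * L * (1 / 2) ^ a := by linarith
  have hK0 : 0 ≤ K := div_nonneg hA hpos.le
  have hKeq : K * (1 - 2 * L * (1 / 2) ^ a) = A := div_mul_cancel₀ A hpos.ne'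
  induction hn : j - i using Nat.strong_induction_on generalizing i j with
  | _ n ih =>
    rcases hij.eq_or_lt with rfl | hlt
    · refine hmono _ _ _ _ (h0 i) ?_
      rw [sub_self, Real.zero_rpow ha.ne', mul_zero]
    · let Q : ℕ → Prop := fun m => p m - p i ≤ (p j - p i) / 2
      have hℓ : 0 ≤ p j - p i := sub_nonneg.2 (hp hij)
      have hQi : Q i := by simp only [Q]; linarith
      classical
      -- The last partition point in the left half. Then [p i, p m] and [p (m+1), p j] have at most
      -- half the length, while the single step between them may be long, which is why three pieces
      -- are used.
      set m := Nat.findGreatest Q (j - 1) with hm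
      have him : i ≤ m := Nat.le_findGreatest (by omega) hQi
      have hmj : m < j := by
        have := Nat.findGreatest_le (P := Q) (j - 1)
        omega
      have hQm : Q m := Nat.findGreatest_spec (P := Q) (by omega : i ≤ j - 1) hQi
      have hr : p j - p (m + 1) ≤ (p j - p i) / 2 := by
        by_cases h : m + 1 ≤ j - 1
        · have : ¬ Q (m + 1) := Nat.findGreatest_is_greatest (by omega) h
          simp only [Q, not_le] at this
          linarith
        · have : m + 1 = j := by omega
          rw [this, sub_self]
          linarith
      have hl : p m - p i ≤ (p j - p i) / 2 := hQm
      have e1 : 0 ≤ p m - p i := sub_nonneg.2 (hp him)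
      have e2 : 0 ≤ p j - p (m + 1) := sub_nonneg.2 (hp (by omega))
      have hhalf : ((p j - p i) / 2) ^ a = (1 / 2) ^ a * (p j - p i) ^ a := by
        rw [← Real.mul_rpow (by norm_num) hℓ]
        congr 1
        ring
      have h1 := ih (m - i) (by omega) i m him (by linarith) rfl
      have h2 := ih (j - (m + 1)) (by omega) (m + 1) j (by omega) (by linarith) rfl
      have b1 : K * (p m - p i) ^ a ≤ K * ((1 / 2) ^ a * (p j - p i) ^ a) := by
        rw [← hhalf]; gcongr
      have b2 : K * (p j - p (m + 1)) ^ a ≤ K * ((1 / 2) ^ a * (p j - p i) ^ a) := by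
        rw [← hhalf]; gcongr
      have b3 : K * (p m - p i) ^ a ≤ η := le_trans (by gcongr; linarith) hη
      have b4 : K * (p j - p (m + 1)) ^ a ≤ η := le_trans (by gcongr; linarith) hη
      refine hmono _ _ _ _ (hrec i m j _ _ him hmj hδ (by positivity) (by positivity) b3 b4 h1 h2) ?_
      calc L * (K * (p m - p i) ^ a + K * (p j - p (m + 1)) ^ a) + A * (p j - p i) ^ a
          ≤ L * (K * ((1 / 2) ^ a * (p j - p i) ^ a) + K * ((1 / 2) ^ a * (p j - p i) ^ a)) +
            A * (p j - p i) ^ a := by gcongr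
        _ = K * (p j - p i) ^ a := by rw [← hKeq]; ring

end Bisection

/-! ### Compositions along partitions -/

section DiscreteFlow

variable {E : Type} {Ψ : ℝ → ℝ → E → E} {p : ℕ → ℝ}

/-- The composition of the maps `Ψ (p l) (p (l + 1))` for `i ≤ l < j`. -/
def discreteFlow (Ψ : ℝ → ℝ → E → E) (p : ℕ → ℝ) (i : ℕ) : ℕ → E → E
  | 0 => id
  | j + 1 => if i ≤ j then fun x => Ψ (p j) (p (j + 1)) (discreteFlow Ψ p i j x) else id

@[simp] lemma discreteFlow_self (i : ℕ) (x : E) : discreteFlow Ψ p i i x = x := by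
  cases i <;> simp [discreteFlow]

lemma discreteFlow_succ {i j : ℕ} (h : i ≤ j) (x : E) :
    discreteFlow Ψ p i (j + 1) x = Ψ (p j) (p (j + 1)) (discreteFlow Ψ p i j x) := by
  simp [discreteFlow, h]

lemma discreteFlow_comp {i m j : ℕ} (him : i ≤ m) (hmj : m ≤ j) (x : E) :
    discreteFlow Ψ p m j (discreteFlow Ψ p i m x) = discreteFlow Ψ p i j x := by
  induction j, hmj using Nat.le_induction with
  | base => simp
  | succ j hmj ih => rw [discreteFlow_succ hmj, discreteFlow_succ (him.trans hmj), ih]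

lemma discreteFlow_eq_step {i j : ℕ} (h : i < j) (x : E) :
    discreteFlow Ψ p i j x = discreteFlow Ψ p (i + 1) j (Ψ (p i) (p (i + 1)) x) := by
  rw [← discreteFlow_comp (Nat.le_succ i) h, discreteFlow_succ le_rfl, discreteFlow_self]

lemma discreteFlow_congr {q : ℕ → ℝ} {i j : ℕ} (h : ∀ l ≤ j, p l = q l) (x : E) :
    discreteFlow Ψ p i j x = discreteFlow Ψ q i j x := by
  induction j with
  | zero => rfl
  | succ j ih =>
    simp only [discreteFlow]
    split_ifs
    · beta_reduce
      rw [ih fun l hl => h l (by omega), h j (by omega), h (j + 1) le_rfl]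
    · rfl

end DiscreteFlow

/-! ### Uniform bounds for compositions of an almost flow -/

section AlmostFlow

variable {E : Type} [NormedAddCommGroup E] [NormedSpace ℝ E]

/-- A two-parameter family of perturbations of the identity which is a flow up to errors of order
`a > 1`, in the `C^k` sense. -/
structure IsAlmostFlow (k : ℕ) (T γ a D : ℝ) (Ψ : ℝ → ℝ → E → E) : Prop where
  γ_pos : 0 < γ
  one_lt : 1 < a
  near_id : ∀ s t, 0 ≤ s → s ≤ t → t ≤ T → BddC (k + 1) (fun x => Ψ s t x - x) (D * (t - s) ^ γ)
  almost : ∀ s u t, 0 ≤ s → s ≤ u → u ≤ t → t ≤ T →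
    BddC k (fun x => Ψ u t (Ψ s u x) - Ψ s t x) (D * (t - s) ^ a)

/-- A partition of a part of `[0, T]`, with possibly repeated points. -/
structure IsPartition (T : ℝ) (p : ℕ → ℝ) : Prop where
  mono : Monotone p
  nonneg : ∀ j, 0 ≤ p j
  le : ∀ j, p j ≤ T

variable {Ψ : ℝ → ℝ → E → E} {k : ℕ} {T γ a D : ℝ}

lemma IsAlmostFlow.self (hΨ : IsAlmostFlow k T γ a D Ψ) {s : ℝ} (hs : s ∈ Icc 0 T) (x : E) :
    Ψ s s x = x := by
  have := (hΨ.near_id s s hs.1 le_rfl hs.2).norm_le x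
  rw [sub_self, Real.zero_rpow hΨ.γ_pos.ne', mul_zero, norm_le_zero_iff, sub_eq_zero] at this
  exact this

/-- Each smallness condition of the bisection step holds strictly at z = 0 and is continuous in z.
-/
lemma exists_small (k : ℕ) {L : ℝ} (hL : 1 < L) : ∃ z : ℝ, 0 < z ∧ 2 * z ≤ 1 ∧
    BddC.compConst k z * z + z ≤ 1 ∧
    BddC.compConst k (BddC.compConst k (2 * z) * z + 2 * z) ≤ L ∧
    1 + BddC.diffConst k * (BddC.compConst (k + 1) z * z + z) ≤ L := by
  have c1 : Continuous fun z : ℝ => BddC.compConst k z * z + z :=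
    (BddC.continuous_compConst.mul continuous_id).add continuous_id
  have c2 : Continuous fun z : ℝ => BddC.compConst k (BddC.compConst k (2 * z) * z + 2 * z) :=
    BddC.continuous_compConst.comp (((BddC.continuous_compConst.comp
      (continuous_const.mul continuous_id)).mul continuous_id).add
      (continuous_const.mul continuous_id))
  have c3 : Continuous fun z : ℝ =>
      1 + BddC.diffConst k * (BddC.compConst (k + 1) z * z + z) :=
    continuous_const.add (continuous_const.mul
      ((BddC.continuous_compConst.mul continuous_id).add continuous_id))
  have e0 : ∀ᶠ z : ℝ in nhds 0, 2 * z < 1 :=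
    (continuous_const.mul continuous_id).tendsto' 0 0 (by simp) |>.eventually_lt_const (by norm_num)
  have e1 := (c1.tendsto' 0 0 (by simp)).eventually_lt_const (zero_lt_one)
  have e2 := (c2.tendsto' 0 1 (by simp)).eventually_lt_const hL
  have e3 := (c3.tendsto' 0 1 (by simp)).eventually_lt_const hL
  have := (((e0.and e1).and (e2.and e3)).filter_mono
    (nhdsWithin_le_nhds (s := Ioi (0 : ℝ)))).and self_mem_nhdsWithin
  obtain ⟨z, ⟨⟨h0, h1⟩, h2, h3⟩, hz⟩ := this.exists
  exact ⟨z, hz, h0.le, h1.le, h2.le, h3.le⟩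

lemma BddC.comp_sub_id {φ ψ : E → E} {ε η : ℝ} (hφ : BddC k (fun x => φ x - x) ε)
    (hψ : BddC k (fun x => ψ x - x) η) :
    BddC k (fun x => φ (ψ x) - x) (BddC.compConst k η * ε + η) := by
  have := (hφ.comp hψ).add hψ
  simpa using this

/-- One step of the bisection argument for almost flows. -/
lemma bddC_three_steps {z L δA : ℝ} (hz1 : 2 * z ≤ 1)
    (hz2 : BddC.compConst k z * z + z ≤ 1)
    (hz3 : BddC.compConst k (BddC.compConst k (2 * z) * z + 2 * z) ≤ L)
    (hz4 : 1 + BddC.diffConst k * (BddC.compConst (k + 1) z * z + z) ≤ L)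
    {A A' S B B' U V : E → E} {b b' : ℝ} (hb : b ≤ z)
    (hA' : BddC (k + 1) (fun x => A' x - x) z) (hS : BddC (k + 1) (fun x => S x - x) z)
    (hB' : BddC (k + 1) (fun x => B' x - x) z) (hU : BddC (k + 1) (fun x => U x - x) z)
    (hAA' : BddC k (fun x => A x - A' x) b') (hBB' : BddC k (fun x => B x - B' x) b)
    (hSB : BddC k (fun x => S (B' x) - U x) δA) (hAU : BddC k (fun x => A' (U x) - V x) δA) :
    BddC k (fun x => A (S (B x)) - V x)
      (L * (b + b') + (2 + BddC.diffConst k) * δA) := by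
  have hb0 := hBB'.nonneg
  have hb0' := hAA'.nonneg
  have hδ := hSB.nonneg
  have hk := Nat.le_succ k
  have hz1' : z ≤ 1 := by linarith
  have hB : BddC k (fun x => B x - x) (2 * z) := by
    have := hBB'.add (hB'.of_le hk)
    simp only [sub_add_sub_cancel] at this
    exact this.mono (by linarith)
  have hSB1 : BddC k (fun x => S (B x) - x) (BddC.compConst k (2 * z) * z + 2 * z) :=
    (hS.of_le hk).comp_sub_id hB
  have t1 := hAA'.comp hSB1
  have hQ : BddC (k + 1) (fun x => A' (S x) - x) (BddC.compConst (k + 1) z * z + z) :=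
    hA'.comp_sub_id hS
  have t2 := hBB'.add (hQ.comp_sub_comp (hB.mono hz1) ((hB'.of_le hk).mono hz1') hBB')
  have hSB'1 : BddC k (fun x => S (B' x) - x) 1 :=
    ((hS.of_le hk).comp_sub_id (hB'.of_le hk)).mono hz2
  have t3 := hSB.add (hA'.comp_sub_comp hSB'1 ((hU.of_le hk).mono hz1') hSB)
  have t := ((t1.add t2).add t3).add hAU
  -- Telescoping from A ∘ S ∘ B to V: replace A by A', then B by B' underneath A' ∘ S, then S ∘ B'
  -- by U, then A' ∘ U by V. Derivatives are lost only on A' and A' ∘ S, which are one-step maps and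
  -- known in `C^{k+1}`; the long compositions are needed only in `C^k`.
  have e : (fun x => A (S (B x)) - V x) = fun x => A (S (B x)) - A' (S (B x)) +
      (B x - B' x + (A' (S (B x)) - B x - (A' (S (B' x)) - B' x))) +
      (S (B' x) - U x + (A' (S (B' x)) - S (B' x) - (A' (U x) - U x))) + (A' (U x) - V x) := by
    funext x
    abel
  rw [e]
  refine t.mono ?_
  have h1 : BddC.compConst k (BddC.compConst k (2 * z) * z + 2 * z) * b' ≤ L * b' := by gcongr
  have h2 : (1 + BddC.diffConst k * (BddC.compConst (k + 1) z * z + z)) * b ≤ L * b := by gcongr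
  have h3 : BddC.diffConst k * (z * δA) ≤ BddC.diffConst k * (1 * δA) := by
    have := BddC.one_le_diffConst k
    gcongr
  linarith

/-- Compositions of an almost flow over a short interval. -/
lemma IsAlmostFlow.exists_local (hΨ : IsAlmostFlow k T γ a D Ψ) (hD : 0 ≤ D) :
    ∃ δ K, 0 < δ ∧ 0 ≤ K ∧ ∀ p, IsPartition T p → ∀ i j, i ≤ j → p j - p i ≤ δ →
      BddC k (fun x => discreteFlow Ψ p i j x - Ψ (p i) (p j) x) (K * (p j - p i) ^ a) ∧
      BddC k (fun x => discreteFlow Ψ p i j x - x) 1 := by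
  have ha : 0 < a := zero_lt_one.trans hΨ.one_lt
  have h2a : (1 / 2 : ℝ) ^ a < 1 / 2 := by
    conv_rhs => rw [← Real.rpow_one (1 / 2)]
    exact Real.rpow_lt_rpow_of_exponent_gt (by norm_num) (by norm_num) hΨ.one_lt
  have h2a0 : 0 < (1 / 2 : ℝ) ^ a := by positivity
  obtain ⟨L, hL1, hL⟩ : ∃ L : ℝ, 1 < L ∧ 2 * L * (1 / 2) ^ a < 1 := by
    -- The midpoint between 1 and 2^a / 2, which exceeds 1 because a > 1.
    refine ⟨(1 + 1 / (2 * (1 / 2) ^ a)) / 2, ?_, ?_⟩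
    · have : 1 < 1 / (2 * (1 / 2 : ℝ) ^ a) := by
        rw [lt_div_iff₀ (by positivity)]; linarith
      linarith
    · have : 1 / (2 * (1 / 2 : ℝ) ^ a) * (1 / 2) ^ a = 1 / 2 := by field_simp
      linarith
  obtain ⟨z, hz0, hz1, hz2, hz3, hz4⟩ := exists_small k hL1
  set A := (2 + BddC.diffConst k) * D with hA
  have hdc := BddC.one_le_diffConst k
  have hA0 : 0 ≤ A := by positivity
  set K := A / (1 - 2 * L * (1 / 2) ^ a) with hK
  have hK0 : 0 ≤ K := div_nonneg hA0 (by linarith)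
  have ev : ∀ c b : ℝ, 0 < b → ∀ᶠ δ in nhdsWithin (0 : ℝ) (Ioi 0), c * δ ^ b < z := by
    intro c b hb
    have h1 : Filter.Tendsto (fun δ : ℝ => c * δ ^ b) (nhds 0) (nhds 0) :=
      (continuous_const.mul (Real.continuous_rpow_const hb.le)).tendsto' 0 0
        (by simp [Real.zero_rpow hb.ne'])
    exact (h1.eventually_lt_const hz0).filter_mono nhdsWithin_le_nhds
  -- On intervals of length δ both the single steps, through D δ^γ, and the bisection errors,
  -- through K δ^a, stay below z.
  obtain ⟨δ, ⟨hδ1, hδ2⟩, hδ0⟩ :=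
    (((ev D γ hΨ.γ_pos).and (ev K a ha)).and self_mem_nhdsWithin).exists
  replace hδ0 : 0 < δ := hδ0
  refine ⟨δ, K, hδ0, hK0, fun p hp i j hij hδ => ?_⟩
  have near : ∀ i j, i ≤ j → p j - p i ≤ δ →
      BddC (k + 1) (fun x => Ψ (p i) (p j) x - x) z := by
    intro i j hij hδ
    refine (hΨ.near_id _ _ (hp.nonneg i) (hp.mono hij) (hp.le j)).mono (le_trans ?_ hδ1.le)
    have : 0 ≤ p j - p i := sub_nonneg.2 (hp.mono hij)
    have := hΨ.γ_pos
    gcongr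
  have main := bisection ha (by linarith) hL hA0 hp.mono
    (P := fun i j b => BddC k (fun x => discreteFlow Ψ p i j x - Ψ (p i) (p j) x) b)
    (η := z) (δ := δ) (fun i j b b' h hb => h.mono hb) (fun i => by
      simp only [discreteFlow_self, hΨ.self ⟨hp.nonneg i, hp.le i⟩, sub_self]
      exact (BddC.const (0 : E)).mono (by simp)) hδ2.le (by
    intro i m j b b' him hmj hδ hb0 hb0' hb hb' h1 h2
    have m1 := hp.mono him
    have m2 := hp.mono (Nat.le_succ m)
    have m3 := hp.mono (Nat.succ_le_of_lt hmj)
    simp only [Nat.succ_eq_add_one] at m2 m3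
    have := bddC_three_steps (k := k) (A := discreteFlow Ψ p (m + 1) j)
      (A' := Ψ (p (m + 1)) (p j)) (S := Ψ (p m) (p (m + 1))) (B := discreteFlow Ψ p i m)
      (B' := Ψ (p i) (p m)) (U := Ψ (p i) (p (m + 1))) (V := Ψ (p i) (p j))
      (δA := D * (p j - p i) ^ a) hz1 hz2 hz3 hz4 hb
      (near _ _ hmj (by linarith)) (near m (m + 1) (Nat.le_succ m) (by linarith)) (near _ _ him (by linarith))
      (near _ _ (by omega) (by linarith)) h2 h1
      ((hΨ.almost _ _ _ (hp.nonneg i) m1 m2 (hp.le _)).mono (by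
        have : 0 ≤ p (m + 1) - p i := by linarith
        gcongr))
      (hΨ.almost _ _ _ (hp.nonneg i) (by linarith) m3 (hp.le _))
    have e : ∀ x, discreteFlow Ψ p (m + 1) j (Ψ (p m) (p (m + 1)) (discreteFlow Ψ p i m x)) =
        discreteFlow Ψ p i j x := by
      intro x
      rw [← discreteFlow_comp (Nat.le_succ_of_le him) hmj, discreteFlow_succ him]
    simp only [e] at this
    refine this.mono (le_of_eq ?_)
    rw [hA]
    ring) i j hij hδ
  refine ⟨main, ?_⟩
  have h3 := main.add ((near i j hij hδ).of_le (Nat.le_succ k))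
  simp only [sub_add_sub_cancel] at h3
  refine h3.mono ?_
  have : 0 ≤ p j - p i := sub_nonneg.2 (hp.mono hij)
  have : K * (p j - p i) ^ a ≤ K * δ ^ a := by gcongr
  linarith

/-- Compositions of an almost flow over arbitrary fine partitions. -/
lemma IsAlmostFlow.exists_global (hΨ : IsAlmostFlow k T γ a D Ψ) (hD : 0 ≤ D) :
    ∃ δ K M, 0 < δ ∧ 0 ≤ K ∧ 0 ≤ M ∧ ∀ p, IsPartition T p → ∀ i j, i ≤ j →
      (p j - p i ≤ δ →
        BddC k (fun x => discreteFlow Ψ p i j x - Ψ (p i) (p j) x) (K * (p j - p i) ^ a)) ∧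
      ((∀ l, p (l + 1) - p l ≤ δ) → BddC k (fun x => discreteFlow Ψ p i j x - x) M) := by
  obtain ⟨δ, K, hδ, hK, h⟩ := hΨ.exists_local hD
  have key : ∀ r : ℕ, ∃ M : ℝ, 1 ≤ M ∧ ∀ p, IsPartition T p →
      (∀ l, p (l + 1) - p l ≤ δ / 2) → ∀ i j, i ≤ j → p j - p i ≤ r * (δ / 2) →
      BddC k (fun x => discreteFlow Ψ p i j x - x) M := by
    intro r
    induction r with
    | zero =>
      refine ⟨1, le_rfl, fun p hp _ i j hij hr => (h p hp i j hij ?_).2⟩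
      simp at hr
      linarith
    | succ r ih =>
      obtain ⟨M, hM, hr⟩ := ih
      have hc : 1 ≤ BddC.compConst k 1 := BddC.one_le_compConst zero_le_one
      refine ⟨BddC.compConst k 1 * M + 1, ?_, fun p hp hmesh i j hij hpr => ?_⟩
      · have : 0 ≤ BddC.compConst k 1 * M := by positivity
        linarith
      · classical
        let Q : ℕ → Prop := fun m => p m - p i ≤ δ
        have hQi : Q i := by simp [Q, hδ.le]
        -- The interval is cut at the last point within δ of p i. With mesh at most δ/2, either m =
        -- j or this piece is longer than δ/2, so the rest needs one unit of δ/2 less and the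
        -- induction on r applies.
        set m := Nat.findGreatest Q j with hm
        have him : i ≤ m := Nat.le_findGreatest hij hQi
        have hmj : m ≤ j := Nat.findGreatest_le (P := Q) j
        have hQm : Q m := Nat.findGreatest_spec (P := Q) hij hQi
        have hl := (h p hp i m him hQm).2
        have hrest : BddC k (fun x => discreteFlow Ψ p m j x - x) M := by
          refine hr p hp hmesh m j hmj ?_
          rcases hmj.eq_or_lt with hmj' | hlt
          · rw [hmj', sub_self]
            positivity
          · have : ¬ Q (m + 1) := Nat.findGreatest_is_greatest (by omega) hlt
            simp only [Q, not_le] at this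
            have := hmesh m
            push_cast at hpr
            linarith
        have := hrest.comp_sub_id hl
        simpa only [discreteFlow_comp him hmj] using this
  obtain ⟨r, hr⟩ := exists_nat_gt (T / (δ / 2))
  obtain ⟨M, hM, hglob⟩ := key r
  refine ⟨δ / 2, K, M, by positivity, hK, by linarith, fun p hp i j hij => ⟨fun hd => ?_, fun hd => ?_⟩⟩
  · exact (h p hp i j hij (by linarith)).1
  · refine hglob p hp hd i j hij ?_
    rw [div_lt_iff₀ (by positivity)] at hr
    linarith [hp.nonneg i, hp.le j]

end AlmostFlow

end RoughContinuity

namespace RoughContinuity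

/-! ### Limits of dyadic compositions and integral curves -/

section DiscreteFlow

lemma discreteFlow_eq_self_of_const {E : Type} {Ψ : ℝ → ℝ → E → E} {p : ℕ → ℝ} {i j : ℕ} (hij : i ≤ j) {t : ℝ} (hΨ : ∀ x, Ψ t t x = x)
    (h : ∀ l, i ≤ l → p l = t) (x : E) : discreteFlow Ψ p i j x = x := by
  induction j, hij using Nat.le_induction with
  | base => simp
  | succ j hij ih => rw [discreteFlow_succ hij, ih, h j hij, h (j + 1) (by omega), hΨ]

/-- Stability of compositions under perturbations of the single steps. -/
lemma norm_sub_discreteFlow_le {E : Type} [NormedAddCommGroup E] {Ψ : ℝ → ℝ → E → E} {p : ℕ → ℝ}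
    {L : ℝ} {m : ℕ}
    (hL : ∀ j ≤ m, ∀ x y, ‖discreteFlow Ψ p j m x - discreteFlow Ψ p j m y‖ ≤ L * ‖x - y‖)
    (hL0 : 0 ≤ L) (y : ℕ → E) (c : ℕ → ℝ)
    (hy : ∀ j < m, ‖y (j + 1) - Ψ (p j) (p (j + 1)) (y j)‖ ≤ c j) :
    ‖y m - discreteFlow Ψ p 0 m (y 0)‖ ≤ L * ∑ j ∈ Finset.range m, c j := by
  -- Each y j is transported to the final time by the discrete flow. Consecutive transported values
  -- differ by one local error, amplified by the Lipschitz constant.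
  have h1 : y m - discreteFlow Ψ p 0 m (y 0) = ∑ j ∈ Finset.range m,
      (discreteFlow Ψ p (j + 1) m (y (j + 1)) - discreteFlow Ψ p j m (y j)) := by
    rw [Finset.sum_range_sub fun j => discreteFlow Ψ p j m (y j), discreteFlow_self]
  rw [h1, Finset.mul_sum]
  refine norm_sum_le_of_le _ fun j hj => ?_
  have hj : j < m := Finset.mem_range.1 hj
  rw [discreteFlow_eq_step hj]
  exact (hL (j + 1) hj _ _).trans (mul_le_mul_of_nonneg_left (hy j hj) hL0)

end DiscreteFlow

section LimitFlow

variable {E : Type} [NormedAddCommGroup E] [NormedSpace ℝ E]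
variable {Ψ : ℝ → ℝ → E → E} {k : ℕ} {T γ a D : ℝ} {p : ℕ → ℝ}

lemma BddC.lipschitz_of_sub_id {φ : E → E} {ε : ℝ} (hφ : BddC (k + 1) (fun x => φ x - x) ε)
    (x y : E) : ‖φ x - φ y‖ ≤ (1 + ε) * ‖x - y‖ := by
  have h := hφ.norm_sub_le x y
  calc ‖φ x - φ y‖ = ‖(φ x - x - (φ y - y)) + (x - y)‖ := by congr 1; abel
    _ ≤ ε * ‖x - y‖ + ‖x - y‖ := (norm_add_le _ _).trans (add_le_add h le_rfl)
    _ = _ := by ring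

/-- `p` is a partition all of whose steps have length at most `δ`. -/
def IsFine (δ : ℝ) (p : ℕ → ℝ) : Prop := ∀ l, p (l + 1) - p l ≤ δ

/-- The only use of a > 1 in the convergence arguments: one power of each step sums to at most T and
the remaining power a-1 is small with the mesh. -/
lemma sum_rpow_le {δ : ℝ} (ha : 1 < a) (hp : IsPartition T p) (hδ : IsFine δ p) (m : ℕ) :
    ∑ j ∈ Finset.range m, (p (j + 1) - p j) ^ a ≤ δ ^ (a - 1) * T := by
  have h0 : ∀ j, 0 ≤ p (j + 1) - p j := fun j => sub_nonneg.2 (hp.mono (Nat.le_succ j))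
  have hδ0 : 0 ≤ δ := (h0 0).trans (hδ 0)
  calc ∑ j ∈ Finset.range m, (p (j + 1) - p j) ^ a
      ≤ ∑ j ∈ Finset.range m, δ ^ (a - 1) * (p (j + 1) - p j) := by
        refine Finset.sum_le_sum fun j _ => ?_
        rcases (h0 j).eq_or_lt with h | h
        · rw [← h, Real.zero_rpow (by linarith), mul_zero]
        · have : (p (j + 1) - p j) ^ a = (p (j + 1) - p j) ^ (a - 1) * (p (j + 1) - p j) := by
            rw [← Real.rpow_add_one h.ne', sub_add_cancel]
          rw [this]
          gcongr
          exact hδ j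
    _ = δ ^ (a - 1) * (p m - p 0) := by rw [← Finset.mul_sum, Finset.sum_range_sub]
    _ ≤ _ := by
        gcongr
        linarith [hp.le m, hp.nonneg 0]

/-- The dyadic partition of `[0, t]` with step `T / 2^n`. -/
noncomputable def dyadic (T : ℝ) (n : ℕ) (t : ℝ) (j : ℕ) : ℝ := min (j * (T / 2 ^ n)) t

lemma isPartition_dyadic {n : ℕ} {t : ℝ} (ht : t ∈ Icc 0 T) : IsPartition T (dyadic T n t) := by
  have hT : 0 ≤ T := ht.1.trans ht.2
  refine ⟨fun i j hij => ?_, fun j => le_min (by positivity) ht.1, fun j =>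
    (min_le_right _ _).trans ht.2⟩
  refine min_le_min_right _ ?_
  gcongr

lemma isFine_dyadic {n : ℕ} {t : ℝ} (hT : 0 ≤ T) : IsFine (T / 2 ^ n) (dyadic T n t) := by
  intro l
  have h : 0 ≤ T / 2 ^ n := by positivity
  have e : ((l + 1 : ℕ) : ℝ) * (T / 2 ^ n) = l * (T / 2 ^ n) + T / 2 ^ n := by push_cast; ring
  rw [dyadic, dyadic, e]
  rcases le_total (l * (T / 2 ^ n)) t with h1 | h1
  · rw [min_eq_left h1]
    linarith [min_le_left (l * (T / 2 ^ n) + T / 2 ^ n) t]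
  · rw [min_eq_right h1]
    linarith [min_le_right (l * (T / 2 ^ n) + T / 2 ^ n) t]

lemma dyadic_zero {n : ℕ} {t : ℝ} (ht : 0 ≤ t) : dyadic T n t 0 = 0 := by
  simp [dyadic, ht]

lemma dyadic_last {n : ℕ} {t : ℝ} (ht : t ≤ T) : dyadic T n t (2 ^ n) = t := by
  rw [dyadic]
  push_cast
  rw [mul_div_cancel₀ _ (by positivity)]
  exact min_eq_right ht

lemma dyadic_succ_double {n j : ℕ} {t : ℝ} : dyadic T (n + 1) t (2 * j) = dyadic T n t j := by
  rw [dyadic, dyadic, pow_succ]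
  congr 1
  push_cast
  field_simp

lemma tendsto_mesh (T : ℝ) : Filter.Tendsto (fun n : ℕ => T / 2 ^ n) Filter.atTop (nhds 0) := by
  have := tendsto_pow_atTop_nhds_zero_of_lt_one (r := (1 / 2 : ℝ)) (by norm_num) (by norm_num)
  have := this.const_mul T
  simpa [div_eq_mul_inv] using this

/-- The estimates on the compositions of an almost flow over fine partitions. -/
structure DiscreteBounds (k : ℕ) (T a δ K M : ℝ) (Ψ : ℝ → ℝ → E → E) : Prop where
  δ_pos : 0 < δ
  K_nonneg : 0 ≤ K
  M_nonneg : 0 ≤ M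
  near_step : ∀ p, IsPartition T p → ∀ i j, i ≤ j → p j - p i ≤ δ →
    ∀ x, ‖discreteFlow Ψ p i j x - Ψ (p i) (p j) x‖ ≤ K * (p j - p i) ^ a
  near_id : ∀ p, IsPartition T p → IsFine δ p → ∀ i j, i ≤ j →
    BddC k (fun x => discreteFlow Ψ p i j x - x) M

lemma IsAlmostFlow.exists_discreteBounds (hΨ : IsAlmostFlow k T γ a D Ψ) (hD : 0 ≤ D) :
    ∃ δ K M, DiscreteBounds k T a δ K M Ψ := by
  obtain ⟨δ, K, M, hδ, hK, hM, h⟩ := hΨ.exists_global hD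
  exact ⟨δ, K, M, hδ, hK, hM, fun p hp i j hij hd x => ((h p hp i j hij).1 hd).norm_le x,
    fun p hp hf i j hij => (h p hp i j hij).2 hf⟩

/-- Paths which follow the almost flow up to errors of order `a`. -/
def IsIntegralCurve (T a C : ℝ) (Ψ : ℝ → ℝ → E → E) (Y : ℝ → E) : Prop :=
  ∀ s t, 0 ≤ s → s ≤ t → t ≤ T → ‖Y t - Ψ s t (Y s)‖ ≤ C * (t - s) ^ a

variable {δ K M : ℝ}

lemma DiscreteBounds.lipschitz (hB : DiscreteBounds (k + 1) T a δ K M Ψ) (hp : IsPartition T p)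
    (hf : IsFine δ p) {i j : ℕ} (hij : i ≤ j) (x y : E) :
    ‖discreteFlow Ψ p i j x - discreteFlow Ψ p i j y‖ ≤ (1 + M) * ‖x - y‖ :=
  (hB.near_id p hp hf i j hij).lipschitz_of_sub_id x y

/-- Integral curves are approximated by compositions along fine partitions. -/
lemma DiscreteBounds.norm_curve_sub_le (hB : DiscreteBounds (k + 1) T a δ K M Ψ) (ha : 1 < a)
    {C : ℝ} {Y : ℝ → E} (hY : IsIntegralCurve T a C Ψ Y) (hC : 0 ≤ C) (hp : IsPartition T p)
    {ε : ℝ} (hf : IsFine ε p) (hε : ε ≤ δ) (m : ℕ) :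
    ‖Y (p m) - discreteFlow Ψ p 0 m (Y (p 0))‖ ≤ (1 + M) * (C * (ε ^ (a - 1) * T)) := by
  have hf' : IsFine δ p := fun l => (hf l).trans hε
  have hM := hB.M_nonneg
  refine (norm_sub_discreteFlow_le (L := 1 + M) (fun j hj x y => hB.lipschitz hp hf' hj x y)
    (by linarith) (fun j => Y (p j)) (fun j => C * (p (j + 1) - p j) ^ a) fun j _ =>
      hY _ _ (hp.nonneg j) (hp.mono (Nat.le_succ j)) (hp.le _)).trans ?_
  rw [← Finset.mul_sum]
  have := sum_rpow_le ha hp hf m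
  gcongr

/-- Integral curves with a given initial value are unique. -/
lemma DiscreteBounds.curve_unique (hB : DiscreteBounds (k + 1) T a δ K M Ψ) (ha : 1 < a)
    {C C' : ℝ} {Y Y' : ℝ → E} (hY : IsIntegralCurve T a C Ψ Y) (hC : 0 ≤ C)
    (hY' : IsIntegralCurve T a C' Ψ Y') (hC' : 0 ≤ C') (h0 : Y 0 = Y' 0) {t : ℝ}
    (ht : t ∈ Icc 0 T) : Y t = Y' t := by
  have hT : 0 ≤ T := ht.1.trans ht.2
  have hlim : Filter.Tendsto (fun n : ℕ => (1 + M) * (C * ((T / 2 ^ n) ^ (a - 1) * T)) +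
      (1 + M) * (C' * ((T / 2 ^ n) ^ (a - 1) * T))) Filter.atTop (nhds 0) := by
    have h1 := (Real.continuous_rpow_const (q := a - 1) (by linarith)).tendsto 0 |>.comp
      (tendsto_mesh T)
    rw [Real.zero_rpow (by linarith)] at h1
    have h2 := (((h1.mul_const T).const_mul C).const_mul (1 + M)).add
      (((h1.mul_const T).const_mul C').const_mul (1 + M))
    simpa using h2
  have hle : ∀ᶠ n : ℕ in Filter.atTop, ‖Y t - Y' t‖ ≤
      (1 + M) * (C * ((T / 2 ^ n) ^ (a - 1) * T)) +
      (1 + M) * (C' * ((T / 2 ^ n) ^ (a - 1) * T)) := by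
    filter_upwards [(tendsto_mesh T).eventually_le_const hB.δ_pos] with n hn
    have h1 := hB.norm_curve_sub_le ha hY hC (isPartition_dyadic (n := n) ht)
      (isFine_dyadic hT) hn (2 ^ n)
    have h2 := hB.norm_curve_sub_le ha hY' hC' (isPartition_dyadic (n := n) ht)
      (isFine_dyadic hT) hn (2 ^ n)
    rw [dyadic_last ht.2, dyadic_zero ht.1] at h1 h2
    rw [h0] at h1
    rw [norm_sub_rev] at h2
    have h3 := norm_sub_le_norm_sub_add_norm_sub (Y t)
      (discreteFlow Ψ (dyadic T n t) 0 (2 ^ n) (Y' 0)) (Y' t)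
    linarith
  have := ge_of_tendsto hlim hle
  rwa [norm_le_zero_iff, sub_eq_zero] at this

/-- Two successive dyadic approximations. -/
lemma DiscreteBounds.norm_dyadic_sub_le (hΨ : IsAlmostFlow (k + 1) T γ a D Ψ) (hD : 0 ≤ D)
    (hB : DiscreteBounds (k + 1) T a δ K M Ψ) {n : ℕ} (hn : T / 2 ^ n ≤ δ) {t : ℝ}
    (ht : t ∈ Icc 0 T) (x : E) :
    ‖discreteFlow Ψ (dyadic T (n + 1) t) 0 (2 ^ (n + 1)) x -
      discreteFlow Ψ (dyadic T n t) 0 (2 ^ n) x‖ ≤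
      (1 + M) * (D * ((T / 2 ^ n) ^ (a - 1) * T)) := by
  have hT : 0 ≤ T := ht.1.trans ht.2
  have hp := isPartition_dyadic (n := n) ht
  have hq := isPartition_dyadic (n := n + 1) ht
  have hf := isFine_dyadic (T := T) (n := n) (t := t) hT
  have hM := hB.M_nonneg
  set p := dyadic T n t with hp'
  set q := dyadic T (n + 1) t with hq'
  have hqp : ∀ j, q (2 * j) = p j := fun j => dyadic_succ_double
  -- The coarse points are the even fine points, so the fine composition is viewed as a perturbed
  -- coarse one: two fine steps against one coarse step differ by the almost-flow defect.
  have h := norm_sub_discreteFlow_le (Ψ := Ψ) (p := p) (L := 1 + M) (m := 2 ^ n)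
    (fun j hj x y => hB.lipschitz hp (fun l => (hf l).trans hn) hj x y) (by linarith)
    (fun j => discreteFlow Ψ q 0 (2 * j) x) (fun j => D * (p (j + 1) - p j) ^ a) (by
      intro j _
      rw [← hqp j, ← hqp (j + 1)]
      have e : 2 * (j + 1) = 2 * j + 1 + 1 := by ring
      rw [e, discreteFlow_succ (Nat.zero_le _), discreteFlow_succ (Nat.zero_le _)]
      exact (hΨ.almost _ _ _ (hq.nonneg _) (hq.mono (Nat.le_succ _)) (hq.mono (Nat.le_succ _))
        (hq.le _)).norm_le _)
  simp only [mul_zero, discreteFlow_self] at h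
  rw [← pow_succ'] at h
  refine h.trans ?_
  rw [← Finset.mul_sum]
  have := sum_rpow_le hΨ.one_lt hp hf (2 ^ n)
  gcongr

lemma DiscreteBounds.exists_limit [CompleteSpace E] (hΨ : IsAlmostFlow (k + 1) T γ a D Ψ)
    (hD : 0 ≤ D) (hB : DiscreteBounds (k + 1) T a δ K M Ψ) {t : ℝ}
    (ht : t ∈ Icc 0 T) (x : E) :
    ∃ y, Filter.Tendsto (fun n => discreteFlow Ψ (dyadic T n t) 0 (2 ^ n) x) Filter.atTop
      (nhds y) := by
  have hT : 0 ≤ T := ht.1.trans ht.2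
  have ha := hΨ.one_lt
  obtain ⟨n₀, hn₀⟩ := Filter.eventually_atTop.1
    ((tendsto_mesh T).eventually_le_const hB.δ_pos)
  -- Halving the mesh multiplies the error by 2^{-(a-1)}, so the sequence is Cauchy once the mesh is
  -- below δ, that is, from n₀ on.
  set r : ℝ := (1 / 2) ^ (a - 1) with hr
  have hr1 : r < 1 := Real.rpow_lt_one (by norm_num) (by norm_num) (by linarith)
  have hcs : CauchySeq fun n => discreteFlow Ψ (dyadic T (n + n₀) t) 0 (2 ^ (n + n₀)) x := by
    refine cauchySeq_of_le_geometric r ((1 + M) * (D * ((T / 2 ^ n₀) ^ (a - 1) * T))) hr1 fun n => ?_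
    rw [dist_comm, dist_eq_norm]
    have h := hB.norm_dyadic_sub_le hΨ hD (hn₀ (n + n₀) (by omega)) ht x
    have e : (T / 2 ^ (n + n₀)) ^ (a - 1) = (T / 2 ^ n₀) ^ (a - 1) * r ^ n := by
      have e0 : T / 2 ^ (n + n₀) = T / 2 ^ n₀ * (1 / 2) ^ n := by
        rw [pow_add, div_pow, one_pow]
        field_simp
      rw [e0, hr, Real.mul_rpow (by positivity) (by positivity), Real.rpow_pow_comm (by norm_num)]
    rw [e] at h
    have e2 : n + 1 + n₀ = n + n₀ + 1 := by ring
    rw [e2]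
    refine h.trans (le_of_eq ?_)
    ring
  obtain ⟨y, hy⟩ := cauchySeq_tendsto_of_complete hcs
  exact ⟨y, (Filter.tendsto_add_atTop_iff_nat n₀).1 hy⟩

/-- The dyadic approximations are approximate integral curves. -/
lemma DiscreteBounds.norm_dyadic_step_le (hΨ : IsAlmostFlow (k + 1) T γ a D Ψ) (hD : 0 ≤ D)
    (hB : DiscreteBounds (k + 1) T a δ K M Ψ) {n : ℕ} {s t : ℝ} (hT : 0 < T)
    (hs : 0 ≤ s) (hst : s ≤ t) (ht : t ≤ T) (hsT : s < T) (hn : t - s + T / 2 ^ n ≤ δ) (x : E) :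
    ‖discreteFlow Ψ (dyadic T n t) 0 (2 ^ n) x -
      Ψ s t (discreteFlow Ψ (dyadic T n s) 0 (2 ^ n) x)‖ ≤
      (K + D) * (t - s + T / 2 ^ n) ^ a := by
  have hh : 0 < T / 2 ^ n := by positivity
  have ha : 0 < a := zero_lt_one.trans hΨ.one_lt
  set h := T / 2 ^ n with hdef
  -- l h is the last grid point not exceeding s. The partitions for s and t agree up to it;
  -- afterwards the one for s makes a single step to s and stays there. Hence both compositions
  -- start from the same point y and only an interval of length at most t - s + h matters.
  set l := ⌊s / h⌋₊ with hl
  have hl1 : l * h ≤ s := by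
    rw [← le_div_iff₀ hh]; exact Nat.floor_le (by positivity)
  have hl2 : s < (l + 1) * h := by
    rw [← div_lt_iff₀ hh]; exact Nat.lt_floor_add_one _
  have hl3 : l < 2 ^ n := by
    have : (l : ℝ) * h < 2 ^ n * h := by
      rw [hdef, mul_div_cancel₀ _ (by positivity)]; linarith
    exact_mod_cast lt_of_mul_lt_mul_right this hh.le
  have hp := isPartition_dyadic (n := n) (T := T) (t := t) ⟨hs.trans hst, ht⟩
  have hpl : dyadic T n t l = l * h := min_eq_left (hl1.trans hst)
  have hpl' : dyadic T n s l = l * h := min_eq_left hl1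
  have hps : ∀ j, l + 1 ≤ j → dyadic T n s j = s := by
    intro j hj
    refine min_eq_right (hl2.le.trans ?_)
    rw [← hdef]
    gcongr
    exact_mod_cast hj
  have e1 : discreteFlow Ψ (dyadic T n s) 0 (2 ^ n) x =
      Ψ (l * h) s (discreteFlow Ψ (dyadic T n t) 0 l x) := by
    rw [← discreteFlow_comp (Nat.zero_le (l + 1)) hl3,
      discreteFlow_eq_self_of_const hl3 (hΨ.self ⟨hs, hsT.le⟩) hps,
      discreteFlow_succ (Nat.zero_le _), hpl', hps _ le_rfl]
    congr 1
    refine discreteFlow_congr (fun j hj => ?_) x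
    have : (j : ℝ) * h ≤ l * h := by gcongr
    rw [dyadic, dyadic, ← hdef, min_eq_left (by linarith), min_eq_left (by linarith)]
  have e2 : discreteFlow Ψ (dyadic T n t) 0 (2 ^ n) x =
      discreteFlow Ψ (dyadic T n t) l (2 ^ n) (discreteFlow Ψ (dyadic T n t) 0 l x) :=
    (discreteFlow_comp (Nat.zero_le _) hl3.le x).symm
  rw [e1, e2]
  generalize discreteFlow Ψ (dyadic T n t) 0 l x = y
  have hlen : t - l * h ≤ t - s + h := by linarith
  have hlen0 : 0 ≤ t - l * h := by linarith
  have h1 := hB.near_step _ hp l (2 ^ n) hl3.le (by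
    rw [dyadic_last ht, hpl]; linarith) y
  rw [dyadic_last ht, hpl] at h1
  have h2 := (hΨ.almost (l * h) s t (by positivity) hl1 hst ht).norm_le y
  rw [norm_sub_rev] at h2
  have hpow : (t - l * h) ^ a ≤ (t - s + h) ^ a := by gcongr
  have hK := hB.K_nonneg
  have h3 := norm_sub_le_norm_sub_add_norm_sub (discreteFlow Ψ (dyadic T n t) l (2 ^ n) y)
    (Ψ (l * h) t y) (Ψ s t (Ψ (l * h) s y))
  calc _ ≤ K * (t - l * h) ^ a + D * (t - l * h) ^ a := by linarith
    _ = (K + D) * (t - l * h) ^ a := by ring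
    _ ≤ _ := by gcongr

/-- An almost flow has integral curves, depending on the initial value in a Lipschitz way. -/
lemma IsAlmostFlow.exists_flow [CompleteSpace E] (hΨ : IsAlmostFlow (k + 1) T γ a D Ψ)
    (hD : 0 ≤ D) (hT : 0 < T) :
    ∃ (X : E → ℝ → E) (C : ℝ), 0 ≤ C ∧ (∀ x, X x 0 = x) ∧
      (∀ x, IsIntegralCurve T a C Ψ (X x)) ∧
      ∀ t ∈ Icc 0 T, Continuous fun x => X x t := by
  obtain ⟨δ, K, M, hB⟩ := hΨ.exists_discreteBounds hD
  have hM := hB.M_nonneg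
  have hK := hB.K_nonneg
  have hδ := hB.δ_pos
  have ha : 0 < a := zero_lt_one.trans hΨ.one_lt
  have hlim : ∀ x t, ∃ y, t ∈ Icc 0 T → Filter.Tendsto
      (fun n => discreteFlow Ψ (dyadic T n t) 0 (2 ^ n) x) Filter.atTop (nhds y) := by
    intro x t
    by_cases ht : t ∈ Icc 0 T
    · obtain ⟨y, hy⟩ := hB.exists_limit hΨ hD ht x
      exact ⟨y, fun _ => hy⟩
    · exact ⟨0, fun h => absurd h ht⟩
  choose X hX using hlim
  have hfine := (tendsto_mesh T).eventually_le_const hδ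
  have hXid : ∀ x, ∀ t ∈ Icc 0 T, ‖X x t - x‖ ≤ M := by
    intro x t ht
    refine le_of_tendsto ((hX x t ht).sub_const x).norm ?_
    filter_upwards [hfine] with n hn
    exact (hB.near_id _ (isPartition_dyadic ht) (fun l => (isFine_dyadic hT.le l).trans hn) 0 _
      (Nat.zero_le _)).norm_le x
  have hXlip : ∀ t ∈ Icc 0 T, ∀ x y, ‖X x t - X y t‖ ≤ (1 + M) * ‖x - y‖ := by
    intro t ht x y
    refine le_of_tendsto ((hX x t ht).sub (hX y t ht)).norm ?_
    filter_upwards [hfine] with n hn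
    exact hB.lipschitz (isPartition_dyadic ht) (fun l => (isFine_dyadic hT.le l).trans hn)
      (Nat.zero_le _) x y
  have hcont : ∀ s t, 0 ≤ s → s ≤ t → t ≤ T → Continuous (Ψ s t) := fun s t h1 h2 h3 =>
    (hΨ.near_id s t h1 h2 h3).continuous_of_sub_id
  have hlocal : ∀ x s t, 0 ≤ s → s ≤ t → t ≤ T → t - s ≤ δ / 2 →
      ‖X x t - Ψ s t (X x s)‖ ≤ (K + D) * (t - s) ^ a := by
    intro x s t hs hst ht hd
    have ht' : t ∈ Icc 0 T := ⟨hs.trans hst, ht⟩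
    have hs' : s ∈ Icc 0 T := ⟨hs, hst.trans ht⟩
    -- The grid comparison needs the last grid point before s to lie strictly before T; for s = T
    -- there is nothing to prove.
    rcases hs'.2.eq_or_lt with h | hsT
    · have : s = t := by linarith
      subst this
      rw [hΨ.self hs', sub_self, norm_zero, sub_self, Real.zero_rpow ha.ne', mul_zero]
    · have h1 := ((hX x t ht').sub
        (((hcont s t hs hst ht).tendsto _).comp (hX x s hs'))).norm
      have h2 : Filter.Tendsto (fun n : ℕ => (K + D) * (t - s + T / 2 ^ n) ^ a) Filter.atTop
          (nhds ((K + D) * (t - s) ^ a)) := by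
        have h3 := (tendsto_mesh T).const_add (t - s)
        rw [add_zero] at h3
        exact (((Real.continuous_rpow_const ha.le).tendsto _).comp h3).const_mul _
      refine le_of_tendsto_of_tendsto h1 h2 ?_
      filter_upwards [(tendsto_mesh T).eventually_le_const (half_pos hδ)] with n hn
      exact hB.norm_dyadic_step_le hΨ hD hT hs hst ht hsT (by linarith) x
  have hδa : 0 < (δ / 2) ^ a := by positivity
  -- The last summand serves intervals longer than δ/2, where X stays within M of its starting point
  -- and one step moves by at most D T^γ.
  refine ⟨X, K + D + (2 * M + D * T ^ γ) / (δ / 2) ^ a, by positivity, fun x => ?_,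
    fun x s t hs hst ht => ?_, fun t ht => ?_⟩
  · refine tendsto_nhds_unique (hX x 0 ⟨le_rfl, hT.le⟩) ?_
    have : ∀ n, discreteFlow Ψ (dyadic T n 0) 0 (2 ^ n) x = x := by
      intro n
      refine discreteFlow_eq_self_of_const (t := 0) (Nat.zero_le _)
        (hΨ.self ⟨le_rfl, hT.le⟩) (fun l _ => ?_) x
      exact min_eq_right (by positivity)
    simp only [this]
    exact tendsto_const_nhds
  · have hst0 : 0 ≤ t - s := by linarith
    have hγ := hΨ.γ_pos
    rcases le_total (t - s) (δ / 2) with hd | hd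
    · refine (hlocal x s t hs hst ht hd).trans ?_
      exact mul_le_mul_of_nonneg_right (le_add_of_nonneg_right (by positivity)) (by positivity)
    · have h1 := hXid x t ⟨hs.trans hst, ht⟩
      have h2 := hXid x s ⟨hs, hst.trans ht⟩
      have h3 := (hΨ.near_id s t hs hst ht).norm_le (X x s)
      have h4 : D * (t - s) ^ γ ≤ D * T ^ γ := by gcongr; linarith
      have h5 : ‖X x t - Ψ s t (X x s)‖ ≤ 2 * M + D * T ^ γ := by
        have e : X x t - Ψ s t (X x s) = (X x t - x) - (X x s - x) - (Ψ s t (X x s) - X x s) := by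
          abel
        rw [e]
        refine (norm_sub_le _ _).trans ?_
        have := norm_sub_le (X x t - x) (X x s - x)
        linarith
      refine h5.trans ?_
      have h6 : 2 * M + D * T ^ γ = (2 * M + D * T ^ γ) / (δ / 2) ^ a * (δ / 2) ^ a := by
        field_simp
      exact h6.le.trans <| mul_le_mul (le_add_of_nonneg_left (by positivity : 0 ≤ K + D))
        (Real.rpow_le_rpow (by positivity) hd ha.le) (by positivity) (by positivity)
  · refine (LipschitzWith.of_dist_le' (K := 1 + M) fun x y => ?_).continuous
    rw [dist_eq_norm, dist_eq_norm]
    exact hXlip t ht x y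

end LimitFlow

end RoughContinuity

namespace RoughContinuity

/-! ### One-step maps of a rough path form an almost flow -/

section RoughStep

variable {E : Type} [NormedAddCommGroup E] [NormedSpace ℝ E] {d : ℕ} {f : Fin d → E → E}

lemma one_le_level {γ : ℝ} (hγ : 0 < γ) (hγ1 : γ ≤ 1) : 1 ≤ level γ := by
  rw [level, Nat.one_le_floor_iff]
  exact (one_le_inv₀ hγ).2 hγ1

/-- The truncation level is chosen exactly so that errors of order N+1 can be summed over
partitions. -/
lemma one_lt_level_succ_mul {γ : ℝ} (hγ : 0 < γ) : 1 < ((level γ + 1 : ℕ) : ℝ) * γ := by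
  have h := Nat.lt_floor_add_one γ⁻¹
  rw [inv_lt_iff_one_lt_mul₀ hγ] at h
  push_cast
  rw [mul_comm]
  simpa [level, mul_comm] using h

lemma rpow_natCast_mul' {x γ : ℝ} (hx : 0 ≤ x) (n : ℕ) : x ^ ((n : ℝ) * γ) = (x ^ γ) ^ n := by
  rw [mul_comm, Real.rpow_mul hx, Real.rpow_natCast]

/-- Vector fields of class `C_b^{2N+1}` and a rough path, with explicit bounds. -/
structure RoughData (γ T : ℝ) (f : Fin d → E → E) (W : ℝ → List (Fin d) → ℝ) (A K : ℝ) : Prop where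
  γ_pos : 0 < γ
  γ_le : γ ≤ 1
  T_pos : 0 < T
  A_nonneg : 0 ≤ A
  K_nonneg : 0 ≤ K
  bdd : ∀ i, BddC (2 * level γ + 1) (f i) A
  rough : IsWeaklyGeometricRoughPath γ T W
  size : ∀ s ∈ Icc 0 T, ∀ t ∈ Icc 0 T, IsCharacterOfSize (level γ) K (|t - s| ^ γ) (incr W s t)

lemma IsWeaklyGeometricRoughPath.exists_size {γ T : ℝ} {W : ℝ → List (Fin d) → ℝ}
    (hW : IsWeaklyGeometricRoughPath γ T W) : ∃ K, 0 ≤ K ∧ ∀ s ∈ Icc 0 T, ∀ t ∈ Icc 0 T,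
      IsCharacterOfSize (level γ) K (|t - s| ^ γ) (incr W s t) := by
  choose! C hC using hW.2
  refine ⟨∑ w ∈ words d (level γ + 1), |C w|, Finset.sum_nonneg fun _ _ => abs_nonneg _,
    fun s hs t ht => ⟨hW.incr_character hs ht, fun w hw => ?_⟩⟩
  refine (hC w hw s hs t ht).trans ?_
  rw [rpow_natCast_mul' (abs_nonneg _)]
  gcongr
  exact (le_abs_self _).trans (Finset.single_le_sum (f := fun w => |C w|)
    (fun _ _ => abs_nonneg _) (mem_words.2 (Nat.lt_succ_of_le hw)))

lemma exists_roughData {γ T : ℝ} {W : ℝ → List (Fin d) → ℝ} (hγ : 0 < γ) (hγ1 : γ ≤ 1) (hT : 0 < T)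
    (hf : ∀ i, IsCb (2 * level γ + 1) (f i)) (hW : IsWeaklyGeometricRoughPath γ T W) :
    ∃ A K, RoughData γ T f W A K := by
  obtain ⟨K, hK, hsize⟩ := hW.exists_size
  choose M hM using fun i => (hf i).exists_bddC
  refine ⟨∑ i, M i, K, hγ, hγ1, hT, Finset.sum_nonneg fun i _ => (hM i).nonneg, hK, fun i => ?_,
    hW, hsize⟩
  exact (hM i).mono (Finset.single_le_sum (f := M) (fun i _ => (hM i).nonneg) (Finset.mem_univ i))

/-- The one-step approximation of the flow over `[s, t]`. -/
noncomputable def roughStep (γ : ℝ) (f : Fin d → E → E) (W : ℝ → List (Fin d) → ℝ) (s t : ℝ) :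
    E → E :=
  stepMap f (level γ) (incr W s t)

variable {N : ℕ} {A : ℝ}

lemma stepMap_sub_id (g : List (Fin d) → ℝ) (hg : g [] = 1) (x : E) :
    stepMap f N g x - x = ∑ v ∈ (words d (N + 1)).erase [], g v • Gam f v id x := by
  rw [stepMap, sumWords_eq_sum,
    ← Finset.add_sum_erase _ _ (mem_words.2 (by simp : ([] : List (Fin d)).length < N + 1)), hg]
  simp [Gam]

lemma bddC_stepMap_sub_id (hA : 0 ≤ A) (hf : ∀ i, BddC (2 * N + 1) (f i) A) {K B : ℝ} (hK : 0 ≤ K)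
    (hB : 1 ≤ B) : ∃ C, 0 ≤ C ∧ ∀ (g : List (Fin d) → ℝ) (τ : ℝ), 0 ≤ τ → τ ≤ B →
      IsCharacterOfSize N K τ g → BddC (N + 1 + 1) (fun x => stepMap f N g x - x) (C * τ) := by
  have hc1 : 1 ≤ gamConst N A := one_le_gamConst hA
  refine ⟨∑ v ∈ (words d (N + 1)).erase [], K * B ^ N * gamConst N A,
    Finset.sum_nonneg fun _ _ => by positivity, fun g τ hτ hτB hg => ?_⟩
  simp only [stepMap_sub_id g hg.character.1]
  rw [Finset.sum_mul]
  refine BddC.sum fun v hv => ?_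
  rw [Finset.mem_erase, mem_words] at hv
  refine ((bddC_Gam_id hA hf hv.1 (by omega)).const_smul (g v)).mono ?_
  have h1 := hg.bound v (by omega)
  have h2 : τ ^ v.length ≤ B ^ N * τ ^ 1 :=
    pow_le_mul_pow hτ hτB hB (List.length_pos_iff.2 hv.1) (by omega)
  calc |g v| * gamConst N A ≤ K * (B ^ N * τ ^ 1) * gamConst N A := by
        gcongr
        refine h1.trans ?_
        gcongr
    _ = _ := by ring

lemma stepMap_congr {g h : List (Fin d) → ℝ} (H : ∀ w : List (Fin d), w.length ≤ N → g w = h w)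
    (x : E) : stepMap f N g x = stepMap f N h x :=
  sumWords_congr fun w hw => by rw [H w (by omega)]

/-- Composition of one-step maps corresponds to the convolution product of characters. -/
lemma bddC_stepMap_comp (hA : 0 ≤ A) (hf : ∀ i, BddC (2 * N + 1) (f i) A) {K B : ℝ} (hK : 0 ≤ K)
    (hB : 1 ≤ B) : ∃ C, 0 ≤ C ∧ ∀ (g h : List (Fin d) → ℝ) (τ : ℝ), 0 ≤ τ → τ ≤ B →
      IsCharacterOfSize N K τ g → IsCharacterOfSize N K τ h →
      BddC (N + 1) (fun x => stepMap f N h (stepMap f N g x) - stepMap f N (conv g h) x)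
        (C * τ ^ (N + 1)) := by
  have hc1 : 1 ≤ gamConst N A := one_le_gamConst hA
  have ht := fun m (hm : m ≤ N + 1) => taylor hA hf hK hB (N + 1) m le_rfl hm
  choose! C hC0 hC using ht
  refine ⟨∑ v ∈ (words d (N + 1)).erase [], K * (C (N + 1 - v.length) * gamConst N A),
    Finset.sum_nonneg fun v _ => by have := hC0 (N + 1 - v.length) (by omega); positivity,
    fun g h τ hτ hτB hg hh => ?_⟩
  -- In the expansion of the convolution, the terms with outer word v form the Taylor polynomial of
  -- F_v of order N+1-|v|. Only Taylor remainders are left, and for the empty word the remainder is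
  -- zero.
  have e : ∀ x, stepMap f N h (stepMap f N g x) - stepMap f N (conv g h) x =
      ∑ v ∈ (words d (N + 1)).erase [], h v • (Gam f v id (stepMap f N g x) -
        sumWords (N + 1 - v.length) fun w => g w • Gam f w (Gam f v id) x) := by
    intro x
    have e1 : stepMap f N (conv g h) x = ∑ v ∈ words d (N + 1), h v •
        sumWords (N + 1 - v.length) fun w => g w • Gam f w (Gam f v id) x := by
      rw [stepMap, sumWords_conv, sumPairs_comm, sumPairs, sumWords_eq_sum]
      refine Finset.sum_congr rfl fun v _ => ?_
      simp only [sumWords_eq_sum, Finset.smul_sum, smul_smul, Gam_append]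
      exact Finset.sum_congr rfl fun w _ => by rw [mul_comm]
    have e2 : stepMap f N h (stepMap f N g x) =
        ∑ v ∈ words d (N + 1), h v • Gam f v id (stepMap f N g x) := by
      rw [stepMap, sumWords_eq_sum]
    rw [e1, e2, ← Finset.sum_sub_distrib]
    simp only [← smul_sub]
    rw [Finset.sum_erase]
    simp [Gam, stepMap]
  simp only [e]
  rw [Finset.sum_mul]
  refine BddC.sum fun v hv => ?_
  rw [Finset.mem_erase, mem_words] at hv
  -- This uses all 2N+2-|v| bounded derivatives of F_v: N+1 for the norm of the remainder and
  -- N+1-|v| for the expansion. The factor τ^{|v|} from h completes the order to N+1.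
  have hFv : BddC (N + 1 + (N + 1 - v.length)) (Gam f v id) (gamConst N A) :=
    bddC_Gam_id hA hf hv.1 (by omega)
  refine ((hC (N + 1 - v.length) (by omega) E _ _ hFv g τ hτ hτB hg).const_smul (h v)).mono ?_
  have h1 := hh.bound v (by omega)
  have h0 := hC0 (N + 1 - v.length) (by omega)
  calc |h v| * (C (N + 1 - v.length) * gamConst N A * τ ^ (N + 1 - v.length))
      ≤ K * τ ^ v.length * (C (N + 1 - v.length) * gamConst N A * τ ^ (N + 1 - v.length)) := by
        gcongr
    _ = K * (C (N + 1 - v.length) * gamConst N A) * τ ^ (v.length + (N + 1 - v.length)) := by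
        rw [pow_add]; ring
    _ = _ := by rw [Nat.add_sub_cancel' hv.2.le]

lemma IsCharacterOfSize.mono {K τ τ' : ℝ} {g : List (Fin d) → ℝ} (hg : IsCharacterOfSize N K τ g)
    (hK : 0 ≤ K) (h0 : 0 ≤ τ) (h : τ ≤ τ') : IsCharacterOfSize N K τ' g :=
  ⟨hg.character, fun w hw => (hg.bound w hw).trans (by gcongr)⟩

variable {γ T K : ℝ} {W : ℝ → List (Fin d) → ℝ}

namespace RoughData

/-- A bound for `(t - s)^γ`. -/
noncomputable def scale (γ T : ℝ) : ℝ := max 1 (T ^ γ)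

lemma one_le_scale : 1 ≤ scale γ T := le_max_left _ _

lemma rpow_le_scale (H : RoughData γ T f W A K) {s t : ℝ} (hs : 0 ≤ s) (hst : s ≤ t) (ht : t ≤ T) :
    (t - s) ^ γ ≤ scale γ T :=
  (Real.rpow_le_rpow (by linarith) (by linarith) H.γ_pos.le).trans (le_max_right _ _)

/-- Increments over subintervals of `[s, t]` are of size `(t - s)^γ`. -/
lemma size_of_le (H : RoughData γ T f W A K) {s u v t : ℝ} (hs : 0 ≤ s) (hsu : s ≤ u) (huv : u ≤ v)
    (hvt : v ≤ t) (ht : t ≤ T) : IsCharacterOfSize (level γ) K ((t - s) ^ γ) (incr W u v) := by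
  have h := H.size u ⟨hs.trans hsu, by linarith⟩ v ⟨by linarith, hvt.trans ht⟩
  rw [abs_of_nonneg (by linarith)] at h
  exact h.mono H.K_nonneg (Real.rpow_nonneg (by linarith) _)
    (Real.rpow_le_rpow (by linarith) (by linarith) H.γ_pos.le)

/-- Chen's relation identifies the convolution in `bddC_stepMap_comp` with the increment over the
whole interval. The regularity N+1 is what lets test functions of class `C_b^{N+1}` be transported
along the discrete flow. -/
lemma exists_isAlmostFlow (H : RoughData γ T f W A K) : ∃ D, 0 ≤ D ∧
    IsAlmostFlow (level γ + 1) T γ (((level γ + 1 : ℕ) : ℝ) * γ) D (roughStep γ f W) := by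
  obtain ⟨C₁, hC₁0, hC₁⟩ := bddC_stepMap_sub_id H.A_nonneg H.bdd H.K_nonneg
    (one_le_scale (γ := γ) (T := T))
  obtain ⟨C₂, hC₂0, hC₂⟩ := bddC_stepMap_comp H.A_nonneg H.bdd H.K_nonneg
    (one_le_scale (γ := γ) (T := T))
  refine ⟨C₁ + C₂, by positivity, H.γ_pos, one_lt_level_succ_mul H.γ_pos, fun s t hs hst ht => ?_,
    fun s u t hs hsu hut ht => ?_⟩
  · have h0 : 0 ≤ (t - s) ^ γ := Real.rpow_nonneg (by linarith) _
    refine (hC₁ _ _ h0 (H.rpow_le_scale hs hst ht)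
      (H.size_of_le hs le_rfl hst le_rfl ht)).mono ?_
    gcongr
    linarith
  · have hst := hsu.trans hut
    have h0 : 0 ≤ (t - s) ^ γ := Real.rpow_nonneg (by linarith) _
    have h1 := hC₂ _ _ _ h0 (H.rpow_le_scale hs hst ht)
      (H.size_of_le hs le_rfl hsu hut ht) (H.size_of_le hs hsu hut le_rfl ht)
    have e : ∀ x, stepMap f (level γ) (conv (incr W s u) (incr W u t)) x =
        roughStep γ f W s t x :=
      stepMap_congr fun w hw => H.rough.chen ⟨hs.trans hsu, hut.trans ht⟩ hw
    simp only [e] at h1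
    refine h1.mono ?_
    rw [rpow_natCast_mul' (by linarith)]
    gcongr
    linarith

end RoughData
end RoughStep

end RoughContinuity

namespace RoughContinuity

/-! ### Splitting off the last letter, as rough integrals do -/

section LastLetter

variable {d : ℕ}

lemma conv_concat (g h : List (Fin d) → ℝ) (w : List (Fin d)) (i : Fin d) :
    conv g h (w ++ [i]) = conv g (fun v => h (v ++ [i])) w + g (w ++ [i]) * h [] := by
  induction w generalizing g with
  | nil => simp [conv_cons, conv_nil]
  | cons a w ih => rw [List.cons_append, conv_cons, ih, conv_cons]; simp [add_assoc]

lemma sumWords_succ_concat {A : Type*} [AddCommMonoid A] (m : ℕ) (g : List (Fin d) → A) :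
    sumWords (m + 1) g = g [] + ∑ i, sumWords m (fun w => g (w ++ [i])) := by
  induction m generalizing g with
  | zero => rw [sumWords_succ]; simp
  | succ m ih =>
    rw [sumWords_succ]
    congr 1
    simp only [ih fun w => g (_ :: w), sumWords_succ m, Finset.sum_add_distrib, List.nil_append,
      List.cons_append]
    rw [Finset.sum_comm]

end LastLetter

/-! ### Rough integrals and equivalence of RDE solutions with integral curves -/

section RDE

variable {E : Type} [NormedAddCommGroup E] [NormedSpace ℝ E] {d : ℕ} {f : Fin d → E → E}
  {A γ T K : ℝ} {W : ℝ → List (Fin d) → ℝ}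

/-- The local approximation of the `i`-th rough integral along `F(Y)`. -/
noncomputable def localIntegral (γ : ℝ) (f : Fin d → E → E) (W : ℝ → List (Fin d) → ℝ) (i : Fin d)
    (Y : ℝ → E) (s t : ℝ) : E :=
  sumWords (level γ) fun w => incr W s t (w ++ [i]) • Gam f (w ++ [i]) id (Y s)

/-- Paths which follow the expansion of order `< N` up to errors of order `N`. -/
def IsApproxCurve (γ T : ℝ) (f : Fin d → E → E) (W : ℝ → List (Fin d) → ℝ) (C : ℝ) (Y : ℝ → E) :
    Prop :=
  ∀ s t, 0 ≤ s → s ≤ t → t ≤ T →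
    ‖Y t - sumWords (level γ) (fun v => incr W s t v • Gam f v id (Y s))‖ ≤
      C * ((t - s) ^ γ) ^ level γ

namespace RoughData

lemma exists_step_sub_le (H : RoughData γ T f W A K) : ∃ C, 0 ≤ C ∧ ∀ s t, 0 ≤ s → s ≤ t → t ≤ T →
    ∀ x, ‖roughStep γ f W s t x - sumWords (level γ) (fun v => incr W s t v • Gam f v id x)‖ ≤
      C * ((t - s) ^ γ) ^ level γ := by
  have hc1 : 1 ≤ gamConst (level γ) A := one_le_gamConst H.A_nonneg
  have hK := H.K_nonneg
  have hN := one_le_level H.γ_pos H.γ_le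
  refine ⟨∑ v ∈ words d (level γ + 1) \ words d (level γ), K * gamConst (level γ) A,
    Finset.sum_nonneg fun _ _ => by positivity, fun s t hs hst ht x => ?_⟩
  have hsub : words d (level γ) ⊆ words d (level γ + 1) := fun w hw =>
    mem_words.2 (Nat.lt_succ_of_lt (mem_words.1 hw))
  rw [roughStep, stepMap, sumWords_eq_sum, sumWords_eq_sum, ← Finset.sum_sdiff_eq_sub hsub,
    Finset.sum_mul]
  refine norm_sum_le_of_le _ fun v hv => ?_
  simp only [Finset.mem_sdiff, mem_words, not_lt] at hv
  have hvl : v.length = level γ := by omega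
  have hv0 : v ≠ [] := by rintro rfl; simp at hvl; omega
  have h1 := (H.size_of_le hs le_rfl hst le_rfl ht).bound v hvl.le
  have h2 := (bddC_Gam_id (j := 0) H.A_nonneg H.bdd hv0 (by omega)).norm_le x
  have h0 : 0 ≤ (t - s) ^ γ := Real.rpow_nonneg (by linarith) _
  rw [norm_smul, Real.norm_eq_abs]
  rw [hvl] at h1
  calc _ ≤ K * ((t - s) ^ γ) ^ level γ * gamConst (level γ) A := by gcongr
    _ = _ := by ring

/-- Functions of approximate curves have the expected expansion. -/
lemma exists_expansion (H : RoughData γ T f W A K) {C : ℝ} {Y : ℝ → E} (hC : 0 ≤ C)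
    (hY : IsApproxCurve γ T f W C Y) : ∃ C', 0 ≤ C' ∧
    ∀ m, 1 ≤ m → m ≤ level γ → ∀ (φ : E → E) (M : ℝ), BddC m φ M →
    ∀ s t, 0 ≤ s → s ≤ t → t ≤ T →
      ‖φ (Y t) - sumWords m (fun w => incr W s t w • Gam f w φ (Y s))‖ ≤
        C' * M * ((t - s) ^ γ) ^ m := by
  obtain ⟨C₁, hC₁0, hC₁⟩ := H.exists_step_sub_le
  have ht := fun m (hm : m ≤ level γ + 1) =>
    taylor_sup H.A_nonneg H.bdd H.K_nonneg (one_le_scale (γ := γ) (T := T)) m hm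
  choose! C₂ hC₂0 hC₂ using ht
  have hB := one_le_scale (γ := γ) (T := T)
  refine ⟨(C + C₁) * scale γ T ^ level γ + ∑ m ∈ Finset.range (level γ + 1), C₂ m, ?_,
    fun m hm1 hm φ M hφ s t hs hst ht => ?_⟩
  · have : 0 ≤ ∑ m ∈ Finset.range (level γ + 1), C₂ m :=
      Finset.sum_nonneg fun m hm => hC₂0 m (by simp at hm; omega)
    positivity
  · have hM := hφ.nonneg
    have h0 : 0 ≤ (t - s) ^ γ := Real.rpow_nonneg (by linarith) _
    have h0B := H.rpow_le_scale hs hst ht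
    set τ := (t - s) ^ γ with hτ
    have h1 := hY s t hs hst ht
    have h2 := hC₁ s t hs hst ht (Y s)
    rw [norm_sub_rev] at h2
    -- The approximate curve is off the one-step map by τ^N only. This suffices for expansions of
    -- order m ≤ N, and the Lipschitz bound on φ is why m ≥ 1 is required.
    have h3 : ‖Y t - roughStep γ f W s t (Y s)‖ ≤ (C + C₁) * τ ^ level γ := by
      refine (norm_sub_le_norm_sub_add_norm_sub _ _ _).trans ((add_le_add h1 h2).trans ?_)
      rw [add_mul]
    obtain ⟨m', rfl⟩ := Nat.exists_eq_add_of_le' hm1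
    have h4 := hφ.norm_sub_le (Y t) (roughStep γ f W s t (Y s))
    have h5 := hC₂ (m' + 1) (by omega) E φ M hφ _ τ h0 h0B (H.size_of_le hs le_rfl hst le_rfl ht)
      (Y s)
    have h6 : τ ^ level γ ≤ scale γ T ^ level γ * τ ^ (m' + 1) :=
      pow_le_mul_pow h0 h0B hB hm le_rfl
    have h7 : C₂ (m' + 1) ≤ ∑ m ∈ Finset.range (level γ + 1), C₂ m :=
      Finset.single_le_sum (f := C₂) (fun m hm => hC₂0 m (by simp at hm; omega))
        (Finset.mem_range.2 (by omega))
    calc _ ≤ M * ((C + C₁) * (scale γ T ^ level γ * τ ^ (m' + 1))) +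
          (∑ m ∈ Finset.range (level γ + 1), C₂ m) * M * τ ^ (m' + 1) := by
          refine (norm_sub_le_norm_sub_add_norm_sub _ (φ (roughStep γ f W s t (Y s))) _).trans
            (add_le_add (h4.trans ?_) (h5.trans ?_))
          · exact mul_le_mul_of_nonneg_left (h3.trans (by gcongr)) hM
          · gcongr
      _ = _ := by ring

lemma incr_nil (H : RoughData γ T f W A K) {s t : ℝ} (hs : s ∈ Icc 0 T) (ht : t ∈ Icc 0 T) :
    incr W s t [] = 1 := (H.size s hs t ht).character.1

/-- The local approximations of rough integrals are almost additive. -/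
lemma exists_localIntegral_add (H : RoughData γ T f W A K) {C : ℝ} {Y : ℝ → E} (hC : 0 ≤ C)
    (hY : IsApproxCurve γ T f W C Y) : ∃ C', 0 ≤ C' ∧ ∀ i s u t, 0 ≤ s → s ≤ u → u ≤ t → t ≤ T →
      ‖localIntegral γ f W i Y s u + localIntegral γ f W i Y u t - localIntegral γ f W i Y s t‖ ≤
        C' * (t - s) ^ (((level γ + 1 : ℕ) : ℝ) * γ) := by
  obtain ⟨C₁, hC₁0, hC₁⟩ := H.exists_expansion hC hY
  have hc1 : 1 ≤ gamConst (level γ) A := one_le_gamConst H.A_nonneg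
  have hK := H.K_nonneg
  refine ⟨∑ v ∈ words d (level γ), K * (C₁ * gamConst (level γ) A),
    Finset.sum_nonneg fun _ _ => by positivity, fun i s u t hs hsu hut ht => ?_⟩
  have hst := hsu.trans hut
  have hu : u ∈ Icc 0 T := ⟨hs.trans hsu, hut.trans ht⟩
  have h0 : 0 ≤ (t - s) ^ γ := Real.rpow_nonneg (by linarith) _
  -- By Chen's relation with the last letter kept apart, the additivity defect is the sum over q of
  -- ⟨W_{ut}, e_{qi}⟩ times the error of expanding F_{qi}(Y_u) from s to order N-|q|. The orders
  -- |q|+1 and N-|q| add up to N+1.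
  have e1 : localIntegral γ f W i Y s t = localIntegral γ f W i Y s u +
      ∑ q ∈ words d (level γ), incr W u t (q ++ [i]) • sumWords (level γ - q.length) fun w =>
        incr W s u w • Gam f w (Gam f (q ++ [i]) id) (Y s) := by
    have e2 : localIntegral γ f W i Y s t = sumWords (level γ) (fun w =>
        conv (incr W s u) (fun v => incr W u t (v ++ [i])) w • Gam f (w ++ [i]) id (Y s) +
        incr W s u (w ++ [i]) • Gam f (w ++ [i]) id (Y s)) := by
      refine sumWords_congr fun w hw => ?_
      rw [← H.rough.chen hu (by simp; omega), conv_concat, H.incr_nil hu ⟨by linarith, ht⟩,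
        mul_one, add_smul]
    rw [e2, sumWords_add, sumWords_conv (G := fun w => Gam f (w ++ [i]) id (Y s)), sumPairs_comm,
      sumPairs, sumWords_eq_sum, add_comm]
    congr 1
    refine Finset.sum_congr rfl fun q _ => ?_
    simp only [sumWords_eq_sum, Finset.smul_sum, smul_smul, ← Gam_append, List.append_assoc]
    exact Finset.sum_congr rfl fun w _ => by rw [mul_comm]
  have e3 : localIntegral γ f W i Y u t = ∑ q ∈ words d (level γ),
      incr W u t (q ++ [i]) • Gam f (q ++ [i]) id (Y u) := by
    rw [localIntegral, sumWords_eq_sum]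
  rw [e1, e3, add_sub_add_left_eq_sub, ← Finset.sum_sub_distrib, Finset.sum_mul]
  refine norm_sum_le_of_le _ fun q hq => ?_
  rw [mem_words] at hq
  rw [← smul_sub, norm_smul, Real.norm_eq_abs, rpow_natCast_mul' (by linarith)]
  set τ := (t - s) ^ γ with hτ
  have h1 := (H.size_of_le hs hsu hut le_rfl ht).bound (q ++ [i]) (by simp; omega)
  have h2 := hC₁ (level γ - q.length) (by omega) (by omega) _ _
    (bddC_Gam_id H.A_nonneg H.bdd (w := q ++ [i]) (by simp) (by simp; omega)) s u hs hsu hu.2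
  have h3 : (u - s) ^ γ ≤ τ := Real.rpow_le_rpow (by linarith) (by linarith) H.γ_pos.le
  have h4 : 0 ≤ (u - s) ^ γ := Real.rpow_nonneg (by linarith) _
  have hql : (q ++ [i]).length = q.length + 1 := by simp
  rw [hql] at h1
  calc _ ≤ (K * τ ^ (q.length + 1)) *
        (C₁ * gamConst (level γ) A * ((u - s) ^ γ) ^ (level γ - q.length)) := by
        refine mul_le_mul h1 h2 (norm_nonneg _) (by positivity)
    _ ≤ (K * τ ^ (q.length + 1)) *
        (C₁ * gamConst (level γ) A * τ ^ (level γ - q.length)) := by gcongr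
    _ = K * (C₁ * gamConst (level γ) A) * τ ^ (q.length + 1 + (level γ - q.length)) := by
        rw [pow_add]; ring
    _ = _ := by congr 2; omega

lemma exists_norm_localIntegral_le (H : RoughData γ T f W A K) : ∃ C, 0 ≤ C ∧ ∀ i (Y : ℝ → E) s t,
    0 ≤ s → s ≤ t → t ≤ T → ‖localIntegral γ f W i Y s t‖ ≤ C * (t - s) ^ γ := by
  have hc1 : 1 ≤ gamConst (level γ) A := one_le_gamConst H.A_nonneg
  have hK := H.K_nonneg
  have hB := one_le_scale (γ := γ) (T := T)
  refine ⟨∑ v ∈ words d (level γ), K * scale γ T ^ level γ * gamConst (level γ) A,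
    Finset.sum_nonneg fun _ _ => by positivity, fun i Y s t hs hst ht => ?_⟩
  have h0 : 0 ≤ (t - s) ^ γ := Real.rpow_nonneg (by linarith) _
  have h0B := H.rpow_le_scale hs hst ht
  rw [localIntegral, sumWords_eq_sum, Finset.sum_mul]
  refine norm_sum_le_of_le _ fun w hw => ?_
  rw [mem_words] at hw
  have hl : (w ++ [i]).length = w.length + 1 := by simp
  have h1 := (H.size_of_le hs le_rfl hst le_rfl ht).bound (w ++ [i]) (by omega)
  have h2 := (bddC_Gam_id (j := 0) (w := w ++ [i]) H.A_nonneg H.bdd (by simp)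
    (by omega)).norm_le (Y s)
  have h3 : ((t - s) ^ γ) ^ (w ++ [i]).length ≤ scale γ T ^ level γ * ((t - s) ^ γ) ^ 1 :=
    pow_le_mul_pow h0 h0B hB (by omega) (by omega)
  rw [norm_smul, Real.norm_eq_abs]
  calc _ ≤ (K * (scale γ T ^ level γ * ((t - s) ^ γ) ^ 1)) * gamConst (level γ) A := by
        refine mul_le_mul (h1.trans ?_) h2 (norm_nonneg _) (by positivity)
        gcongr
    _ = _ := by ring

/-- The sewing lemma for the rough integrals along an approximate curve. -/
lemma exists_integral [CompleteSpace E] (H : RoughData γ T f W A K) {C : ℝ} {Y : ℝ → E}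
    (hC : 0 ≤ C) (hY : IsApproxCurve γ T f W C Y) (i : Fin d) :
    ∃ (I : ℝ → E) (C' : ℝ), 0 ≤ C' ∧ I 0 = 0 ∧ ∀ s t, 0 ≤ s → s ≤ t → t ≤ T →
      ‖I t - I s - localIntegral γ f W i Y s t‖ ≤ C' * (t - s) ^ (((level γ + 1 : ℕ) : ℝ) * γ) := by
  obtain ⟨C₁, hC₁0, hC₁⟩ := H.exists_localIntegral_add hC hY
  obtain ⟨C₂, hC₂0, hC₂⟩ := H.exists_norm_localIntegral_le
  -- Additive sewing is the case of translations: the local integrals define an almost flow of maps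
  -- x ↦ x + c, and its integral curve from 0 is the integral.
  have hflow : IsAlmostFlow (0 + 1) T γ (((level γ + 1 : ℕ) : ℝ) * γ) (C₁ + C₂)
      fun s t x => x + localIntegral γ f W i Y s t := by
    refine ⟨H.γ_pos, one_lt_level_succ_mul H.γ_pos, fun s t hs hst ht => ?_,
      fun s u t hs hsu hut ht => ?_⟩
    · simp only [add_sub_cancel_left]
      refine (BddC.const _).mono ((hC₂ i Y s t hs hst ht).trans ?_)
      have : 0 ≤ (t - s) ^ γ := Real.rpow_nonneg (by linarith) _
      gcongr
      linarith
    · have e : ∀ x : E, x + localIntegral γ f W i Y s u + localIntegral γ f W i Y u t -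
          (x + localIntegral γ f W i Y s t) = localIntegral γ f W i Y s u +
          localIntegral γ f W i Y u t - localIntegral γ f W i Y s t := fun x => by abel
      simp only [e]
      refine (BddC.const _).mono ((hC₁ i s u t hs hsu hut ht).trans ?_)
      have : 0 ≤ (t - s) ^ (((level γ + 1 : ℕ) : ℝ) * γ) := Real.rpow_nonneg (by linarith) _
      gcongr
      linarith
  obtain ⟨X, C', hC', hX0, hX, -⟩ := hflow.exists_flow (by positivity) H.T_pos
  refine ⟨X 0, C', hC', hX0 0, fun s t hs hst ht => ?_⟩
  rw [sub_sub]
  exact hX 0 s t hs hst ht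

lemma composeLift_eq (H : RoughData γ T f W A K) {Y : ℝ → E} {XX : ℝ → List (Fin d) → E} {t : ℝ}
    {w : List (Fin d)} (i : Fin d) (hw : w.length < level γ)
    (hXX : ∀ v : List (Fin d), v.length ≤ w.length → XX t v = Gam f v id (Y t)) :
    composeLift (f i) XX t w = Gam f (w ++ [i]) id (Y t) := by
  rw [Gam_concat_id]
  exact composeLift_Gam (contDiff_of_bddC H.bdd (by omega) i)
    (contDiff_of_bddC H.bdd (by omega)) hXX

/-- The sewn integral is the limit of compensated Riemann sums. -/
lemma hasRoughIntegral (H : RoughData γ T f W A K) {Y I : ℝ → E} {C : ℝ} {i : Fin d}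
    {XX : ℝ → List (Fin d) → E} (hC : 0 ≤ C) (hI0 : I 0 = 0)
    (hI : ∀ s t, 0 ≤ s → s ≤ t → t ≤ T →
      ‖I t - I s - localIntegral γ f W i Y s t‖ ≤ C * (t - s) ^ (((level γ + 1 : ℕ) : ℝ) * γ))
    (hXX : ∀ t ∈ Icc 0 T, ∀ w : List (Fin d), w.length < level γ → XX t w = Gam f w id (Y t))
    {t : ℝ} (ht : t ∈ Icc 0 T) :
    HasRoughIntegral (level γ) W i (composeLift (f i) XX) t (I t) := by
  intro ε hε
  have ha := one_lt_level_succ_mul H.γ_pos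
  set a := ((level γ + 1 : ℕ) : ℝ) * γ with hadef
  have hlim : Filter.Tendsto (fun δ : ℝ => C * (δ ^ (a - 1) * T)) (nhds 0) (nhds 0) := by
    have h1 := ((Real.continuous_rpow_const (q := a - 1) (by linarith)).mul_const T).const_mul C
    exact h1.tendsto' 0 0 (by rw [Real.zero_rpow (by linarith)]; simp)
  obtain ⟨δ, hδ, hδ0⟩ := (((hlim.eventually_lt_const hε).filter_mono nhdsWithin_le_nhds).and
    (self_mem_nhdsWithin (s := Ioi (0 : ℝ)))).exists
  refine ⟨δ, hδ0, fun k p hp hp0 hpk hfine => ?_⟩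
  -- Beyond index k the given partition is uncontrolled, so it is frozen at its endpoint t.
  let q : ℕ → ℝ := fun j => p (min j k)
  have hq : IsPartition T q := by
    refine ⟨fun i j hij => hp (min_le_min_right _ hij), fun j => ?_, fun j => ?_⟩
    · rw [← hp0]; exact hp (Nat.zero_le _)
    · exact (hp (min_le_right _ _)).trans (hpk.le.trans ht.2)
  have hqf : IsFine δ q := by
    intro j
    by_cases hj : j < k
    · simp only [q, min_eq_left hj.le, min_eq_left (Nat.succ_le_of_lt hj)]
      exact (hfine j hj).le
    · simp only [q, min_eq_right (not_lt.1 hj), min_eq_right ((not_lt.1 hj).trans (Nat.le_succ j)),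
        sub_self]
      exact le_of_lt hδ0
  have e1 : ∑ j ∈ Finset.range k, sumWords (level γ) (fun w => incr W (p j) (p (j + 1)) (w ++ [i]) •
      composeLift (f i) XX (p j) w) = ∑ j ∈ Finset.range k,
        localIntegral γ f W i Y (q j) (q (j + 1)) := by
    refine Finset.sum_congr rfl fun j hj => sumWords_congr fun w hw => ?_
    have hj : j < k := Finset.mem_range.1 hj
    have hqj : q j = p j := by simp only [q, min_eq_left hj.le]
    have hqj' : q (j + 1) = p (j + 1) := by simp only [q, min_eq_left (Nat.succ_le_of_lt hj)]
    rw [← hqj, ← hqj', H.composeLift_eq i hw fun v hv => hXX _ ⟨hq.nonneg j, hq.le j⟩ v (by omega)]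
  have e2 : I t = ∑ j ∈ Finset.range k, (I (q (j + 1)) - I (q j)) := by
    rw [Finset.sum_range_sub fun j => I (q j)]
    simp [q, hpk, hp0, hI0]
  rw [e1, e2, ← Finset.sum_sub_distrib]
  have h1 : ‖∑ j ∈ Finset.range k,
      (localIntegral γ f W i Y (q j) (q (j + 1)) - (I (q (j + 1)) - I (q j)))‖ ≤
      ∑ j ∈ Finset.range k, C * (q (j + 1) - q j) ^ a := by
    refine norm_sum_le_of_le _ fun j _ => ?_
    rw [norm_sub_rev]
    exact hI _ _ (hq.nonneg j) (hq.mono (Nat.le_succ j)) (hq.le _)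
  rw [← Finset.mul_sum] at h1
  refine lt_of_le_of_lt (h1.trans ?_) hδ
  have := sum_rpow_le ha hq hqf k
  gcongr

end RoughData

lemma HasRoughIntegral.unique {N : ℕ} {i : Fin d} {Y : ℝ → List (Fin d) → E} {t : ℝ} {I J : E}
    (ht : 0 ≤ t) (hI : HasRoughIntegral N W i Y t I) (hJ : HasRoughIntegral N W i Y t J) :
    I = J := by
  refine eq_of_forall_dist_le fun ε hε => ?_
  obtain ⟨δ, hδ, h1⟩ := hI (ε / 2) (half_pos hε)
  obtain ⟨δ', hδ', h2⟩ := hJ (ε / 2) (half_pos hε)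
  obtain ⟨n, hn, hn'⟩ := (((tendsto_mesh t).eventually_lt_const hδ).and
    ((tendsto_mesh t).eventually_lt_const hδ')).exists
  have hp := isPartition_dyadic (n := n) (T := t) (t := t) ⟨ht, le_rfl⟩
  have hf := isFine_dyadic (T := t) (n := n) (t := t) ht
  have h3 := h1 (2 ^ n) _ hp.mono (dyadic_zero ht) (dyadic_last le_rfl)
    fun j _ => (hf j).trans_lt hn
  have h4 := h2 (2 ^ n) _ hp.mono (dyadic_zero ht) (dyadic_last le_rfl)
    fun j _ => (hf j).trans_lt hn'
  rw [dist_eq_norm]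
  rw [norm_sub_rev] at h3
  exact (norm_sub_le_norm_sub_add_norm_sub _ _ _).trans (by linarith)

/-- Paths with increments of order `a > 1` are constant. -/
lemma eq_of_norm_sub_le {a C : ℝ} (ha : 1 < a) (hC : 0 ≤ C) {V : ℝ → E}
    (hV : ∀ s t, 0 ≤ s → s ≤ t → t ≤ T → ‖V t - V s‖ ≤ C * (t - s) ^ a) {t : ℝ}
    (ht : t ∈ Icc 0 T) : V t = V 0 := by
  -- Identity maps form an almost flow without error; V and the constant path are both integral
  -- curves of it.
  have hΨ : IsAlmostFlow (0 + 1) T 1 a 0 (fun (_ _ : ℝ) (x : E) => x) := by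
    refine ⟨one_pos, ha, fun s t _ _ _ => ?_, fun s u t _ _ _ _ => ?_⟩ <;>
    · simp only [sub_self, zero_mul]
      exact (BddC.const (0 : E)).mono (by simp)
  obtain ⟨δ, K, M, hB⟩ := hΨ.exists_discreteBounds le_rfl
  refine hB.curve_unique ha (Y := V) (Y' := fun _ => V 0) (C' := 0) hV hC
    (fun s t _ _ _ => by simp) le_rfl rfl ht

namespace RoughData

lemma roughStep_eq (H : RoughData γ T f W A K) {s t : ℝ} (hs : s ∈ Icc 0 T) (ht : t ∈ Icc 0 T)
    (Y : ℝ → E) : roughStep γ f W s t (Y s) = Y s + ∑ i, localIntegral γ f W i Y s t := by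
  rw [roughStep, stepMap, sumWords_succ_concat, H.incr_nil hs ht]
  simp [localIntegral, Gam]

lemma isApproxCurve (H : RoughData γ T f W A K) {C : ℝ} {Y : ℝ → E} (hC : 0 ≤ C)
    (hY : IsIntegralCurve T (((level γ + 1 : ℕ) : ℝ) * γ) C (roughStep γ f W) Y) :
    ∃ C', 0 ≤ C' ∧ IsApproxCurve γ T f W C' Y := by
  obtain ⟨C₁, hC₁0, hC₁⟩ := H.exists_step_sub_le
  have hB := one_le_scale (γ := γ) (T := T)
  refine ⟨C * scale γ T ^ (level γ + 1) + C₁, by positivity, fun s t hs hst ht => ?_⟩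
  have h0 : 0 ≤ (t - s) ^ γ := Real.rpow_nonneg (by linarith) _
  have h1 := hY s t hs hst ht
  rw [rpow_natCast_mul' (by linarith)] at h1
  have h2 : ((t - s) ^ γ) ^ (level γ + 1) ≤ scale γ T ^ (level γ + 1) * ((t - s) ^ γ) ^ level γ :=
    pow_le_mul_pow h0 (H.rpow_le_scale hs hst ht) hB (Nat.le_succ _) le_rfl
  refine (norm_sub_le_norm_sub_add_norm_sub _ (roughStep γ f W s t (Y s)) _).trans
    ((add_le_add h1 (hC₁ s t hs hst ht (Y s))).trans ?_)
  calc _ ≤ C * (scale γ T ^ (level γ + 1) * ((t - s) ^ γ) ^ level γ) +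
        C₁ * ((t - s) ^ γ) ^ level γ := by gcongr
    _ = _ := by ring

lemma lipschitz_Gam_id (H : RoughData γ T f W A K) {w : List (Fin d)} (hw : w.length ≤ level γ)
    (x y : E) : ‖Gam f w id x - Gam f w id y‖ ≤ gamConst (level γ) A * ‖x - y‖ :=
  Convex.norm_image_sub_le_of_norm_fderiv_le
    (fun z _ => differentiable_Gam_id H.bdd (by omega) z)
    (fun z _ => (bddC_fderiv_Gam_id (j := 0) H.A_nonneg H.bdd (by omega)).norm_le z)
    convex_univ (mem_univ y) (mem_univ x)

lemma exists_holder (H : RoughData γ T f W A K) {C : ℝ} {Y : ℝ → E} (hC : 0 ≤ C)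
    (hY : IsIntegralCurve T (((level γ + 1 : ℕ) : ℝ) * γ) C (roughStep γ f W) Y) :
    ∃ C', 0 ≤ C' ∧ ∀ s t, 0 ≤ s → s ≤ t → t ≤ T → ‖Y t - Y s‖ ≤ C' * (t - s) ^ γ := by
  obtain ⟨D, hD, hΨ⟩ := H.exists_isAlmostFlow
  have hB := one_le_scale (γ := γ) (T := T)
  refine ⟨C * scale γ T ^ (level γ + 1) + D, by positivity, fun s t hs hst ht => ?_⟩
  have h0 : 0 ≤ (t - s) ^ γ := Real.rpow_nonneg (by linarith) _
  have h1 := hY s t hs hst ht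
  rw [rpow_natCast_mul' (by linarith)] at h1
  have h2 : ((t - s) ^ γ) ^ (level γ + 1) ≤ scale γ T ^ (level γ + 1) * ((t - s) ^ γ) ^ 1 :=
    pow_le_mul_pow h0 (H.rpow_le_scale hs hst ht) hB (by omega) le_rfl
  refine (norm_sub_le_norm_sub_add_norm_sub _ (roughStep γ f W s t (Y s)) _).trans
    ((add_le_add h1 ((hΨ.near_id s t hs hst ht).norm_le (Y s))).trans ?_)
  calc _ ≤ C * (scale γ T ^ (level γ + 1) * ((t - s) ^ γ) ^ 1) + D * (t - s) ^ γ := by gcongr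
    _ = _ := by ring

/-- The lift of an integral curve is controlled. -/
lemma isControlled (H : RoughData γ T f W A K) {C : ℝ} {Y : ℝ → E} (hC : 0 ≤ C)
    (hY : IsIntegralCurve T (((level γ + 1 : ℕ) : ℝ) * γ) C (roughStep γ f W) Y) :
    IsControlled (level γ) γ T W fun t w => Gam f w id (Y t) := by
  obtain ⟨C₁, hC₁0, hC₁⟩ := H.exists_holder hC hY
  obtain ⟨C₂, hC₂0, hC₂⟩ := H.isApproxCurve hC hY
  obtain ⟨C₃, hC₃0, hC₃⟩ := H.exists_expansion hC₂0 hC₂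
  have hc1 : 1 ≤ gamConst (level γ) A := one_le_gamConst H.A_nonneg
  intro w hw
  constructor
  · refine ⟨gamConst (level γ) A * C₁, ?_⟩
    have key : ∀ s t, 0 ≤ s → s ≤ t → t ≤ T → ‖Gam f w id (Y t) - Gam f w id (Y s)‖ ≤
        gamConst (level γ) A * C₁ * (t - s) ^ γ := by
      intro s t hs hst ht
      refine (H.lipschitz_Gam_id hw.le _ _).trans ?_
      rw [mul_assoc]
      have := hC₁ s t hs hst ht
      gcongr
    intro s hs t ht
    rcases le_total s t with h | h
    · rw [abs_of_nonneg (by linarith)]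
      exact key s t hs.1 h ht.2
    · rw [abs_of_nonpos (by linarith), neg_sub, norm_sub_rev]
      exact key t s ht.1 h hs.2
  -- The identity is unbounded, so the general expansion does not cover the empty word; there the
  -- claim is the approximate-curve property itself.
  · rcases eq_or_ne w [] with rfl | hw0
    · refine ⟨C₂, fun s hs t ht hst => ?_⟩
      rw [rpow_natCast_mul' (by linarith)]
      simpa [Gam] using hC₂ s t hs.1 hst.le ht.2
    · refine ⟨C₃ * gamConst (level γ) A, fun s hs t ht hst => ?_⟩
      rw [rpow_natCast_mul' (by linarith)]
      simp only [Gam_append]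
      exact hC₃ (level γ - w.length) (by omega) (by omega) _ _
        (bddC_Gam_id H.A_nonneg H.bdd hw0 (by omega)) s t hs.1 hst.le ht.2

/-- Integral curves of the approximate flow solve the rough differential equation. -/
lemma isRDESolution [CompleteSpace E] (H : RoughData γ T f W A K) {C : ℝ} {Y : ℝ → E} (hC : 0 ≤ C)
    (hY : IsIntegralCurve T (((level γ + 1 : ℕ) : ℝ) * γ) C (roughStep γ f W) Y) :
    IsRDESolution γ T f W (Y 0) Y := by
  obtain ⟨C₂, hC₂0, hC₂⟩ := H.isApproxCurve hC hY
  choose I CI hCI0 hI0 hI using fun i => H.exists_integral hC₂0 hC₂ i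
  let XX : ℝ → List (Fin d) → E := fun t w => Gam f w id (Y t)
  let Z : Fin d → ℝ → List (Fin d) → E := fun i t w =>
    if w = [] then I i t else if w.getLast? = some i then composeLift (f i) XX t w.dropLast else 0
  have hZ : ∀ i t w j, Z i t (w ++ [j]) = if j = i then composeLift (f i) XX t w else 0 := by
    intro i t w j
    simp [Z]
  refine ⟨XX, Z, H.isControlled hC hY, fun t _ => rfl, fun w _ => rfl, fun i t ht => ⟨?_, ?_⟩, ?_⟩
  · have : Z i t [] = I i t := by simp [Z]
    rw [this]
    exact H.hasRoughIntegral (hCI0 i) (hI0 i) (hI i) (fun t _ w _ => rfl) ht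
  · intro w j _
    exact hZ i t w j
  -- The increments of Y - ∑ I_i combine the defect of Y from the one-step map with the sewing
  -- errors, both of order (N+1)γ > 1. Hence the difference is constant, which is the equation for
  -- the empty word.
  · have hV : ∀ t ∈ Icc 0 T, Y t - ∑ i, I i t = Y 0 - ∑ i, I i 0 := by
      intro t ht
      refine eq_of_norm_sub_le (V := fun t => Y t - ∑ i, I i t) (C := C + ∑ i, CI i)
        (one_lt_level_succ_mul H.γ_pos) (add_nonneg hC (Finset.sum_nonneg fun i _ => hCI0 i))
        (fun s t hs hst ht => ?_) ht
      have e : Y t - ∑ i, I i t - (Y s - ∑ i, I i s) = (Y t - roughStep γ f W s t (Y s)) -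
          ∑ i, (I i t - I i s - localIntegral γ f W i Y s t) := by
        rw [H.roughStep_eq ⟨hs, hst.trans ht⟩ ⟨hs.trans hst, ht⟩ Y]
        simp only [Finset.sum_sub_distrib]
        abel
      rw [e, add_mul, Finset.sum_mul]
      exact (norm_sub_le _ _).trans (add_le_add (hY s t hs hst ht)
        (norm_sum_le_of_le _ fun i _ => hI i s t hs hst ht))
    intro s hs t ht w hw
    rcases List.eq_nil_or_concat' w with rfl | ⟨v, j, rfl⟩
    · have h1 := hV t ht
      rw [← hV s hs] at h1
      have h2 : ∀ i, Z i t [] - Z i s [] = I i t - I i s := fun i => by simp [Z]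
      simp only [h2, Finset.sum_sub_distrib, XX, Gam, id]
      rw [sub_eq_sub_iff_add_eq_add] at h1 ⊢
      rw [h1, add_comm]
    · have hv : v.length < level γ := by simp at hw; omega
      simp only [hZ]
      rw [Finset.sum_eq_single j (fun i _ hi => by simp [hi.symm]) (by simp)]
      simp only [if_true]
      rw [H.composeLift_eq (Y := Y) j hv fun u _ => rfl, H.composeLift_eq (Y := Y) j hv fun u _ => rfl]

/-- Solutions of the rough differential equation are integral curves. -/
lemma isIntegralCurve_of_isRDESolution [CompleteSpace E] (H : RoughData γ T f W A K) {x : E}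
    {Y : ℝ → E} (hY : IsRDESolution γ T f W x Y) : Y 0 = x ∧ ∃ C, 0 ≤ C ∧
    IsIntegralCurve T (((level γ + 1 : ℕ) : ℝ) * γ) C (roughStep γ f W) Y := by
  obtain ⟨XX, Z, hctrl, hXX, hinit, hint, heq⟩ := hY
  have hN := one_le_level H.γ_pos H.γ_le
  have h00 : (0 : ℝ) ∈ Icc 0 T := ⟨le_rfl, H.T_pos.le⟩
  have hY0 : Y 0 = x := by
    rw [← hXX 0 h00, hinit [] (by simp; omega)]
    rfl
  -- The increment of the coefficient on vj is the increment of the coefficient of f_j(XX) on v. The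
  -- latter involves only words of length at most |v|, already known, and equals F_{vj}(Y). The
  -- prescribed initial coefficients fix the constant.
  have hF : ∀ n (w : List (Fin d)), w.length = n → w.length < level γ → ∀ t ∈ Icc 0 T,
      XX t w = Gam f w id (Y t) := by
    intro n
    induction n using Nat.strong_induction_on with
    | _ n ih =>
      intro w hwn hw t ht
      rcases List.eq_nil_or_concat' w with rfl | ⟨v, j, rfl⟩
      · exact hXX t ht
      · have hvl : (v ++ [j]).length = v.length + 1 := by simp
        have hv : v.length < level γ := by omega
        have h1 := heq 0 h00 t ht (v ++ [j]) hw
        have h2 : ∀ s ∈ Icc 0 T, ∀ i, Z i s (v ++ [j]) = if j = i then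
            Gam f (v ++ [i]) id (Y s) else 0 := by
          intro s hs i
          rw [(hint i s hs).2 v j hv, H.composeLift_eq (Y := Y) i hv fun u hu =>
            ih u.length (by omega) u rfl (by omega) s hs]
        simp only [h2 0 h00, h2 t ht] at h1
        rw [Finset.sum_eq_single j (fun i _ hi => by simp [hi.symm]) (by simp), hinit _ hw, hY0] at h1
        simpa using h1
  refine ⟨hY0, ?_⟩
  obtain ⟨C₁, hC₁⟩ := (hctrl [] (by simp; omega)).2
  -- With the coefficients identified, controlledness on the empty word is the approximate-curve
  -- bound. It is stated for s < t only, so s = t is treated apart.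
  have happrox : IsApproxCurve γ T f W |C₁| Y := by
    intro s t hs hst ht
    have hs' : s ∈ Icc 0 T := ⟨hs, hst.trans ht⟩
    have ht' : t ∈ Icc 0 T := ⟨hs.trans hst, ht⟩
    rcases hst.eq_or_lt with rfl | hlt
    · have : sumWords (level γ) (fun v => incr W s s v • Gam f v id (Y s)) = Y s := by
        obtain ⟨m, hm⟩ := Nat.exists_eq_add_of_le' hN
        rw [hm, sumWords_succ, H.incr_nil hs' hs']
        have : ∀ a, sumWords m (fun w => incr W s s (a :: w) • Gam f (a :: w) id (Y s)) = 0 := by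
          intro a
          refine sumWords_eq_zero fun w hw => ?_
          rw [H.rough.incr_self H.γ_pos hs' (by simp; omega)]
          simp [convUnit]
        rw [Finset.sum_eq_zero fun a _ => this a]
        simp [Gam]
      rw [this, sub_self, norm_zero]
      positivity
    · have h1 := hC₁ s hs' t ht' hlt
      rw [rpow_natCast_mul' (by linarith)] at h1
      simp only [List.length_nil, Nat.sub_zero, List.append_nil, hXX t ht'] at h1
      have h2 : sumWords (level γ) (fun v => incr W s t v • XX s v) =
          sumWords (level γ) (fun v => incr W s t v • Gam f v id (Y s)) :=
        sumWords_congr fun v hv => by rw [hF _ v rfl hv s hs']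
      rw [h2] at h1
      refine h1.trans ?_
      have : 0 ≤ (t - s) ^ γ := Real.rpow_nonneg (by linarith) _
      gcongr
      exact le_abs_self _
  choose I CI hCI0 hI0 hI using fun i => H.exists_integral (abs_nonneg C₁) happrox i
  -- Limits of Riemann sums are unique, so the given integrals are the sewn ones and inherit their
  -- local error bound.
  have hZ : ∀ i, ∀ t ∈ Icc 0 T, Z i t [] = I i t := fun i t ht =>
    (hint i t ht).1.unique ht.1
      (H.hasRoughIntegral (hCI0 i) (hI0 i) (hI i) (fun t ht w hw => hF _ w rfl hw t ht) ht)
  refine ⟨∑ i, CI i, Finset.sum_nonneg fun i _ => hCI0 i, fun s t hs hst ht => ?_⟩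
  have hs' : s ∈ Icc 0 T := ⟨hs, hst.trans ht⟩
  have ht' : t ∈ Icc 0 T := ⟨hs.trans hst, ht⟩
  have h1 := heq s hs' t ht' [] (by simp; omega)
  simp only [hXX s hs', hXX t ht', hZ _ s hs', hZ _ t ht'] at h1
  have e : Y t - roughStep γ f W s t (Y s) =
      ∑ i, (I i t - I i s - localIntegral γ f W i Y s t) := by
    rw [H.roughStep_eq hs' ht' Y, Finset.sum_sub_distrib, ← h1]
    abel
  rw [e, Finset.sum_mul]
  exact norm_sum_le_of_le _ fun i _ => hI i s t hs hst ht

end RoughData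
end RDE

end RoughContinuity

namespace RoughContinuity

/-! ### Smooth test functions determine finite measures -/

section TestFunctions

variable {E : Type} [NormedAddCommGroup E]

section Normed

variable [NormedSpace ℝ E]

/-- Real and imaginary parts of characters of E are admissible test functions, so equality of
integrals gives equality of characteristic functions. The two bounds are proved jointly because
differentiation exchanges sine and cosine. -/
lemma bddC_cos_sin (L : E →L[ℝ] ℝ) (k : ℕ) :
    BddC k (fun x => Real.cos (L x)) ((1 + ‖L‖) ^ k) ∧
      BddC k (fun x => Real.sin (L x)) ((1 + ‖L‖) ^ k) := by
  have h1 : ∀ k : ℕ, 1 ≤ (1 + ‖L‖) ^ k := fun k => one_le_pow₀ (by simp)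
  induction k with
  | zero =>
    refine ⟨BddC.zero_iff.2 ⟨by fun_prop, fun x => ?_⟩, BddC.zero_iff.2 ⟨by fun_prop, fun x => ?_⟩⟩
    · simpa using Real.abs_cos_le_one _
    · simpa using Real.abs_sin_le_one _
  | succ k ih =>
    have hS : ‖ContinuousLinearMap.toSpanSingleton ℝ L‖ * (1 + ‖L‖) ^ k ≤ (1 + ‖L‖) ^ (k + 1) := by
      rw [ContinuousLinearMap.norm_toSpanSingleton, pow_succ']
      gcongr
      simp
    have hc : ∀ x, HasFDerivAt (fun x => Real.cos (L x)) (-Real.sin (L x) • L) x := fun x =>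
      (L.hasFDerivAt (x := x)).cos
    have hs : ∀ x, HasFDerivAt (fun x => Real.sin (L x)) (Real.cos (L x) • L) x := fun x =>
      (L.hasFDerivAt (x := x)).sin
    refine ⟨BddC.succ_iff.2 ⟨fun x => (hc x).differentiableAt, fun x => ?_, ?_⟩,
      BddC.succ_iff.2 ⟨fun x => (hs x).differentiableAt, fun x => ?_, ?_⟩⟩
    · exact (Real.abs_cos_le_one _).trans (h1 _)
    · rw [show fderiv ℝ (fun x => Real.cos (L x)) = fun x =>
        ContinuousLinearMap.toSpanSingleton ℝ L (-Real.sin (L x)) from funext fun x => (hc x).fderiv]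
      exact (BddC.clm_left _ ih.2.neg).mono hS
    · exact (Real.abs_sin_le_one _).trans (h1 _)
    · rw [show fderiv ℝ (fun x => Real.sin (L x)) = fun x =>
        ContinuousLinearMap.toSpanSingleton ℝ L (Real.cos (L x)) from funext fun x => (hs x).fderiv]
      exact (BddC.clm_left _ ih.1).mono hS

lemma BddC.integrable [MeasurableSpace E] [BorelSpace E] {k : ℕ} {φ : E → ℝ} {M : ℝ} (hφ : BddC k φ M) (μ : Measure E)
    [IsFiniteMeasure μ] : Integrable φ μ :=
  Integrable.of_bound hφ.continuous.aestronglyMeasurable M (ae_of_all _ hφ.norm_le)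

end Normed

/-- Finite measures are determined by their integrals over test functions of class `C_b^k`. -/
lemma ext_of_forall_bddC [InnerProductSpace ℝ E] [MeasurableSpace E] [BorelSpace E] [CompleteSpace E] [SecondCountableTopology E] {μ ν : Measure E}
    [IsFiniteMeasure μ] [IsFiniteMeasure ν] (k : ℕ)
    (h : ∀ (φ : E → ℝ) (M : ℝ), BddC k φ M → ∫ x, φ x ∂μ = ∫ x, φ x ∂ν) : μ = ν := by
  refine Measure.ext_of_charFun (funext fun t => ?_)
  obtain ⟨hc, hs⟩ := bddC_cos_sin (innerSL ℝ t) k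
  have key : ∀ (κ : Measure E) [IsFiniteMeasure κ], charFun κ t =
      ((∫ x, Real.cos (innerSL ℝ t x) ∂κ : ℝ) : ℂ) +
        ((∫ x, Real.sin (innerSL ℝ t x) ∂κ : ℝ) : ℂ) * Complex.I := by
    intro κ _
    rw [charFun_apply, ← integral_complex_ofReal, ← integral_complex_ofReal, ← integral_mul_const,
      ← integral_add (hc.integrable κ).ofReal ((hs.integrable κ).ofReal.mul_const _)]
    refine integral_congr_ae (ae_of_all _ fun x => ?_)
    simp only [innerSL_apply_apply, real_inner_comm x t]
    rw [Complex.exp_mul_I]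
    push_cast
    rfl
  rw [key, key, h _ _ hc, h _ _ hs]

end TestFunctions

/-! ### Weak solutions of the continuity equation -/

section WeakSolutions

variable {E : Type} [NormedAddCommGroup E] [NormedSpace ℝ E]
  {d : ℕ} {f : Fin d → E → E} {A γ T K : ℝ} {W : ℝ → List (Fin d) → ℝ}

lemma abs_integral_sub_le {Ω : Type} [MeasurableSpace Ω] {μ : Measure Ω} [IsFiniteMeasure μ]
    {u v : Ω → ℝ} {c : ℝ} (hu : Integrable u μ) (hv : Integrable v μ) (h : ∀ x, |u x - v x| ≤ c) :
    |∫ x, u x ∂μ - ∫ x, v x ∂μ| ≤ c * μ.real univ := by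
  rw [← integral_sub hu hv]
  exact norm_integral_le_of_norm_le_const (f := fun x => u x - v x) (ae_of_all _ h)

lemma integral_sumWords {Ω : Type} [MeasurableSpace Ω] {μ : Measure Ω} {m : ℕ}
    {g : List (Fin d) → ℝ} {G : List (Fin d) → Ω → ℝ}
    (hG : ∀ w : List (Fin d), w.length < m → Integrable (G w) μ) :
    Integrable (fun x => sumWords m fun w => g w • G w x) μ ∧
      ∫ x, sumWords m (fun w => g w • G w x) ∂μ = sumWords m fun w => (∫ x, G w x ∂μ) * g w := by
  simp only [sumWords_eq_sum]
  have h : ∀ w ∈ words d m, Integrable (fun x => g w • G w x) μ := fun w hw =>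
    (hG w (mem_words.1 hw)).const_mul (g w)
  refine ⟨integrable_finsetSum _ h, ?_⟩
  rw [integral_finsetSum _ h]
  exact Finset.sum_congr rfl fun w _ => by rw [integral_smul, smul_eq_mul, mul_comm]

lemma Gam_const {w : List (Fin d)} (hw : w ≠ []) (c : ℝ) :
    Gam f w (fun _ => c) = fun _ => 0 := by
  induction w with
  | nil => exact absurd rfl hw
  | cons i w ih =>
    funext x
    rcases eq_or_ne w [] with rfl | h
    · simp [Gam]
    · simp [Gam, ih h]

namespace RoughData

/-- Expansion of test functions along integral curves. -/
lemma exists_expansion_curve (H : RoughData γ T f W A K) {X : E → ℝ → E} {C₀ : ℝ} (hC₀ : 0 ≤ C₀)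
    (hX : ∀ x, IsIntegralCurve T (((level γ + 1 : ℕ) : ℝ) * γ) C₀ (roughStep γ f W) (X x))
    {M : ℝ} (hM : 0 ≤ M) : ∃ C, 0 ≤ C ∧ ∀ φ : E → ℝ, BddC (level γ + 1) φ M →
      ∀ w : List (Fin d), w.length ≤ level γ → ∀ s t, 0 ≤ s → s ≤ t → t ≤ T → ∀ x,
      |Gam f w φ (X x t) - sumWords (level γ + 1 - w.length)
        (fun v => incr W s t v • Gam f (v ++ w) φ (X x s))| ≤
      C * (t - s) ^ (((level γ + 1 - w.length : ℕ) : ℝ) * γ) := by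
  set N := level γ with hN
  have hB := one_le_scale (γ := γ) (T := T)
  choose! Ct hCt0 hCt using fun m (hm : m ≤ N + 1) =>
    taylor_sup H.A_nonneg H.bdd H.K_nonneg hB m hm
  have hc1 : 1 ≤ gamConst N A := one_le_gamConst H.A_nonneg
  set c := gamConst N A with hc
  set B := scale γ T with hBdef
  have hS : 0 ≤ ∑ m ∈ Finset.range (N + 2), Ct m := Finset.sum_nonneg fun m hm =>
    hCt0 m (by rw [Finset.mem_range] at hm; omega)
  refine ⟨c * M * (C₀ * B ^ (N + 1)) + (∑ m ∈ Finset.range (N + 2), Ct m) * (c * M),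
    by positivity, fun φ hφ w hw s t hs hst ht x => ?_⟩
  have hτ : 0 ≤ (t - s) ^ γ := Real.rpow_nonneg (by linarith) _
  have hτB := H.rpow_le_scale hs hst ht
  obtain ⟨k, hk⟩ : ∃ k, N + 1 - w.length = k + 1 := ⟨N - w.length, by omega⟩
  have hG : BddC (k + 1) (Gam f w φ) (c * M) :=
    bddC_Gam H.A_nonneg H.bdd (by omega) (by rwa [show k + 1 + w.length = N + 1 by omega])
  have h1 := hG.norm_sub_le (X x t) (roughStep γ f W s t (X x s))
  have h2 := hX x s t hs hst ht
  have h3 := hCt (k + 1) (by omega) ℝ _ _ hG _ _ hτ hτB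
    (H.size_of_le hs le_rfl hst le_rfl ht) (X x s)
  have h4 : Ct (k + 1) ≤ ∑ m ∈ Finset.range (N + 2), Ct m :=
    Finset.single_le_sum (f := Ct) (fun m hm => hCt0 m (by rw [Finset.mem_range] at hm; omega))
      (Finset.mem_range.2 (by omega))
  have h5 : ((t - s) ^ γ) ^ (N + 1) ≤ B ^ (N + 1) * ((t - s) ^ γ) ^ (k + 1) :=
    pow_le_mul_pow hτ hτB hB (by omega) le_rfl
  rw [rpow_natCast_mul' (by linarith)] at h2 ⊢
  rw [hk]
  simp only [Gam_append]
  have h6 := norm_sub_le_norm_sub_add_norm_sub (Gam f w φ (X x t))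
    (Gam f w φ (roughStep γ f W s t (X x s)))
    (sumWords (k + 1) fun v => incr W s t v • Gam f v (Gam f w φ) (X x s))
  refine h6.trans ((add_le_add h1 h3).trans ?_)
  rw [add_mul]
  have hcM : 0 ≤ c * M := by positivity
  refine add_le_add ?_ ?_
  · calc c * M * ‖X x t - roughStep γ f W s t (X x s)‖
        ≤ c * M * (C₀ * (B ^ (N + 1) * ((t - s) ^ γ) ^ (k + 1))) := by
          gcongr
          exact h2.trans (by gcongr)
      _ = _ := by ring
  · gcongr

variable [MeasurableSpace E] [BorelSpace E]

/-- The push-forward of a measure by the flow is a weak solution. -/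
lemma isWeakSolution_map (H : RoughData γ T f W A K) {X : E → ℝ → E} {C₀ : ℝ} (hC₀ : 0 ≤ C₀)
    (hX : ∀ x, IsIntegralCurve T (((level γ + 1 : ℕ) : ℝ) * γ) C₀ (roughStep γ f W) (X x))
    (hX0 : ∀ x, X x 0 = x) (hXm : ∀ t ∈ Icc 0 T, Continuous fun x => X x t) (μ : FiniteMeasure E) :
    IsWeakSolution γ T f W μ fun t => μ.map fun x => X x t := by
  refine ⟨?_, fun M => ?_⟩
  · apply Subtype.ext
    simp [hX0]
  obtain ⟨C, hC0, hC⟩ := H.exists_expansion_curve hC₀ hX (abs_nonneg M)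
  refine ⟨C * (μ : Measure E).real univ, fun φ hφ hφM w hw s hs t ht hst => ?_⟩
  have hφ' : BddC (level γ + 1) φ |M| := ⟨hφ, fun j hj x => (hφM j hj x).trans (le_abs_self M)⟩
  have hΓ : ∀ v : List (Fin d), v.length < level γ + 1 - w.length →
      BddC 0 (Gam f (v ++ w) φ) (gamConst (level γ) A * |M|) := fun v hv =>
    bddC_Gam H.A_nonneg H.bdd (by simp; omega) (hφ'.of_le (by simp; omega))
  have hΓw := hΓ [] (by simp; omega)
  rw [List.nil_append] at hΓw
  have hi : ∀ r ∈ Icc 0 T, ∀ {ψ : E → ℝ} {M' : ℝ}, BddC 0 ψ M' →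
      Integrable (fun x => ψ (X x r)) (μ : Measure E) := fun r hr ψ M' hψ =>
    Integrable.of_bound (hψ.continuous.comp (hXm r hr)).aestronglyMeasurable M'
      (ae_of_all _ fun x => hψ.norm_le _)
  have hm : ∀ r ∈ Icc 0 T, ∀ {ψ : E → ℝ} {M' : ℝ}, BddC 0 ψ M' →
      ∫ x, ψ x ∂((μ.map fun x => X x r : FiniteMeasure E) : Measure E) =
        ∫ x, ψ (X x r) ∂(μ : Measure E) := fun r hr ψ M' hψ => by
    rw [FiniteMeasure.toMeasure_map, integral_map (hXm r hr).aemeasurable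
      hψ.continuous.aestronglyMeasurable]
  rw [hm t ht hΓw, sumWords_congr fun v hv => by rw [hm s hs (hΓ v hv)]]
  obtain ⟨h1, h2⟩ := integral_sumWords (g := incr W s t) fun v hv => hi s hs (hΓ v hv)
  rw [← h2]
  refine (abs_integral_sub_le (hi t ht hΓw) h1
    (hC φ hφ' w hw s t hs.1 hst.le ht.2)).trans_eq ?_
  ring

end RoughData

namespace IsWeakSolution

variable [MeasurableSpace E] {μ : FiniteMeasure E} {ρ : ℝ → FiniteMeasure E}

/-- The total mass of a weak solution is bounded. -/
lemma exists_mass_le (H : RoughData γ T f W A K) (hρ : IsWeakSolution γ T f W μ ρ) :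
    ∃ B, 0 ≤ B ∧ ∀ t ∈ Icc 0 T, (ρ t : Measure E).real univ ≤ B := by
  obtain ⟨h0, h⟩ := hρ
  obtain ⟨C, hC⟩ := h 1
  set a : ℝ := ((level γ + 1 : ℕ) : ℝ) * γ with ha
  have ha0 : 0 < a := zero_lt_one.trans (one_lt_level_succ_mul H.γ_pos)
  have hT : 0 ≤ T := H.T_pos.le
  have hm0 : 0 ≤ (μ : Measure E).real univ := measureReal_nonneg
  refine ⟨(μ : Measure E).real univ + |C| * T ^ a, by positivity, fun t ht => ?_⟩
  rcases ht.1.eq_or_lt with rfl | ht0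
  · rw [h0]
    linarith [show 0 ≤ |C| * T ^ a by positivity]
  have h00 : (0 : ℝ) ∈ Icc 0 T := ⟨le_rfl, hT⟩
  -- Tested against the constant 1, all nonempty words drop out, so the total mass deviates from its
  -- initial value by at most C t^a.
  have hφ : BddC (level γ + 1) (fun _ : E => (1 : ℝ)) 1 := by
    simpa using BddC.const (k := level γ + 1) (E := E) (1 : ℝ)
  have h1 := hC _ hφ.1 hφ.2 [] (Nat.zero_le _) 0 h00 t ht ht0
  simp only [List.length_nil, Nat.sub_zero, List.append_nil, sub_zero] at h1
  rw [sumWords_succ, Finset.sum_eq_zero fun a _ => sumWords_eq_zero fun w _ => by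
    rw [Gam_const (by simp)]; simp, H.incr_nil h00 ht, h0] at h1
  simp only [Gam, integral_const, smul_eq_mul, mul_one, add_zero] at h1
  have h2 : C * t ^ a ≤ |C| * T ^ a := by
    have := Real.rpow_nonneg ht0.le a
    gcongr
    · exact le_abs_self C
    · exact ht.2
  linarith [le_abs_self ((ρ t : Measure E).real univ - (μ : Measure E).real univ)]

variable [BorelSpace E]

/-- A weak solution is transported by the one-step maps, up to errors of order `a > 1`. -/
lemma exists_step_le (H : RoughData γ T f W A K) (hρ : IsWeakSolution γ T f W μ ρ) {M : ℝ}
    (hM : 0 ≤ M) : ∃ C, 0 ≤ C ∧ ∀ φ : E → ℝ, BddC (level γ + 1) φ M →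
      ∀ s t, 0 ≤ s → s ≤ t → t ≤ T →
      |∫ x, φ x ∂(ρ t : Measure E) - ∫ x, φ (roughStep γ f W s t x) ∂(ρ s : Measure E)| ≤
        C * (t - s) ^ (((level γ + 1 : ℕ) : ℝ) * γ) := by
  obtain ⟨B, hB0, hB⟩ := hρ.exists_mass_le H
  obtain ⟨D, hD, hΨ⟩ := H.exists_isAlmostFlow
  obtain ⟨Ct, hCt0, hCt⟩ := taylor_sup H.A_nonneg H.bdd H.K_nonneg
    (RoughData.one_le_scale (γ := γ) (T := T)) (level γ + 1) le_rfl
  obtain ⟨C, hC⟩ := hρ.2 M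
  refine ⟨|C| + Ct * M * B, by positivity, fun φ hφ s t hs hst ht => ?_⟩
  have hs' : s ∈ Icc 0 T := ⟨hs, hst.trans ht⟩
  have ht' : t ∈ Icc 0 T := ⟨hs.trans hst, ht⟩
  have hpow : 0 ≤ (t - s) ^ (((level γ + 1 : ℕ) : ℝ) * γ) := Real.rpow_nonneg (by linarith) _
  rcases hst.eq_or_lt with rfl | hlt
  · simp only [hΨ.self hs', sub_self, abs_zero]
    positivity
  -- The definition with w empty already suffices: its sum is the ρ_s-integral of the Taylor
  -- polynomial of φ along the one-step map, and the bounded mass controls the integrated remainder.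
  have h1 := hC φ hφ.1 hφ.2 [] (Nat.zero_le _) s hs' t ht' hlt
  simp only [List.length_nil, Nat.sub_zero, List.append_nil] at h1
  have hΓ : ∀ v : List (Fin d), v.length < level γ + 1 → Integrable (Gam f v φ) (ρ s : Measure E) :=
    fun v hv => (bddC_Gam (j := 0) H.A_nonneg H.bdd (by omega)
      (hφ.of_le (by omega))).integrable _
  obtain ⟨h2, h3⟩ := integral_sumWords (g := incr W s t) hΓ
  rw [← h3] at h1
  have h4 := hCt ℝ φ M hφ _ _ (Real.rpow_nonneg (by linarith) γ) (H.rpow_le_scale hs hst ht)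
    (H.size_of_le hs le_rfl hst le_rfl ht)
  rw [← rpow_natCast_mul' (by linarith)] at h4
  have h5 : Integrable (fun x => φ (roughStep γ f W s t x)) (ρ s : Measure E) :=
    (hφ.comp ((hΨ.near_id s t hs hst ht).of_le (by omega))).integrable _
  have h6 := abs_integral_sub_le h5 h2 h4
  rw [abs_sub_comm] at h6
  have h7 := abs_sub_le (∫ x, φ x ∂(ρ t : Measure E))
    (∫ x, sumWords (level γ + 1) (fun w => incr W s t w • Gam f w φ x) ∂(ρ s : Measure E))
    (∫ x, φ (roughStep γ f W s t x) ∂(ρ s : Measure E))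
  refine h7.trans ((add_le_add h1 h6).trans ?_)
  rw [add_mul]
  refine add_le_add ?_ ?_
  · gcongr
    exact le_abs_self C
  · calc _ ≤ Ct * M * (t - s) ^ (((level γ + 1 : ℕ) : ℝ) * γ) * B := by
          gcongr
          exact hB s hs'
      _ = _ := by ring

/-- Weak solutions are transported by the flow. -/
lemma integral_eq (H : RoughData γ T f W A K) (hρ : IsWeakSolution γ T f W μ ρ) {X : E → ℝ → E}
    {C₀ : ℝ} (hC₀ : 0 ≤ C₀)
    (hX : ∀ x, IsIntegralCurve T (((level γ + 1 : ℕ) : ℝ) * γ) C₀ (roughStep γ f W) (X x))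
    (hX0 : ∀ x, X x 0 = x) (hXm : ∀ t ∈ Icc 0 T, Continuous fun x => X x t) {φ : E → ℝ} {M : ℝ}
    (hφ : BddC (level γ + 1) φ M) {t : ℝ} (ht : t ∈ Icc 0 T) :
    ∫ x, φ x ∂(ρ t : Measure E) = ∫ x, φ (X x t) ∂(μ : Measure E) := by
  obtain ⟨D, hD, hΨ⟩ := H.exists_isAlmostFlow
  obtain ⟨δ, K', M', hB⟩ := hΨ.exists_discreteBounds hD
  set a : ℝ := ((level γ + 1 : ℕ) : ℝ) * γ with ha
  have hM := hφ.nonneg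
  have hM' := hB.M_nonneg
  have hT := H.T_pos.le
  have hcomp : 1 ≤ BddC.compConst (level γ + 1) M' := BddC.one_le_compConst hM'
  -- The constant is taken for the larger class containing φ composed with every discrete flow,
  -- which is bounded in `C^{N+1}` independently of the partition.
  obtain ⟨C, hC0, hC⟩ := hρ.exists_step_le H
    (M := BddC.compConst (level γ + 1) M' * M) (by positivity)
  set m := (μ : Measure E).real univ with hm
  have hlim : Filter.Tendsto (fun n : ℕ => C * ((T / 2 ^ n) ^ (a - 1) * T) +
      M * ((1 + M') * (C₀ * ((T / 2 ^ n) ^ (a - 1) * T))) * m) Filter.atTop (nhds 0) := by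
    have h1 := (Real.continuous_rpow_const (q := a - 1) (by linarith [hΨ.one_lt])).tendsto 0 |>.comp
      (tendsto_mesh T)
    rw [Real.zero_rpow (by linarith [hΨ.one_lt])] at h1
    have h2 := ((h1.mul_const T).const_mul C).add
      (((((h1.mul_const T).const_mul C₀).const_mul (1 + M')).const_mul M).mul_const m)
    simpa using h2
  have hle : ∀ᶠ n : ℕ in Filter.atTop,
      |∫ x, φ x ∂(ρ t : Measure E) - ∫ x, φ (X x t) ∂(μ : Measure E)| ≤
      C * ((T / 2 ^ n) ^ (a - 1) * T) +
        M * ((1 + M') * (C₀ * ((T / 2 ^ n) ^ (a - 1) * T))) * m := by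
    filter_upwards [(tendsto_mesh T).eventually_le_const hB.δ_pos] with n hn
    have hp := isPartition_dyadic (n := n) ht
    have hf := isFine_dyadic (n := n) (t := t) hT
    have hf' : IsFine δ (dyadic T n t) := fun l => (hf l).trans hn
    have hp0 : dyadic T n t 0 = 0 := dyadic_zero ht.1
    have hpl : dyadic T n t (2 ^ n) = t := dyadic_last ht.2
    set p := dyadic T n t with hpdef
    have hψ : ∀ i j, i ≤ j → BddC (level γ + 1)
        (fun x => φ (discreteFlow (roughStep γ f W) p i j x)) (BddC.compConst (level γ + 1) M' * M) :=
      fun i j hij => hφ.comp (hB.near_id p hp hf' i j hij)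
    -- Duality: the integrals of φ ∘ (discrete flow from p j to t) against ρ at time p j run from
    -- the transported φ against μ at j = 0 to φ against ρ_t at the last index. Each step changes
    -- them by at most C times the step length to the power a.
    have h1 := dist_le_range_sum_of_dist_le (2 ^ n)
      (f := fun j => ∫ x, φ (discreteFlow (roughStep γ f W) p j (2 ^ n) x) ∂(ρ (p j) : Measure E))
      (d := fun j => C * (p (j + 1) - p j) ^ a) (fun {j} hj => by
        rw [dist_comm, Real.dist_eq]
        simp only [discreteFlow_eq_step hj]
        exact hC _ (hψ (j + 1) (2 ^ n) hj) _ _ (hp.nonneg j) (hp.mono (Nat.le_succ j)) (hp.le _))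
    rw [← Finset.mul_sum, dist_comm, Real.dist_eq] at h1
    simp only [discreteFlow_self, hp0, hpl, hρ.1] at h1
    have h2 := sum_rpow_le hΨ.one_lt hp hf (2 ^ n)
    have h3 : ∀ x, |φ (discreteFlow (roughStep γ f W) p 0 (2 ^ n) x) - φ (X x t)| ≤
        M * ((1 + M') * (C₀ * ((T / 2 ^ n) ^ (a - 1) * T))) := by
      intro x
      have h4 := hB.norm_curve_sub_le hΨ.one_lt (hX x) hC₀ hp hf hn (2 ^ n)
      rw [hpl, hp0, hX0, norm_sub_rev] at h4
      refine (hφ.norm_sub_le _ _).trans ?_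
      gcongr
    have h5 := abs_integral_sub_le (μ := (μ : Measure E)) ((hψ 0 _ (Nat.zero_le _)).integrable _)
      (Integrable.of_bound (hφ.continuous.comp (hXm t ht)).aestronglyMeasurable M
        (ae_of_all _ fun x => hφ.norm_le _)) h3
    have h6 := abs_sub_le (∫ x, φ x ∂(ρ t : Measure E))
      (∫ x, φ (discreteFlow (roughStep γ f W) p 0 (2 ^ n) x) ∂(μ : Measure E))
      (∫ x, φ (X x t) ∂(μ : Measure E))
    refine h6.trans (add_le_add (h1.trans ?_) h5)
    gcongr
  have := ge_of_tendsto hlim hle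
  exact sub_eq_zero.1 (abs_nonpos_iff.1 this)

end IsWeakSolution
end WeakSolutions

end RoughContinuity
-- The theorem
theorem mainTheorem2 {n d : ℕ} (γ T : ℝ) (hγ : 0 < γ) (hγ1 : γ ≤ 1) (hT : 0 < T)
    (f : Fin d → EuclideanSpace ℝ (Fin n) → EuclideanSpace ℝ (Fin n))
    (hf : ∀ i, RoughContinuity.IsCb (2 * RoughContinuity.level γ + 1) (f i))
    (W : ℝ → List (Fin d) → ℝ) (hW : RoughContinuity.IsWeaklyGeometricRoughPath γ T W) :
    ∃ X : EuclideanSpace ℝ (Fin n) → ℝ → EuclideanSpace ℝ (Fin n),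
      -- `X x` is the unique solution of the rough differential equation started from `x`
      (∀ x, RoughContinuity.IsRDESolution γ T f W x (X x) ∧
        ∀ Y : ℝ → EuclideanSpace ℝ (Fin n), RoughContinuity.IsRDESolution γ T f W x Y →
          ∀ t ∈ Set.Icc 0 T, Y t = X x t) ∧
      (∀ t ∈ Set.Icc 0 T, Measurable fun x => X x t) ∧
      ∀ μ : MeasureTheory.FiniteMeasure (EuclideanSpace ℝ (Fin n)),
        ∃ ρ : ℝ → MeasureTheory.FiniteMeasure (EuclideanSpace ℝ (Fin n)),
          RoughContinuity.IsWeakSolution γ T f W μ ρ ∧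
          (∀ ρ' : ℝ → MeasureTheory.FiniteMeasure (EuclideanSpace ℝ (Fin n)),
            RoughContinuity.IsWeakSolution γ T f W μ ρ' → ∀ t ∈ Set.Icc 0 T, ρ' t = ρ t) ∧
          ∀ t ∈ Set.Icc 0 T,
            (ρ t : MeasureTheory.Measure (EuclideanSpace ℝ (Fin n))) =
              (μ : MeasureTheory.Measure (EuclideanSpace ℝ (Fin n))).map (fun x => X x t) ∧
            ∀ φ : EuclideanSpace ℝ (Fin n) → ℝ,
              RoughContinuity.IsCb (RoughContinuity.level γ + 1) φ →
              ∫ x, φ x ∂(ρ t : MeasureTheory.Measure (EuclideanSpace ℝ (Fin n))) =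
                ∫ x, φ (X x t) ∂(μ : MeasureTheory.Measure (EuclideanSpace ℝ (Fin n))) := by
  obtain ⟨A, K, H⟩ := RoughContinuity.exists_roughData hγ hγ1 hT hf hW
  obtain ⟨D, hD, hΨ⟩ := H.exists_isAlmostFlow
  obtain ⟨X, C, hC, hX0, hX, hXc⟩ := hΨ.exists_flow hD hT
  refine ⟨X, fun x => ⟨?_, fun Y hY t ht => ?_⟩, fun t ht => (hXc t ht).measurable, fun μ =>
    ⟨fun t => μ.map fun x => X x t, H.isWeakSolution_map hC hX hX0 hXc μ, fun ρ' hρ' t ht => ?_,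
      fun t ht => ⟨MeasureTheory.FiniteMeasure.toMeasure_map _ _, fun φ hφ => ?_⟩⟩⟩
  · have h := H.isRDESolution hC (hX x)
    rwa [hX0] at h
  · obtain ⟨δ, K', M, hB⟩ := hΨ.exists_discreteBounds hD
    obtain ⟨hY0, C', hC', hYc⟩ := H.isIntegralCurve_of_isRDESolution hY
    exact hB.curve_unique hΨ.one_lt hYc hC' (hX x) hC (by rw [hY0, hX0]) ht
  -- Both families satisfy the same transport formula for all `C_b^{N+1}` test functions, and these
  -- separate finite measures.
  · have h : (ρ' t : MeasureTheory.Measure (EuclideanSpace ℝ (Fin n))) =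
        (μ.map fun x => X x t : MeasureTheory.FiniteMeasure (EuclideanSpace ℝ (Fin n))) :=
      RoughContinuity.ext_of_forall_bddC (RoughContinuity.level γ + 1) fun φ M hφ => by
        rw [hρ'.integral_eq H hC hX hX0 hXc hφ ht,
          (H.isWeakSolution_map hC hX hX0 hXc μ).integral_eq H hC hX hX0 hXc hφ ht]
    exact Subtype.ext h
  · obtain ⟨M, hM⟩ := hφ.exists_bddC
    exact (H.isWeakSolution_map hC hX hX0 hXc μ).integral_eq H hC hX hX0 hXc hM ht
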